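/- \textbf{Setting.} Let $(S,g)$ be a smooth Riemannian surface without boundary (Hausdorff), $M\subset S$ a set with interior $M^{\rm int}$. Let $H=\{h(y)\}$, $y\in Y\subset\mathbb R$ open, be a smooth immersed curve with smooth unit normal field $\nu$. Let $\mathcal M_0$ be an open set of directed unit speed geodesics $\gamma_{(y,\eta)}$, with coordinates $(y,\eta)$ in an open set $W\subset\mathbb R^2$: $\gamma_{(y,\eta)}(0)=h(y)$, $\langle\dot\gamma_{(y,\eta)}(0),h'(y)\rangle=\eta$, $\langle\dot\gamma_{(y,\eta)}(0),\nu(y)\rangle>0$. The geodesic $\gamma_{(y,\eta)}$ is considered on an open interval $I_{(y,\eta)}\ni0$, and the set of all $(y,\eta,t)$ with $(y,\eta)\in W$, $t\in I_{(y,\eta)}$ is open. Let $V\subset T^*S\setminus0$ be the set of all $(x,\xi)$ with $x=\gamma_{(y,\eta)}(t)\in M^{\rm int}$, $\xi\ne0$, $\xi(\dot\gamma_{(y,\eta)}(t))=0$ for some $(y,\eta,t)$. Assume that each $(x,\xi)\in V$ is conormal to exactly one geodesic in $\mathcal M_0$, at exactly one parameter value, i.e., $(y,\eta,t)$ is determined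 by $(x,\xi)$. Let $$\mathcal C:V\to T^*\mathcal M_0,\qquad \mathcal C(x,\xi)=\bigl(y,\eta,\ \xi(\partial_y\gamma_{(y,\eta)}(t)),\ \xi(\partial_\eta\gamma_{(y,\eta)}(t))\bigr)$$ be the canonical map of the geodesic X-ray transform. Fix $(p_1,\xi^1)\ne(p_2,\xi^2)$ in $V$ with $\mathcal C(p_1,\xi^1)=\mathcal C(p_2,\xi^2)$. \textbf{Theorem.} There are open conic neighborhoods $U^k\subset V$ of $(p_k,\xi^k)$, $k=1,2$, invariant under $\xi\mapsto-\xi$, such that the following holds. First, within any open conic neighborhoods of $(p_k,\xi^k)$ invariant under $\xi\mapsto-\xi$ there are open conic neighborhoods $V^k\subset U^k$ of $(p_k,\xi^k)$, $k=1,2$, also invariant under $\xi\mapsto-\xi$, with $\mathcal C(V^1)=\mathcal C(V^2)$. Second, let $V^k\subset U^k$ be any open conic neighborhoods of $(p_k,\xi^k)$ with $\mathcal C(V^1)=\mathcal C(V^2)$. Then $\mathcal C_k:=\mathcal C|_{V^k}$ are injective, $\mathcal C_{21}:=\mathcal C_2^{-1}\circ\mathcal C_1:V^1\to V^2$ sends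 $(p_1,\xi^1)$ to $(p_2,\xi^2)$, and (a) $\mathcal C_{21}:V^1\to V^2$ is a diffeomorphism, and its graph is a canonical relation: a relatively closed conic subset of $V^2\times V^1$, away from the zero sections, which is a smooth embedded submanifold, Lagrangian for the twisted symplectic form $\omega\oplus(-\omega)$ on $T^*S\times T^*S$; (b) for $(x_1,\zeta^1)\in V^1$ and $(x_2,\zeta^2)\in V^2$, one has $\mathcal C_{21}(x_1,\zeta^1)=(x_2,\zeta^2)$ if and only if there is a geodesic segment $\sigma:[0,1]\to S$ with $\sigma(s)=\gamma(t_1+s(t_2-t_1))$, $\gamma\in\mathcal M_0$, $t_1\neq t_2$, joining $x_1$ and $x_2$, such that $x_1$ and $x_2$ are conjugate to each other along $\sigma$ and $\zeta^1=\lambda J'(0)$, $\zeta^2=\lambda J'(1)$ for some $\lambda\ne0$, where $J$ is a non-trivial Jacobi field along $\sigma$ with $J(0)=J(1)=0$ (vectors and covectors being identified by $g$). Moreover, on each such geodesic segment, a non-trivial Jacobi field vanishing at both ends is unique up to multiplication by a constant. -/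

import Mathlib

open scoped Manifold ContDiff

noncomputable section

namespace XRay

/-- The coordinate plane. -/
abbrev Plane : Type := EuclideanSpace ℝ (Fin 2)

/-- The coordinate vectors of the plane. -/
def basisVec (i : Fin 2) : Plane := EuclideanSpace.single i 1

section Surface

variable {S : Type*} [TopologicalSpace S] [ChartedSpace Plane S] [IsManifold 𝓘(ℝ, Plane) ∞ S]

/-- Smooth Riemannian metrics on the surface `S`. -/
abbrev Metric (S : Type*) [TopologicalSpace S] [ChartedSpace Plane S]
    [IsManifold 𝓘(ℝ, Plane) ∞ S] :=
  Bundle.ContMDiffRiemannianMetric 𝓘(ℝ, Plane) ∞ Plane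
    (fun x : S => TangentSpace 𝓘(ℝ, Plane) x)

/-! ### Riemannian geometry in charts -/

/-- The Gram matrix `g_ij(z)` of the metric in the chart centred at `x₀`. -/
def gram (g : Metric S) (x₀ : S) (z : Plane) : Matrix (Fin 2) (Fin 2) ℝ :=
  Matrix.of fun i j =>
    g.inner ((extChartAt 𝓘(ℝ, Plane) x₀).symm z)
      (mfderiv 𝓘(ℝ, Plane) 𝓘(ℝ, Plane) (extChartAt 𝓘(ℝ, Plane) x₀).symm z (basisVec i))
      (mfderiv 𝓘(ℝ, Plane) 𝓘(ℝ, Plane) (extChartAt 𝓘(ℝ, Plane) x₀).symm z (basisVec j))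

/-- `∂_l g_ij`. -/
def dGram (g : Metric S) (x₀ : S) (l i j : Fin 2) (z : Plane) : ℝ :=
  fderiv ℝ (fun w => gram g x₀ w i j) z (basisVec l)

/-- The Christoffel symbols `Γ^k_ij = ½ g^{kl} (∂_i g_jl + ∂_j g_il - ∂_l g_ij)`. -/
def christoffel (g : Metric S) (x₀ : S) (k i j : Fin 2) (z : Plane) : ℝ :=
  (1 / 2 : ℝ) * ∑ l, (gram g x₀ z)⁻¹ k l *
    (dGram g x₀ i j l z + dGram g x₀ j i l z - dGram g x₀ l i j z)

/-- The vector with components `Γ^k_ij(z) u^i v^j`. -/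
def christoffelVec (g : Metric S) (x₀ : S) (z u v : Plane) : Plane :=
  ∑ k, (∑ i, ∑ j, christoffel g x₀ k i j z * u i * v j) • basisVec k

/-- `R^l_kij = ∂_i Γ^l_jk - ∂_j Γ^l_ik + Γ^l_im Γ^m_jk - Γ^l_jm Γ^m_ik`. -/
def curvCoeff (g : Metric S) (x₀ : S) (l k i j : Fin 2) (z : Plane) : ℝ :=
  fderiv ℝ (christoffel g x₀ l j k) z (basisVec i)
    - fderiv ℝ (christoffel g x₀ l i k) z (basisVec j)
    + ∑ m, (christoffel g x₀ l i m z * christoffel g x₀ m j k z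
      - christoffel g x₀ l j m z * christoffel g x₀ m i k z)

/-- The Riemann curvature `R(u, v) w`, in the chart centred at `x₀`. -/
def curvVec (g : Metric S) (x₀ : S) (z u v w : Plane) : Plane :=
  ∑ l, (∑ k, ∑ i, ∑ j, curvCoeff g x₀ l k i j z * u i * v j * w k) • basisVec l

/-- The velocity of a curve. -/
def velocity (c : ℝ → S) (t : ℝ) : TangentSpace 𝓘(ℝ, Plane) (c t) :=
  mfderiv 𝓘(ℝ, ℝ) 𝓘(ℝ, Plane) c t (1 : ℝ)

/-- A curve read in the chart centred at `x₀`. -/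
def coordCurve (x₀ : S) (c : ℝ → S) (t : ℝ) : Plane := extChartAt 𝓘(ℝ, Plane) x₀ (c t)

/-- A vector field along a curve read in the chart centred at `x₀`. -/
def coordField (x₀ : S) (c : ℝ → S) (J : ∀ t, TangentSpace 𝓘(ℝ, Plane) (c t)) (t : ℝ) : Plane :=
  mfderiv 𝓘(ℝ, Plane) 𝓘(ℝ, Plane) (extChartAt 𝓘(ℝ, Plane) x₀) (c t) (J t)

/-- The Levi-Civita covariant derivative along a coordinate curve `x` of a vector field with
coordinates `j`: `(Dj)^k = (j^k)' + Γ^k_il(x) (x^i)' j^l`. -/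
def chartCovDeriv (g : Metric S) (x₀ : S) (x j : ℝ → Plane) (t : ℝ) : Plane :=
  deriv j t + christoffelVec g x₀ (x t) (deriv x t) (j t)

/-- The covariant derivative `J'(t)` of a vector field along a curve. -/
def covDeriv (g : Metric S) (c : ℝ → S) (J : ∀ t, TangentSpace 𝓘(ℝ, Plane) (c t)) (t : ℝ) :
    TangentSpace 𝓘(ℝ, Plane) (c t) :=
  (mfderiv 𝓘(ℝ, Plane) 𝓘(ℝ, Plane) (extChartAt 𝓘(ℝ, Plane) (c t)) (c t)).inverse
    (chartCovDeriv g (c t) (coordCurve (c t) c) (coordField (c t) c J) t)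

/-- `c` is a (smooth, affinely parametrized) geodesic on the open set of times `T`:
`D_t c' = 0` in all charts. -/
def IsGeodesicOn (g : Metric S) (c : ℝ → S) (T : Set ℝ) : Prop :=
  ContMDiffOn 𝓘(ℝ, ℝ) 𝓘(ℝ, Plane) ∞ c T ∧
  ∀ t ∈ T, ∀ x₀ : S, c t ∈ (chartAt Plane x₀).source →
    chartCovDeriv g x₀ (coordCurve x₀ c) (deriv (coordCurve x₀ c)) t = 0

/-- `J` is a Jacobi field along the curve `c` on the open set of times `T`:
`D_t D_t J + R(J, c') c' = 0` in all charts. -/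
def IsJacobiOn (g : Metric S) (c : ℝ → S) (J : ∀ t, TangentSpace 𝓘(ℝ, Plane) (c t))
    (T : Set ℝ) : Prop :=
  ContMDiffOn 𝓘(ℝ, ℝ) (𝓘(ℝ, Plane).tangent) ∞
    (fun t => (⟨c t, J t⟩ : TangentBundle 𝓘(ℝ, Plane) S)) T ∧
  ∀ t ∈ T, ∀ x₀ : S, c t ∈ (chartAt Plane x₀).source →
    chartCovDeriv g x₀ (coordCurve x₀ c)
        (chartCovDeriv g x₀ (coordCurve x₀ c) (coordField x₀ c J)) t
      + curvVec g x₀ (coordCurve x₀ c t) (coordField x₀ c J t)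
          (deriv (coordCurve x₀ c) t) (deriv (coordCurve x₀ c) t) = 0

/-- A Jacobi field on `T ∋ 0, 1` that is not identically zero and vanishes at times `0` and `1`.
Its existence means that `c 0` and `c 1` are conjugate to each other along `c`. -/
def IsConjugacyField (g : Metric S) (c : ℝ → S) (J : ∀ t, TangentSpace 𝓘(ℝ, Plane) (c t))
    (T : Set ℝ) : Prop :=
  IsJacobiOn g c J T ∧ (∃ t ∈ T, J t ≠ 0) ∧ J 0 = 0 ∧ J 1 = 0

/-! ### The cotangent bundle -/

/-- The cotangent bundle `T*S`. -/
abbrev Cotangent (S : Type*) [TopologicalSpace S] [ChartedSpace Plane S]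
    [IsManifold 𝓘(ℝ, Plane) ∞ S] : Type _ :=
  Bundle.TotalSpace (Plane →L[ℝ] ℝ)
    (fun x : S => TangentSpace 𝓘(ℝ, Plane) x →L[ℝ] Bundle.Trivial S ℝ x)

/-- The model of the cotangent bundle as a manifold. -/
abbrev cotModel := (𝓘(ℝ, Plane)).prod 𝓘(ℝ, Plane →L[ℝ] ℝ)

/-- Multiplication of a covector by a scalar. -/
def scale (r : ℝ) (q : Cotangent S) : Cotangent S := ⟨q.proj, r • q.snd⟩

/-- Conic sets: invariant under `(x, ξ) ↦ (x, rξ)`, `r > 0`. -/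
def IsConic (A : Set (Cotangent S)) : Prop := ∀ q ∈ A, ∀ r : ℝ, 0 < r → scale r q ∈ A

/-- Sets invariant under `(x, ξ) ↦ (x, -ξ)`. -/
def IsEven (A : Set (Cotangent S)) : Prop := ∀ q ∈ A, scale (-1) q ∈ A

/-- The canonical symplectic form `dξ_i ∧ dx^i` of `T*S` at `q`. The chart of `T*S` centred at `q`
is the one with the canonical coordinates `(x, ξ)` induced by the chart of `S` centred at the base
point of `q`. -/
def symplecticForm (q : Cotangent S) (v w : TangentSpace cotModel q) : ℝ :=
  let v' : Plane × (Plane →L[ℝ] ℝ) :=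
    mfderiv cotModel 𝓘(ℝ, Plane × (Plane →L[ℝ] ℝ)) (extChartAt cotModel q) q v
  let w' : Plane × (Plane →L[ℝ] ℝ) :=
    mfderiv cotModel 𝓘(ℝ, Plane × (Plane →L[ℝ] ℝ)) (extChartAt cotModel q) q w
  v'.2 w'.1 - w'.2 v'.1

/-- `Λ ⊆ A` is a canonical relation in the open set `A` of `T*S × T*S`: it avoids the zero
sections, is relatively closed in `A`, conic, and a smooth embedded submanifold of dimension `4`
(half of the dimension of `T*S × T*S`), given locally by embeddings `z ↦ (φ z, ψ z)`, on which the
twisted symplectic form `ω ⊕ (-ω)` vanishes. -/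
def IsCanonicalRelation (Λ A : Set (Cotangent S × Cotangent S)) : Prop :=
  (∀ q ∈ Λ, q.1.snd ≠ 0 ∧ q.2.snd ≠ 0) ∧
  (∃ F : Set (Cotangent S × Cotangent S), IsClosed F ∧ Λ = F ∩ A) ∧
  (∀ q ∈ Λ, ∀ r : ℝ, 0 < r → (scale r q.1, scale r q.2) ∈ Λ) ∧
  ∀ q ∈ Λ, ∃ (O : Set (Plane × (Plane →L[ℝ] ℝ))) (N : Set (Cotangent S × Cotangent S))
    (φ ψ : Plane × (Plane →L[ℝ] ℝ) → Cotangent S),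
    IsOpen O ∧ IsOpen N ∧ q ∈ N ∧ (fun z => (φ z, ψ z)) '' O = Λ ∩ N ∧
    Topology.IsEmbedding (O.domRestrict fun z => (φ z, ψ z)) ∧
    ContMDiffOn 𝓘(ℝ, Plane × (Plane →L[ℝ] ℝ)) cotModel ∞ φ O ∧
    ContMDiffOn 𝓘(ℝ, Plane × (Plane →L[ℝ] ℝ)) cotModel ∞ ψ O ∧
    ∀ z ∈ O,
      (∀ v, mfderiv 𝓘(ℝ, Plane × (Plane →L[ℝ] ℝ)) cotModel φ z v = 0 →
        mfderiv 𝓘(ℝ, Plane × (Plane →L[ℝ] ℝ)) cotModel ψ z v = 0 → v = 0) ∧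
      ∀ v w,
        symplecticForm (φ z)
            (mfderiv 𝓘(ℝ, Plane × (Plane →L[ℝ] ℝ)) cotModel φ z v)
            (mfderiv 𝓘(ℝ, Plane × (Plane →L[ℝ] ℝ)) cotModel φ z w)
          - symplecticForm (ψ z)
            (mfderiv 𝓘(ℝ, Plane × (Plane →L[ℝ] ℝ)) cotModel ψ z v)
            (mfderiv 𝓘(ℝ, Plane × (Plane →L[ℝ] ℝ)) cotModel ψ z w) = 0

/-- `Φ` restricts to a diffeomorphism from the open set `A` onto the open set `B`. -/
def IsDiffeoOn (Φ : Cotangent S → Cotangent S) (A B : Set (Cotangent S)) : Prop :=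
  Set.BijOn Φ A B ∧ ContMDiffOn cotModel cotModel ∞ Φ A ∧
  ∃ Ψ : Cotangent S → Cotangent S, Set.InvOn Ψ Φ A B ∧ ContMDiffOn cotModel cotModel ∞ Ψ B

/-! ### The manifold of geodesics and the canonical relation of the X-ray transform -/

/-- An open set of directed unit speed geodesics, in the chart given by a hypersurface (a curve)
`H = {h y}` with smooth unit normal `ν`: the geodesic with coordinates `(y, η)` starts at time `0`
at `h y`, on the side of `ν`, and its direction projects to the vector in `T_{h y} H` whose
dual coordinate is `η`. The geodesics are considered on open intervals `dom (y, η)` of times. -/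
structure GeodesicManifold (g : Metric S) where
  /-- the range of the coordinate on the hypersurface -/
  Y : Set ℝ
  /-- the hypersurface -/
  h : ℝ → S
  /-- the unit normal field -/
  ν : ∀ y, TangentSpace 𝓘(ℝ, Plane) (h y)
  /-- the range of the coordinates of the geodesics -/
  W : Set (ℝ × ℝ)
  /-- the interval of times on which a geodesic is considered -/
  dom : ℝ × ℝ → Set ℝ
  /-- the geodesics -/
  γ : ℝ × ℝ → ℝ → S
  isOpen_Y : IsOpen Y
  smooth_h : ContMDiffOn 𝓘(ℝ, ℝ) 𝓘(ℝ, Plane) ∞ h Y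
  immersion_h : ∀ y ∈ Y, velocity h y ≠ 0
  smooth_ν : ContMDiffOn 𝓘(ℝ, ℝ) (𝓘(ℝ, Plane).tangent) ∞
    (fun y => (⟨h y, ν y⟩ : TangentBundle 𝓘(ℝ, Plane) S)) Y
  unit_ν : ∀ y ∈ Y, g.inner (h y) (ν y) (ν y) = 1
  normal_ν : ∀ y ∈ Y, g.inner (h y) (ν y) (velocity h y) = 0
  isOpen_W : IsOpen W
  fst_mem : ∀ p ∈ W, p.1 ∈ Y
  isOpen_dom : IsOpen {a : (ℝ × ℝ) × ℝ | a.1 ∈ W ∧ a.2 ∈ dom a.1}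
  interval_dom : ∀ p ∈ W, (dom p).OrdConnected
  zero_mem : ∀ p ∈ W, (0 : ℝ) ∈ dom p
  geodesic : ∀ p ∈ W, IsGeodesicOn g (γ p) (dom p)
  start : ∀ p ∈ W, γ p 0 = h p.1
  direction : ∀ p ∈ W, ∃ θ : TangentSpace 𝓘(ℝ, Plane) (h p.1),
    (⟨γ p 0, velocity (γ p) 0⟩ : TangentBundle 𝓘(ℝ, Plane) S) = ⟨h p.1, θ⟩ ∧
    g.inner (h p.1) θ θ = 1 ∧ g.inner (h p.1) θ (velocity h p.1) = p.2 ∧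
    0 < g.inner (h p.1) θ (ν p.1)

namespace GeodesicManifold

variable {g : Metric S} (𝓜 : GeodesicManifold g)

/-- `ξ` is a nonzero covector at the point with parameter `t` of the geodesic with coordinates `p`,
conormal to the geodesic; the point is in the interior of `M`. -/
def IsConormal (M : Set S) (p : ℝ × ℝ) (t : ℝ)
    (ξ : TangentSpace 𝓘(ℝ, Plane) (𝓜.γ p t) →L[ℝ] ℝ) : Prop :=
  p ∈ 𝓜.W ∧ t ∈ 𝓜.dom p ∧ 𝓜.γ p t ∈ interior M ∧ ξ ≠ 0 ∧ ξ (velocity (𝓜.γ p) t) = 0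

/-- The Jacobi field `∂γ/∂y`. -/
def dy (p : ℝ × ℝ) (t : ℝ) : TangentSpace 𝓘(ℝ, Plane) (𝓜.γ p t) :=
  mfderiv 𝓘(ℝ, ℝ) 𝓘(ℝ, Plane) (fun y => 𝓜.γ (y, p.2) t) p.1 (1 : ℝ)

/-- The Jacobi field `∂γ/∂η`. -/
def dη (p : ℝ × ℝ) (t : ℝ) : TangentSpace 𝓘(ℝ, Plane) (𝓜.γ p t) :=
  mfderiv 𝓘(ℝ, ℝ) 𝓘(ℝ, Plane) (fun η => 𝓜.γ (p.1, η) t) p.2 (1 : ℝ)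

/-- The canonical relation `C = N*Z₀'` of the X-ray transform over `M`, where
`Z₀` is the point-geodesic relation: the set of all `((p, Γ), (x, ξ))` such that `x = γ(p, t)` for
some `t`, `ξ ≠ 0`, `ξ(γ') = 0`, `Γ = (ξ(∂γ/∂y), ξ(∂γ/∂η))`. -/
def relC (M : Set S) : Set (((ℝ × ℝ) × (ℝ × ℝ)) × Cotangent S) :=
  {a | ∃ (p : ℝ × ℝ) (t : ℝ) (ξ : TangentSpace 𝓘(ℝ, Plane) (𝓜.γ p t) →L[ℝ] ℝ),
    𝓜.IsConormal M p t ξ ∧ a = ((p, (ξ (𝓜.dy p t), ξ (𝓜.dη p t))), ⟨𝓜.γ p t, ξ⟩)}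

/-- `V = π_M(C)`, the union of the conormal bundles (without zero) of the geodesics. -/
def V (M : Set S) : Set (Cotangent S) := Prod.snd '' 𝓜.relC M

/-- Each element of `V` is conormal to exactly one geodesic of the family, at exactly one point
of it; in other words, the projection `π_M : C → V` is injective. -/
def UniqueConormal (M : Set S) : Prop :=
  ∀ (p p' : ℝ × ℝ) (t t' : ℝ) (ξ : TangentSpace 𝓘(ℝ, Plane) (𝓜.γ p t) →L[ℝ] ℝ)
    (ξ' : TangentSpace 𝓘(ℝ, Plane) (𝓜.γ p' t') →L[ℝ] ℝ),
    𝓜.IsConormal M p t ξ → 𝓜.IsConormal M p' t' ξ' →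
    (⟨𝓜.γ p t, ξ⟩ : Cotangent S) = ⟨𝓜.γ p' t', ξ'⟩ → p = p' ∧ t = t'

/-- The canonical map `𝒞 = π_𝓜 ∘ π_M⁻¹` on `V`, with values in `T*𝓜₀` (coordinates
`((y, η), (ŷ, η̂))`). -/
def mapC (M : Set S) (q : Cotangent S) : (ℝ × ℝ) × (ℝ × ℝ) :=
  Classical.epsilon fun z => (z, q) ∈ 𝓜.relC M

/-- `𝒞₂₁ = 𝒞₂⁻¹ ∘ 𝒞₁`, where `𝒞₂` is the restriction of `𝒞` to `V₂`. -/
def mapC21 (M : Set S) (V₂ : Set (Cotangent S)) (q : Cotangent S) : Cotangent S :=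
  @Function.invFunOn _ _ ⟨q⟩ (𝓜.mapC M) V₂ (𝓜.mapC M q)

/-- The piece of the geodesic with coordinates `p` from time `t₁` to time `t₂`, reparametrized
by `[0, 1]`. -/
def segment (p : ℝ × ℝ) (t₁ t₂ : ℝ) (s : ℝ) : S := 𝓜.γ p (t₁ + s * (t₂ - t₁))

/-- The times at which the reparametrized geodesic is defined. -/
def segmentDom (p : ℝ × ℝ) (t₁ t₂ : ℝ) : Set ℝ := {s | t₁ + s * (t₂ - t₁) ∈ 𝓜.dom p}

/-- There is a geodesic `σ : [0, 1] → S` in the family joining the base points of `q₁` and `q₂`,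
these are conjugate to each other along `σ`, and `ξ¹ = λ J'(0)`, `ξ² = λ J'(1)` with `λ ≠ 0`, where
`J` is a nontrivial Jacobi field along `σ` with `J(0) = J(1) = 0` (covectors and vectors are
identified by the metric). -/
def ConjugateRelated (q₁ q₂ : Cotangent S) : Prop :=
  ∃ p ∈ 𝓜.W, ∃ t₁ ∈ 𝓜.dom p, ∃ t₂ ∈ 𝓜.dom p, t₁ ≠ t₂ ∧
    ∃ J : ∀ s, TangentSpace 𝓘(ℝ, Plane) (𝓜.segment p t₁ t₂ s),
      IsConjugacyField g (𝓜.segment p t₁ t₂) J (𝓜.segmentDom p t₁ t₂) ∧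
      ∃ l : ℝ, l ≠ 0 ∧
        q₁ = ⟨𝓜.segment p t₁ t₂ 0,
          l • g.inner (𝓜.segment p t₁ t₂ 0) (covDeriv g (𝓜.segment p t₁ t₂) J 0)⟩ ∧
        q₂ = ⟨𝓜.segment p t₁ t₂ 1,
          l • g.inner (𝓜.segment p t₁ t₂ 1) (covDeriv g (𝓜.segment p t₁ t₂) J 1)⟩

/-- A Jacobi field along a geodesic segment of the family vanishing at both ends is unique up to
multiplication by a constant. -/
def ConjugacyFieldUnique : Prop :=
  ∀ p ∈ 𝓜.W, ∀ t₁ ∈ 𝓜.dom p, ∀ t₂ ∈ 𝓜.dom p, t₁ ≠ t₂ →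
    ∀ J J' : ∀ s, TangentSpace 𝓘(ℝ, Plane) (𝓜.segment p t₁ t₂ s),
      IsConjugacyField g (𝓜.segment p t₁ t₂) J (𝓜.segmentDom p t₁ t₂) →
      IsConjugacyField g (𝓜.segment p t₁ t₂) J' (𝓜.segmentDom p t₁ t₂) →
      ∃ k : ℝ, ∀ s ∈ 𝓜.segmentDom p t₁ t₂, J' s = k • J s

end GeodesicManifold

end Surface

end XRay

end

/-!
The geodesics of the family depend smoothly on all variables: the initial velocity is a smooth
function of `(y, η)`, the local flow of the geodesic equation in a chart is smooth, and a geodesic of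
the Hausdorff surface `S` cannot branch off from the flow (`smoothNear`). Let `γ` denote the map
`(y, η, t) ↦ γ_(y, η)(t)`. By the Euler-Lagrange equations the pairing of the velocity with a
variation is constant along geodesics, so the pullback of the one-form `g(γ', ·)` under `γ` is the
contact form `η dy + dt` (`coordMom_fderiv`). Its exterior derivative is `dη ∧ dy`
(`fderiv_coordMom`), which is nondegenerate in `(y, η)`, and everything else rests on these two
identities.

*Jacobi fields.* The fields `∂_m γ + d s γ'` along a segment of a geodesic of the family, where `m`
is a constant vector and `d` a constant, satisfy the Jacobi equation, which is the linearized geodesic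
equation. By the two identities they are independent to first order (`eq_zero_of_jacobi_eq_zero`).
They form a space of dimension four, so they are all Jacobi fields (`exists_eq_variationField`). If
such a field vanishes at both ends, the contact form shows that it is `∂_m γ` with
`m = (a, b, -η a)`, and `dη ∧ dy` forces the pairs `(a, b)` of two such fields to be parallel, which
is the uniqueness statement (`conjugacyFieldUnique`). At a zero of the field, the pairings of its
covariant derivative with `∂_y γ` and `∂_η γ` are `L b` and `-L a`, where `L` is the length of the
parameter interval (with its sign), whichever zero is taken (`inner_covDeriv_variationField`).

*The canonical map.* Near a covector of `V` the triple `(y, η, t)` is a smooth function of the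
covector, because conormal covectors are parametrized by `(y, η, t)` and a scalar, and the derivative
of this parametrization is injective by the first order independence above
(`exists_conormalCoord_homeomorph`). Differentiating `γ(y, η, t) = x` and applying `ξ`, which
annihilates `γ'`, shows that `𝒞` pulls back the canonical one-form `ŷ dy + η̂ dη` to `ξ dx`
(`exists_contDiffOn_mapC`). Hence `𝒞` preserves the symplectic forms (`symplecticForm_eq`), is a
local diffeomorphism (`exists_local_inverse`), avoids the zero section, and separates the covectors
conormal to a geodesic at one and the same time (`eq_of_isParam`). It is homogeneous in the fibres, so
injectivity near a covector extends to a conic neighborhood (`exists_conic_nhd`). The two given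
covectors are conormal to the same geodesic at different times, and the neighborhoods are taken so
small that this persists. The graph of `𝒞₂₁` is given by the equation `𝒞(x, ξ) = 𝒞(y, ζ)`, hence it
is relatively closed, conic and Lagrangian (`isCanonicalRelation_mapC21`).

*Conjugate points.* If two covectors have the same image `(y, η, ŷ, η̂)`, the variation `∂_m γ` with
`m = (-η̂, ŷ, η η̂)` is annihilated by the covectors and by `g(γ', ·)`, so it vanishes at both points.
By the formula for its covariant derivative, the covectors are dual to multiples of that derivative
by the same constant (`conjugateRelated`). The same formula gives the converse
(`mapC_eq_of_conjugateRelated`).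
-/

open scoped Manifold ContDiff

noncomputable section

namespace XRay

open Set Filter Metric
open scoped Topology

/-! ### Smooth dependence of solutions of ordinary differential equations -/

section ODE

universe u

/-- The inverse function theorem for smooth maps, with a smooth inverse on the whole target. -/
theorem exists_openPartialHomeomorph_of_contDiffOn {E F : Type*} [NormedAddCommGroup E]
    [NormedSpace ℝ E] [CompleteSpace E] [NormedAddCommGroup F] [NormedSpace ℝ F] {f : E → F}
    {U : Set E} (hU : IsOpen U) (hf : ContDiffOn ℝ ∞ f U) {a : E} (ha : a ∈ U) (f' : E ≃L[ℝ] F)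
    (hf' : HasFDerivAt f (f' : E →L[ℝ] F) a) :
    ∃ e : OpenPartialHomeomorph E F, a ∈ e.source ∧ e.source ⊆ U ∧ ⇑e = f ∧
      ContDiffOn ℝ ∞ e.symm e.target := by
  have hfa : ContDiffAt ℝ ∞ f a := hf.contDiffAt (hU.mem_nhds ha)
  let e₀ := hfa.toOpenPartialHomeomorph f hf' (by simp)
  have hcont : ContinuousOn (fderiv ℝ f) U := hf.continuousOn_fderiv_of_isOpen hU (by simp)
  let s : Set E := U ∩ fderiv ℝ f ⁻¹' range ((↑) : (E ≃L[ℝ] F) → E →L[ℝ] F)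
  -- On the open set `s` the derivative is invertible, so the inverse is smooth on its whole domain.
  have hs : IsOpen s := hcont.isOpen_inter_preimage hU ContinuousLinearEquiv.isOpen
  have has : a ∈ s := ⟨ha, f', by rw [hf'.fderiv]⟩
  refine ⟨e₀.restrOpen s hs, ⟨hfa.mem_toOpenPartialHomeomorph_source hf' (by simp), has⟩,
    fun x hx => hx.2.1, rfl, ?_⟩
  intro y hy
  have hy' : (e₀.restrOpen s hs).symm y ∈ (e₀.restrOpen s hs).source :=
    (e₀.restrOpen s hs).map_target hy
  obtain ⟨hxU, g', hg'⟩ := hy'.2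
  have hx : ContDiffAt ℝ ∞ f ((e₀.restrOpen s hs).symm y) := hf.contDiffAt (hU.mem_nhds hxU)
  refine ((e₀.restrOpen s hs).contDiffAt_symm hy (f₀' := g') ?_ hx).contDiffWithinAt
  rw [hg']
  exact (hx.differentiableAt (by simp)).hasFDerivAt

variable {K : Type*} [TopologicalSpace K] [CompactSpace K]

/-- Pointwise application of a continuous family of operators to a continuous family of vectors,
as a continuous bilinear map. -/
def applyL (K : Type*) [TopologicalSpace K] [CompactSpace K]
    (E F : Type*) [NormedAddCommGroup E] [NormedSpace ℝ E]
    [NormedAddCommGroup F] [NormedSpace ℝ F] :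
    C(K, E →L[ℝ] F) →L[ℝ] C(K, E) →L[ℝ] C(K, F) :=
  LinearMap.mkContinuous₂
    (LinearMap.mk₂ ℝ
      (fun (A : C(K, E →L[ℝ] F)) (h : C(K, E)) =>
        (⟨fun k => A k (h k), by fun_prop⟩ : C(K, F)))
      (by intros; ext; simp) (by intros; ext; simp) (by intros; ext; simp)
      (by intros; ext; simp)) 1 (by
    intro A h
    rw [one_mul, ContinuousMap.norm_le _ (by positivity)]
    intro k
    refine ((A k).le_opNorm _).trans ?_
    gcongr
    exacts [A.norm_coe_le_norm k, h.norm_coe_le_norm k])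

/-- Composition with `f` on continuous functions on a compact space is differentiable: the remainder
is uniformly small because `f'` is uniformly continuous near the compact range of `u`. -/
theorem hasFDerivAt_continuousMap_comp {E F : Type*} [NormedAddCommGroup E] [NormedSpace ℝ E]
    [NormedAddCommGroup F] [NormedSpace ℝ F] (f : C(E, F)) (f' : C(E, E →L[ℝ] F))
    (hf : ∀ x, HasFDerivAt f (f' x) x) (u : C(K, E)) :
    HasFDerivAt (fun u : C(K, E) => f.comp u) (applyL K E F (f'.comp u)) u := by
  rw [hasFDerivAt_iff_isLittleO_nhds_zero, Asymptotics.isLittleO_iff]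
  intro ε hε
  have hc : IsCompact (range u) := isCompact_range u.continuous
  have h1 := hc.uniformContinuousAt_of_continuousAt f' (fun a _ => f'.continuous.continuousAt)
    (Metric.dist_mem_uniformity hε)
  obtain ⟨δ, hδ, h2⟩ := Metric.mem_uniformity_dist.1 h1
  filter_upwards [Metric.ball_mem_nhds (0 : C(K, E)) hδ] with h hh
  rw [mem_ball_zero_iff] at hh
  rw [ContinuousMap.norm_le _ (by positivity)]
  intro k
  have h3 : ∀ y ∈ ball (u k) δ, ‖f' y - f' (u k)‖ ≤ ε := by
    intro y hy
    have := @h2 (u k) y (by rwa [mem_ball, dist_comm] at hy) ⟨k, rfl⟩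
    simp only [mem_ofPred_eq] at this
    rw [dist_comm, dist_eq_norm] at this
    exact this.le
  have hk : ‖h k‖ < δ := (h.norm_coe_le_norm k).trans_lt hh
  have h4 := Convex.norm_image_sub_le_of_norm_hasFDerivWithin_le' (f := f) (s := ball (u k) δ)
    (f' := f') (φ := f' (u k)) (C := ε) (fun x _ => (hf x).hasFDerivWithinAt) h3
    (convex_ball _ _) (mem_ball_self hδ) (y := u k + h k) (by simpa using hk)
  simp only [add_sub_cancel_left] at h4
  calc _ = ‖f (u k + h k) - f (u k) - f' (u k) (h k)‖ := rfl
    _ ≤ ε * ‖h k‖ := h4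
    _ ≤ ε * ‖h‖ := by gcongr; exact h.norm_coe_le_norm k

/-- By induction, since the derivative of composition with `f` is, up to the continuous linear map
`applyL`, composition with `f'`. -/
theorem contDiff_nat_continuousMap_comp {E : Type u} [NormedAddCommGroup E] [NormedSpace ℝ E]
    (n : ℕ) : ∀ {F : Type u} [NormedAddCommGroup F] [NormedSpace ℝ F] (f : C(E, F)),
    ContDiff ℝ n f → ContDiff ℝ n (fun u : C(K, E) => f.comp u) := by
  induction n with
  | zero =>
    intro F _ _ f _
    exact contDiff_zero.2 (ContinuousMap.continuous_postcomp f)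
  | succ n ih =>
    intro F _ _ f hf
    have hf1 : ContDiff ℝ n (fderiv ℝ f) :=
      hf.fderiv_right (by norm_cast)
    have hd : Differentiable ℝ f := hf.differentiable (by simp)
    let f' : C(E, E →L[ℝ] F) := ⟨fderiv ℝ f, hf1.continuous⟩
    push_cast
    refine (contDiff_succ_iff_hasFDerivAt (n := n)).2 ⟨fun u => applyL K E F (f'.comp u), ?_, ?_⟩
    · exact (applyL K E F).contDiff.comp (ih f' hf1)
    · intro u
      exact hasFDerivAt_continuousMap_comp f f' (fun x => (hd x).hasFDerivAt) u

/-- Composition with a smooth map is a smooth map between spaces of continuous functions. -/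
theorem contDiff_continuousMap_comp {E F : Type u} [NormedAddCommGroup E] [NormedSpace ℝ E]
    [NormedAddCommGroup F] [NormedSpace ℝ F] (f : C(E, F)) (hf : ContDiff ℝ ∞ f) :
    ContDiff ℝ ∞ (fun u : C(K, E) => f.comp u) :=
  contDiff_infty.2 fun n => contDiff_nat_continuousMap_comp n f (hf.of_le (by exact_mod_cast le_top))

/-- The primitive vanishing at `0` of a continuous function on `[-2, 2]`, as a continuous linear
map. -/
def primitiveL (E : Type*) [NormedAddCommGroup E] [NormedSpace ℝ E] [CompleteSpace E] :
    C(Icc (-2 : ℝ) 2, E) →L[ℝ] C(Icc (-2 : ℝ) 2, E) :=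
  LinearMap.mkContinuous
    { toFun := fun u => ⟨fun s => ∫ r in (0 : ℝ)..s, IccExtend (by norm_num : (-2 : ℝ) ≤ 2) u r, by
        have : Continuous (IccExtend (by norm_num : (-2 : ℝ) ≤ 2) u) := by fun_prop
        exact (intervalIntegral.continuous_primitive
          (fun a b => this.intervalIntegrable a b) 0).comp continuous_subtype_val⟩
      map_add' := by
        intro u v
        ext s
        simp only [ContinuousMap.coe_mk, ContinuousMap.add_apply]
        rw [← intervalIntegral.integral_add]
        · rfl
        · exact Continuous.intervalIntegrable (by fun_prop) _ _
        · exact Continuous.intervalIntegrable (by fun_prop) _ _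
      map_smul' := by
        intro c u
        ext s
        simp only [ContinuousMap.coe_mk, ContinuousMap.smul_apply, RingHom.id_apply]
        rw [← intervalIntegral.integral_smul]
        rfl } 2 (by
    intro u
    rw [ContinuousMap.norm_le _ (by positivity)]
    intro s
    have h := intervalIntegral.norm_integral_le_of_norm_le_const (a := 0) (b := (s : ℝ))
      (f := IccExtend (by norm_num : (-2 : ℝ) ≤ 2) u) (C := ‖u‖)
      (fun x _ => u.norm_coe_le_norm _)
    refine h.trans ?_
    rw [mul_comm]
    gcongr
    have := s.2
    rw [sub_zero, abs_le]
    exact this)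

/-- Smooth dependence on the initial value `x` and on the speed `τ` for `U' = τ f(U)`, `U(0) = x`,
near `τ = 0`, from the inverse function theorem applied to `(x, τ, u) ↦ (x, τ, u - x - τ ∫ f(u))`,
whose derivative at `τ = 0` is invertible. -/
theorem exists_smooth_flow_of_contDiff {E : Type u} [NormedAddCommGroup E] [NormedSpace ℝ E]
    [CompleteSpace E] (f : E → E) (hf : ContDiff ℝ ∞ f) (x₀ : E) {r : ℝ} (hr : 0 < r) :
    ∃ A ∈ 𝓝 x₀, ∃ δ > 0, ∃ U : E → ℝ → ℝ → E,
      (∀ x ∈ A, ∀ τ ∈ Ioo (-δ) δ, ContDiffAt ℝ ∞ (fun a : E × ℝ => U a.1 a.2 1) (x, τ)) ∧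
      ∀ x ∈ A, ∀ τ ∈ Ioo (-δ) δ, U x τ 0 = x ∧ ∀ s ∈ Ioo (-2 : ℝ) 2,
        U x τ s ∈ ball x₀ r ∧ HasDerivAt (U x τ) (τ • f (U x τ s)) s := by
  let C := C(Icc (-2 : ℝ) 2, E)
  let f₀ : C(E, E) := ⟨f, hf.continuous⟩
  let cst : E →L[ℝ] C := ContinuousLinearMap.const ℝ (Icc (-2 : ℝ) 2)
  have hN : ContDiff ℝ ∞ (fun u : C => f₀.comp u) := contDiff_continuousMap_comp f₀ hf
  let Ψ : (E × ℝ) × C → (E × ℝ) × C := fun a =>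
    (a.1, a.2 - cst a.1.1 - a.1.2 • primitiveL E (f₀.comp a.2))
  have hΨ : ContDiff ℝ ∞ Ψ := by
    refine contDiff_fst.prodMk ((contDiff_snd.sub (cst.contDiff.comp
      (contDiff_fst.comp contDiff_fst))).sub ((contDiff_snd.comp contDiff_fst).smul
      ((primitiveL E).contDiff.comp (hN.comp contDiff_snd))))
  -- At `τ = 0` the derivative of `Ψ` is `(x, τ, u) ↦ (x, τ, u - x - τ w₀)`.
  let w₀ : C := primitiveL E (f₀.comp (cst x₀))
  let φ : E × ℝ →L[ℝ] C := cst.comp (ContinuousLinearMap.fst ℝ E ℝ) +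
    (ContinuousLinearMap.snd ℝ E ℝ).smulRight w₀
  let P₁ := ContinuousLinearMap.fst ℝ (E × ℝ) C
  let P₂ := ContinuousLinearMap.snd ℝ (E × ℝ) C
  let L : ((E × ℝ) × C) ≃L[ℝ] ((E × ℝ) × C) :=
    ContinuousLinearEquiv.equivOfInverse (P₁.prod (P₂ - φ.comp P₁)) (P₁.prod (P₂ + φ.comp P₁))
      (fun x => by simp [P₁, P₂]) (fun x => by simp [P₁, P₂])
  have hL : HasFDerivAt Ψ (L : ((E × ℝ) × C) →L[ℝ] ((E × ℝ) × C)) ((x₀, (0 : ℝ)), cst x₀) := by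
    have h1 : HasFDerivAt (fun a : (E × ℝ) × C => primitiveL E (f₀.comp a.2))
        (fderiv ℝ (fun a : (E × ℝ) × C => primitiveL E (f₀.comp a.2)) ((x₀, (0 : ℝ)), cst x₀))
        ((x₀, (0 : ℝ)), cst x₀) :=
      ((((primitiveL E).contDiff.comp (hN.comp contDiff_snd)).differentiable
        (by simp)) _).hasFDerivAt
    have h2 : HasFDerivAt (fun a : (E × ℝ) × C => a.1.2)
        ((ContinuousLinearMap.snd ℝ E ℝ).comp P₁) ((x₀, (0 : ℝ)), cst x₀) :=
      ((ContinuousLinearMap.snd ℝ E ℝ).comp P₁).hasFDerivAt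
    have h3 : HasFDerivAt (fun a : (E × ℝ) × C => cst a.1.1)
        (cst.comp ((ContinuousLinearMap.fst ℝ E ℝ).comp P₁)) ((x₀, (0 : ℝ)), cst x₀) :=
      (cst.comp ((ContinuousLinearMap.fst ℝ E ℝ).comp P₁)).hasFDerivAt
    refine (P₁.hasFDerivAt.prodMk ((P₂.hasFDerivAt.sub h3).sub (h2.smul h1))).congr_fderiv ?_
    ext x
    all_goals simp [L, P₁, P₂, φ, w₀]
  obtain ⟨e, ha, -, he, hsm⟩ := exists_openPartialHomeomorph_of_contDiffOn isOpen_univ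
    hΨ.contDiffOn (mem_univ _) L hL
  have hΨ₀ : Ψ ((x₀, (0 : ℝ)), cst x₀) = ((x₀, 0), 0) := by simp [Ψ]
  have ht : ((x₀, (0 : ℝ)), (0 : C)) ∈ e.target := by
    have := e.map_source ha
    rwa [he, hΨ₀] at this
  have hsymm : e.symm ((x₀, (0 : ℝ)), (0 : C)) = ((x₀, (0 : ℝ)), cst x₀) := by
    rw [← hΨ₀, ← he, e.left_inv ha]
  let ι : E × ℝ → (E × ℝ) × C := fun a => (a, 0)
  have hι : Continuous ι := by fun_prop
  -- The solution with data `(x, τ)` is the last component of `Ψ⁻¹ (x, τ, 0)`.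
  have hev : ∀ᶠ a : E × ℝ in 𝓝 (x₀, (0 : ℝ)), ι a ∈ e.target ∧
      (e.symm (ι a)).2 ∈ ball (cst x₀) r := by
    have h1 : ∀ᶠ a : E × ℝ in 𝓝 (x₀, (0 : ℝ)), ι a ∈ e.target :=
      hι.continuousAt.eventually (e.open_target.mem_nhds ht)
    have h2 : ContinuousAt (fun a => (e.symm (ι a)).2) (x₀, (0 : ℝ)) :=
      continuous_snd.continuousAt.comp
        (ContinuousAt.comp (f := ι) (g := e.symm) (e.continuousAt_symm ht) hι.continuousAt)
    have h3 : (e.symm (ι (x₀, (0 : ℝ)))).2 = cst x₀ := congrArg Prod.snd hsymm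
    refine h1.and (h2 ?_)
    simp only [h3]
    exact ball_mem_nhds _ hr
  rw [nhds_prod_eq, Filter.eventually_prod_iff] at hev
  obtain ⟨pa, hpa, pb, hpb, hab⟩ := hev
  obtain ⟨δ, hδ, hδb⟩ := Metric.eventually_nhds_iff_ball.1 hpb
  refine ⟨{x | pa x}, hpa, δ, hδ, fun x τ => IccExtend (by norm_num : (-2 : ℝ) ≤ 2)
    (e.symm (ι (x, τ))).2, ?_, ?_⟩
  · intro x hx τ hτ
    have h1 := (hab hx (hδb τ (by rwa [Real.ball_eq_Ioo, zero_sub, zero_add]))).1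
    have h2 : ContDiffAt ℝ ∞ (fun a => (e.symm (ι a)).2) (x, τ) :=
      contDiffAt_snd.comp _ ((hsm.contDiffAt (e.open_target.mem_nhds h1)).comp (x, τ)
        (contDiffAt_id.prodMk contDiffAt_const))
    refine ((ContinuousMap.evalCLM ℝ
      (⟨1, by norm_num⟩ : Icc (-2 : ℝ) 2)).contDiff.contDiffAt.comp (x, τ) h2).congr_of_eventuallyEq
      (Eventually.of_forall fun a => ?_)
    exact IccExtend_of_mem _ _ _
  · intro x hx τ hτ
    obtain ⟨h1, h2⟩ := hab hx (hδb τ (by rwa [Real.ball_eq_Ioo, zero_sub, zero_add]))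
    set u : C := (e.symm (ι (x, τ))).2 with hu
    have h3 : Ψ (e.symm (ι (x, τ))) = ((x, τ), 0) := by
      rw [← he, e.right_inv h1]
    have h4 : (e.symm (ι (x, τ))).1 = (x, τ) := congrArg Prod.fst h3
    have h5 : u = cst x + τ • primitiveL E (f₀.comp u) := by
      have := congrArg Prod.snd h3
      simp only [Ψ, h4, ← hu] at this
      rw [sub_sub, sub_eq_zero] at this
      exact this
    -- The integral equation `u(s) = x + τ ∫₀ˢ f(u)`.
    have h6 : ∀ s (hs : s ∈ Icc (-2 : ℝ) 2), IccExtend (by norm_num : (-2 : ℝ) ≤ 2) u s =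
        x + τ • ∫ ρ in (0 : ℝ)..s, IccExtend (by norm_num : (-2 : ℝ) ≤ 2) (f₀.comp u) ρ := by
      intro s hs
      rw [IccExtend_of_mem _ _ hs]
      exact congrArg (fun v : C => v ⟨s, hs⟩) h5
    refine ⟨?_, fun s hs => ⟨?_, ?_⟩⟩
    · refine (h6 0 (by norm_num)).trans ?_
      simp
    · change IccExtend (by norm_num : (-2 : ℝ) ≤ 2) u s ∈ ball x₀ r
      rw [IccExtend_of_mem _ _ (Ioo_subset_Icc_self hs)]
      exact (ContinuousMap.dist_apply_le_dist (f := u) (g := cst x₀) _).trans_lt h2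
    · have hc : Continuous (IccExtend (by norm_num : (-2 : ℝ) ≤ 2) (f₀.comp u)) := by fun_prop
      have h7 := ((intervalIntegral.integral_hasDerivAt_right (hc.intervalIntegrable 0 s)
        (hc.stronglyMeasurableAtFilter _ _) hc.continuousAt).const_smul τ).const_add x
      refine h7.congr_of_eventuallyEq ?_
      filter_upwards [Icc_mem_nhds hs.1 hs.2] with y hy
      exact h6 y hy

/-- The same for a vector field that is only smooth on an open subset of a finite-dimensional
space, cut off to be globally smooth. -/
theorem exists_smooth_flow {E : Type u} [NormedAddCommGroup E] [NormedSpace ℝ E]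
    [FiniteDimensional ℝ E] {f : E → E} {Ω : Set E} (hΩ : IsOpen Ω) (hf : ContDiffOn ℝ ∞ f Ω)
    {x₀ : E} (hx₀ : x₀ ∈ Ω) :
    ∃ A ∈ 𝓝 x₀, ∃ δ > 0, ∃ U : E → ℝ → ℝ → E,
      (∀ x ∈ A, ∀ τ ∈ Ioo (-δ) δ, ContDiffAt ℝ ∞ (fun a : E × ℝ => U a.1 a.2 1) (x, τ)) ∧
      ∀ x ∈ A, ∀ τ ∈ Ioo (-δ) δ, U x τ 0 = x ∧ ∀ s ∈ Ioo (-2 : ℝ) 2,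
        U x τ s ∈ Ω ∧ HasDerivAt (U x τ) (τ • f (U x τ s)) s := by
  have : CompleteSpace E := FiniteDimensional.complete ℝ E
  obtain ⟨ρ, hρ, hρΩ⟩ := Metric.isOpen_iff.1 hΩ x₀ hx₀
  let χ : ContDiffBump x₀ := ⟨ρ / 3, ρ / 2, by positivity, by linarith⟩
  have hg : ContDiff ℝ ∞ (fun x => χ x • f x) := by
    rw [contDiff_iff_contDiffAt]
    intro x
    by_cases hx : x ∈ ball x₀ ρ
    · exact χ.contDiff.contDiffAt.smul (hf.contDiffAt (hΩ.mem_nhds (hρΩ hx)))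
    · have : x ∉ tsupport χ := by
        rw [χ.tsupport_eq]
        intro h
        rw [mem_closedBall] at h
        rw [mem_ball, not_lt] at hx
        have : χ.rOut = ρ / 2 := rfl
        linarith
      refine (contDiffAt_const (c := (0 : E))).congr_of_eventuallyEq ?_
      filter_upwards [(isClosed_tsupport χ).isOpen_compl.mem_nhds this] with y hy
      rw [image_eq_zero_of_notMem_tsupport hy, zero_smul]
  obtain ⟨A, hA, δ, hδ, U, h1, h2⟩ := exists_smooth_flow_of_contDiff _ hg x₀
    (show 0 < ρ / 3 by positivity)
  refine ⟨A, hA, δ, hδ, U, h1, fun x hx τ hτ => ⟨(h2 x hx τ hτ).1, fun s hs => ?_⟩⟩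
  obtain ⟨h3, h4⟩ := (h2 x hx τ hτ).2 s hs
  refine ⟨hρΩ (ball_subset_ball (by linarith) h3), ?_⟩
  rwa [χ.one_of_mem_closedBall (ball_subset_closedBall h3), one_smul] at h4

end ODE

/-! ### The metric and the Christoffel symbols in a chart -/

theorem sum_basisVec (u : Plane) : u 0 • basisVec 0 + u 1 • basisVec 1 = u := by
  ext i
  fin_cases i <;> simp [basisVec]

section Chart

variable {S : Type*} [TopologicalSpace S] [ChartedSpace Plane S] [IsManifold 𝓘(ℝ, Plane) ∞ S]

/-- Components of a tangent vector in the chart centred at `x₀`. -/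
def toChart (x₀ x : S) : TangentSpace 𝓘(ℝ, Plane) x →L[ℝ] Plane :=
  mfderiv 𝓘(ℝ, Plane) 𝓘(ℝ, Plane) (extChartAt 𝓘(ℝ, Plane) x₀) x

/-- The tangent vector with given components in the chart centred at `x₀`. -/
def ofChart (x₀ : S) (z : Plane) :
    Plane →L[ℝ] TangentSpace 𝓘(ℝ, Plane) ((extChartAt 𝓘(ℝ, Plane) x₀).symm z) :=
  mfderiv 𝓘(ℝ, Plane) 𝓘(ℝ, Plane) (extChartAt 𝓘(ℝ, Plane) x₀).symm z

theorem toChart_ofChart (x₀ : S) {z : Plane} (hz : z ∈ (extChartAt 𝓘(ℝ, Plane) x₀).target)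
    (u : Plane) : toChart x₀ ((extChartAt 𝓘(ℝ, Plane) x₀).symm z) (ofChart x₀ z u) = u := by
  have h := mfderiv_extChartAt_comp_mfderivWithin_extChartAt_symm (I := 𝓘(ℝ, Plane)) hz
  rw [ModelWithCorners.range_eq_univ, mfderivWithin_univ] at h
  exact congrArg (fun L : Plane →L[ℝ] Plane => L u) h

theorem ofChart_toChart (x₀ : S) {z : Plane} (hz : z ∈ (extChartAt 𝓘(ℝ, Plane) x₀).target)
    (u : TangentSpace 𝓘(ℝ, Plane) ((extChartAt 𝓘(ℝ, Plane) x₀).symm z)) :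
    ofChart x₀ z (toChart x₀ ((extChartAt 𝓘(ℝ, Plane) x₀).symm z) u) = u := by
  have h := mfderivWithin_extChartAt_symm_comp_mfderiv_extChartAt (I := 𝓘(ℝ, Plane)) hz
  rw [ModelWithCorners.range_eq_univ, mfderivWithin_univ] at h
  exact congrArg (fun L : Plane →L[ℝ] Plane => L u) h

theorem toChart_injective (x₀ : S) {x : S} (hx : x ∈ (extChartAt 𝓘(ℝ, Plane) x₀).source) :
    Function.Injective (toChart x₀ x) := by
  obtain ⟨z, hz, rfl⟩ : ∃ z ∈ (extChartAt 𝓘(ℝ, Plane) x₀).target,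
      (extChartAt 𝓘(ℝ, Plane) x₀).symm z = x :=
    ⟨_, (extChartAt 𝓘(ℝ, Plane) x₀).map_source hx, (extChartAt 𝓘(ℝ, Plane) x₀).left_inv hx⟩
  exact Function.LeftInverse.injective (ofChart_toChart x₀ hz)

theorem toChart_surjective (x₀ : S) {x : S} (hx : x ∈ (extChartAt 𝓘(ℝ, Plane) x₀).source) :
    Function.Surjective (toChart x₀ x) := by
  obtain ⟨z, hz, rfl⟩ : ∃ z ∈ (extChartAt 𝓘(ℝ, Plane) x₀).target,
      (extChartAt 𝓘(ℝ, Plane) x₀).symm z = x :=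
    ⟨_, (extChartAt 𝓘(ℝ, Plane) x₀).map_source hx, (extChartAt 𝓘(ℝ, Plane) x₀).left_inv hx⟩
  exact fun u => ⟨_, toChart_ofChart x₀ hz u⟩

theorem contMDiffOn_ofChart (x₀ : S) (u : Plane) :
    ContMDiffOn 𝓘(ℝ, Plane) 𝓘(ℝ, Plane).tangent ∞
      (fun z => (⟨(extChartAt 𝓘(ℝ, Plane) x₀).symm z, ofChart x₀ z u⟩ :
        TangentBundle 𝓘(ℝ, Plane) S)) (extChartAt 𝓘(ℝ, Plane) x₀).target := by
  intro z hz
  have hx : (extChartAt 𝓘(ℝ, Plane) x₀).symm z ∈ (chartAt Plane x₀).source := by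
    rw [← extChartAt_source 𝓘(ℝ, Plane)]
    exact (extChartAt 𝓘(ℝ, Plane) x₀).map_target hz
  set e := trivializationAt Plane (TangentSpace 𝓘(ℝ, Plane) : S → Type _) x₀
  have h1 : ContMDiffAt 𝓘(ℝ, Plane) 𝓘(ℝ, Plane).tangent ∞
      (fun m : S => (⟨m, e.symmL ℝ m u⟩ : TangentBundle 𝓘(ℝ, Plane) S))
      ((extChartAt 𝓘(ℝ, Plane) x₀).symm z) := by
    refine ContMDiffAt.clm_bundle_apply (F₁ := Plane) (E₁ := Bundle.Trivial S Plane) (v := fun _ => u)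
      (e.contMDiffAt_symmL (by simpa [e] using hx)) ?_
    rw [Bundle.contMDiffAt_section]
    exact contMDiffAt_const
  have h2 : ContMDiffWithinAt 𝓘(ℝ, Plane) 𝓘(ℝ, Plane) ∞ (extChartAt 𝓘(ℝ, Plane) x₀).symm
    (extChartAt 𝓘(ℝ, Plane) x₀).target z := contMDiffOn_extChartAt_symm x₀ z hz
  refine (h1.comp_contMDiffWithinAt z h2).congr_of_mem ?_ hz
  intro y hy
  have hy' : (extChartAt 𝓘(ℝ, Plane) x₀).symm y ∈ (chartAt Plane x₀).source := by
    rw [← extChartAt_source 𝓘(ℝ, Plane)]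
    exact (extChartAt 𝓘(ℝ, Plane) x₀).map_target hy
  have := TangentBundle.symmL_trivializationAt (𝕜 := ℝ) (I := 𝓘(ℝ, Plane)) hy'
  rw [(extChartAt 𝓘(ℝ, Plane) x₀).right_inv hy, ModelWithCorners.range_eq_univ,
    mfderivWithin_univ] at this
  simp only [Function.comp, e, this]
  rfl

variable (g : Metric S) (x₀ : S)

theorem contDiffOn_gram (i j : Fin 2) :
    ContDiffOn ℝ ∞ (fun z => gram g x₀ z i j) (extChartAt 𝓘(ℝ, Plane) x₀).target := by
  rw [← contMDiffOn_iff_contDiffOn]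
  intro z hz
  have : ContMDiffWithinAt 𝓘(ℝ, Plane) (𝓘(ℝ, Plane).prod 𝓘(ℝ, ℝ)) ∞
      (fun m ↦ Bundle.TotalSpace.mk' ℝ (E := Bundle.Trivial S ℝ)
        ((extChartAt 𝓘(ℝ, Plane) x₀).symm m) (gram g x₀ m i j))
      (extChartAt 𝓘(ℝ, Plane) x₀).target z := by
    apply ContMDiffWithinAt.clm_bundle_apply₂ (F₁ := Plane) (F₂ := Plane)
    · exact ContMDiffAt.comp_contMDiffWithinAt z g.contMDiff.contMDiffAt
        (contMDiffOn_extChartAt_symm x₀ z hz)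
    · exact contMDiffOn_ofChart x₀ (basisVec i) z hz
    · exact contMDiffOn_ofChart x₀ (basisVec j) z hz
  rw [Bundle.contMDiffWithinAt_totalSpace] at this
  exact this.2

/-- The metric in the chart centred at `x₀`, as a family of bilinear forms on the plane. -/
def gramL (z : Plane) : Plane →L[ℝ] Plane →L[ℝ] ℝ :=
  ∑ i, ∑ j, gram g x₀ z i j •
    (EuclideanSpace.proj (𝕜 := ℝ) i).smulRight (EuclideanSpace.proj (𝕜 := ℝ) j)

theorem gramL_apply (z u w : Plane) :
    gramL g x₀ z u w = ∑ i, ∑ j, gram g x₀ z i j * u i * w j := by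
  simp [gramL, mul_assoc]

theorem gramL_eq_inner (z u w : Plane) : gramL g x₀ z u w =
    g.inner ((extChartAt 𝓘(ℝ, Plane) x₀).symm z) (ofChart x₀ z u) (ofChart x₀ z w) := by
  conv_rhs => rw [← sum_basisVec u, ← sum_basisVec w]
  rw [gramL_apply]
  simp only [map_add, map_smul, _root_.add_apply, _root_.smul_apply,
    smul_eq_mul, Fin.sum_univ_two]
  have : ∀ i j, g.inner ((extChartAt 𝓘(ℝ, Plane) x₀).symm z) (ofChart x₀ z (basisVec i))
    (ofChart x₀ z (basisVec j)) = gram g x₀ z i j := fun i j => rfl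
  simp only [this]
  ring

theorem inner_eq_gramL {x : S} (hx : x ∈ (extChartAt 𝓘(ℝ, Plane) x₀).source)
    (u w : TangentSpace 𝓘(ℝ, Plane) x) :
    g.inner x u w = gramL g x₀ (extChartAt 𝓘(ℝ, Plane) x₀ x) (toChart x₀ x u)
      (toChart x₀ x w) := by
  obtain ⟨z, hz, rfl⟩ : ∃ z ∈ (extChartAt 𝓘(ℝ, Plane) x₀).target,
      (extChartAt 𝓘(ℝ, Plane) x₀).symm z = x :=
    ⟨_, (extChartAt 𝓘(ℝ, Plane) x₀).map_source hx, (extChartAt 𝓘(ℝ, Plane) x₀).left_inv hx⟩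
  rw [(extChartAt 𝓘(ℝ, Plane) x₀).right_inv hz, gramL_eq_inner, ofChart_toChart x₀ hz,
    ofChart_toChart x₀ hz]

theorem contDiffOn_gramL : ContDiffOn ℝ ∞ (gramL g x₀) (extChartAt 𝓘(ℝ, Plane) x₀).target := by
  refine contDiffOn_clm_apply.2 fun u => contDiffOn_clm_apply.2 fun w => ?_
  simp only [gramL_apply]
  exact ContDiffOn.sum fun i _ => ContDiffOn.sum fun j _ =>
    ((contDiffOn_gram g x₀ i j).mul contDiffOn_const).mul contDiffOn_const

theorem hasFDerivAt_gramL {z : Plane} (hz : z ∈ (extChartAt 𝓘(ℝ, Plane) x₀).target) :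
    HasFDerivAt (gramL g x₀) (fderiv ℝ (gramL g x₀) z) z :=
  (((contDiffOn_gramL g x₀).contDiffAt ((isOpen_extChartAt_target x₀).mem_nhds
    hz)).differentiableAt (by simp)).hasFDerivAt

theorem gram_symm (z : Plane) (i j : Fin 2) : gram g x₀ z i j = gram g x₀ z j i :=
  g.symm _ _ _

theorem gramL_symm (z u w : Plane) : gramL g x₀ z u w = gramL g x₀ z w u := by
  rw [gramL_eq_inner, gramL_eq_inner, g.symm]

theorem gramL_pos {z : Plane} (hz : z ∈ (extChartAt 𝓘(ℝ, Plane) x₀).target) {u : Plane}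
    (hu : u ≠ 0) : 0 < gramL g x₀ z u u := by
  rw [gramL_eq_inner]
  refine g.pos _ _ fun h => hu ?_
  rw [← toChart_ofChart x₀ hz u, h, map_zero]

theorem det_gram_pos {z : Plane} (hz : z ∈ (extChartAt 𝓘(ℝ, Plane) x₀).target) :
    0 < (gram g x₀ z).det := by
  have h0 : ∀ u : Plane, u ≠ 0 → 0 < gramL g x₀ z u u := fun u hu => gramL_pos g x₀ hz hu
  simp only [gramL_apply, Fin.sum_univ_two, gram_symm g x₀ z 1 0] at h0
  have h1 : 0 < gram g x₀ z 0 0 := by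
    have := h0 (basisVec 0) (fun h => by simpa [basisVec] using congrArg (fun v : Plane => v 0) h)
    simpa [basisVec] using this
  have h2 := h0 (!₂[-gram g x₀ z 0 1, gram g x₀ z 0 0])
    (fun h => h1.ne' (by simpa using congrArg (fun v : Plane => v 1) h))
  rw [Matrix.det_fin_two, gram_symm g x₀ z 1 0]
  simp at h2
  nlinarith [h1, h2]

theorem contDiffOn_dGram (l i j : Fin 2) :
    ContDiffOn ℝ ∞ (dGram g x₀ l i j) (extChartAt 𝓘(ℝ, Plane) x₀).target :=
  ((contDiffOn_gram g x₀ i j).fderiv_of_isOpen (isOpen_extChartAt_target x₀)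
    (by simp)).clm_apply contDiffOn_const

theorem contDiffOn_christoffel (k i j : Fin 2) :
    ContDiffOn ℝ ∞ (christoffel g x₀ k i j) (extChartAt 𝓘(ℝ, Plane) x₀).target := by
  have hdet : ContDiffOn ℝ ∞ (fun z => ((gram g x₀ z).det)⁻¹)
      (extChartAt 𝓘(ℝ, Plane) x₀).target := by
    refine ContDiffOn.inv ?_ fun z hz => (det_gram_pos g x₀ hz).ne'
    simp only [Matrix.det_fin_two]
    exact ((contDiffOn_gram g x₀ _ _).mul (contDiffOn_gram g x₀ _ _)).sub
      ((contDiffOn_gram g x₀ _ _).mul (contDiffOn_gram g x₀ _ _))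
  have hinv : ∀ k l, ContDiffOn ℝ ∞ (fun z => (gram g x₀ z)⁻¹ k l)
      (extChartAt 𝓘(ℝ, Plane) x₀).target := by
    intro k l
    simp only [Matrix.inv_def, Ring.inverse_eq_inv', Matrix.smul_apply, smul_eq_mul,
      Matrix.adjugate_fin_two]
    refine hdet.mul ?_
    fin_cases k <;> fin_cases l <;> simp only [Fin.zero_eta, Fin.mk_one, Matrix.of_apply,
      Matrix.cons_val_zero, Matrix.cons_val_one, Matrix.cons_val', Matrix.cons_val_fin_one]
    · exact contDiffOn_gram g x₀ _ _
    · exact (contDiffOn_gram g x₀ _ _).neg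
    · exact (contDiffOn_gram g x₀ _ _).neg
    · exact contDiffOn_gram g x₀ _ _
  exact contDiffOn_const.mul (ContDiffOn.sum fun l _ => (hinv k l).mul
    (((contDiffOn_dGram g x₀ i j l).add (contDiffOn_dGram g x₀ j i l)).sub
      (contDiffOn_dGram g x₀ l i j)))

theorem dGram_symm (l i j : Fin 2) (z : Plane) : dGram g x₀ l i j z = dGram g x₀ l j i z := by
  simp only [dGram, gram_symm g x₀ _ i j]

theorem christoffel_symm (k i j : Fin 2) (z : Plane) :
    christoffel g x₀ k i j z = christoffel g x₀ k j i z := by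
  simp only [christoffel, dGram_symm g x₀ _ i j z]
  congr 1
  refine Finset.sum_congr rfl fun l _ => ?_
  ring

/-- The Christoffel symbols in the chart centred at `x₀`, as a family of bilinear maps. -/
def christoffelL (z : Plane) : Plane →L[ℝ] Plane →L[ℝ] Plane :=
  ∑ k, ∑ i, ∑ j, christoffel g x₀ k i j z • (EuclideanSpace.proj (𝕜 := ℝ) i).smulRight
    ((EuclideanSpace.proj (𝕜 := ℝ) j).smulRight (basisVec k))

theorem christoffelVec_eq (z u v : Plane) :
    christoffelVec g x₀ z u v = christoffelL g x₀ z u v := by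
  simp [christoffelVec, christoffelL]
  module

theorem christoffelL_symm (z u v : Plane) : christoffelL g x₀ z u v = christoffelL g x₀ z v u := by
  simp only [← christoffelVec_eq, christoffelVec]
  refine Finset.sum_congr rfl fun k _ => ?_
  congr 1
  rw [Finset.sum_comm]
  refine Finset.sum_congr rfl fun i _ => Finset.sum_congr rfl fun j _ => ?_
  rw [christoffel_symm]
  ring

theorem contDiffOn_christoffelL :
    ContDiffOn ℝ ∞ (christoffelL g x₀) (extChartAt 𝓘(ℝ, Plane) x₀).target := by
  refine contDiffOn_clm_apply.2 fun u => contDiffOn_clm_apply.2 fun w => ?_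
  simp only [← christoffelVec_eq, christoffelVec]
  exact ContDiffOn.sum fun k _ => (ContDiffOn.sum fun i _ => ContDiffOn.sum fun j _ =>
    ((contDiffOn_christoffel g x₀ k i j).mul contDiffOn_const).mul contDiffOn_const).smul
    contDiffOn_const

theorem hasFDerivAt_christoffelL {z : Plane} (hz : z ∈ (extChartAt 𝓘(ℝ, Plane) x₀).target) :
    HasFDerivAt (christoffelL g x₀) (fderiv ℝ (christoffelL g x₀) z) z :=
  (((contDiffOn_christoffelL g x₀).contDiffAt ((isOpen_extChartAt_target x₀).mem_nhds
    hz)).differentiableAt (by simp)).hasFDerivAt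

theorem fderiv_gramL {z : Plane} (hz : z ∈ (extChartAt 𝓘(ℝ, Plane) x₀).target) (w u v : Plane) :
    fderiv ℝ (gramL g x₀) z w u v = ∑ l, ∑ i, ∑ j, dGram g x₀ l i j z * w l * u i * v j := by
  have hd : ∀ i j, HasFDerivAt (fun z => gram g x₀ z i j)
      (fderiv ℝ (fun z => gram g x₀ z i j) z) z := fun i j =>
    (((contDiffOn_gram g x₀ i j).contDiffAt ((isOpen_extChartAt_target x₀).mem_nhds
      hz)).differentiableAt (by simp)).hasFDerivAt
  have h1 := ((hasFDerivAt_gramL g x₀ hz).clm_apply (hasFDerivAt_const u z)).clm_apply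
    (hasFDerivAt_const v z)
  have h2 : HasFDerivAt (fun z => gramL g x₀ z u v) _ z :=
    (HasFDerivAt.fun_sum fun i (_ : i ∈ Finset.univ) => HasFDerivAt.fun_sum
      fun j (_ : j ∈ Finset.univ) => ((hd i j).mul_const (u i)).mul_const (v j)).congr_of_eventuallyEq
      (Eventually.of_forall fun z => gramL_apply g x₀ z u v)
  have h3 := congrArg (fun L : Plane →L[ℝ] ℝ => L w) (h1.unique h2)
  simp only [ContinuousLinearMap.comp_zero, zero_add, ContinuousLinearMap.flip_apply,
    _root_.sum_apply, _root_.smul_apply, smul_eq_mul] at h3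
  refine h3.trans ?_
  conv_lhs => rw [← sum_basisVec w]
  simp only [dGram, Fin.sum_univ_two, map_add, map_smul, smul_eq_mul]
  ring

theorem fderiv_christoffelL {z : Plane} (hz : z ∈ (extChartAt 𝓘(ℝ, Plane) x₀).target)
    (w u v : Plane) :
    fderiv ℝ (christoffelL g x₀) z w u v = ∑ k, (∑ l, ∑ i, ∑ j,
      fderiv ℝ (christoffel g x₀ k i j) z (basisVec l) * w l * u i * v j) • basisVec k := by
  have hd : ∀ k i j, HasFDerivAt (christoffel g x₀ k i j)
      (fderiv ℝ (christoffel g x₀ k i j) z) z := fun k i j =>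
    (((contDiffOn_christoffel g x₀ k i j).contDiffAt ((isOpen_extChartAt_target x₀).mem_nhds
      hz)).differentiableAt (by simp)).hasFDerivAt
  have h1 := ((hasFDerivAt_christoffelL g x₀ hz).clm_apply (hasFDerivAt_const u z)).clm_apply
    (hasFDerivAt_const v z)
  have h2 : HasFDerivAt (fun z => christoffelL g x₀ z u v) _ z :=
    (HasFDerivAt.fun_sum fun k (_ : k ∈ Finset.univ) => (HasFDerivAt.fun_sum
      fun i (_ : i ∈ Finset.univ) => HasFDerivAt.fun_sum
      fun j (_ : j ∈ Finset.univ) => ((hd k i j).mul_const (u i)).mul_const (v j)).smul_const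
        (basisVec k)).congr_of_eventuallyEq
      (Eventually.of_forall fun z => (christoffelVec_eq g x₀ z u v).symm)
  have h3 := congrArg (fun L : Plane →L[ℝ] Plane => L w) (h1.unique h2)
  simp only [ContinuousLinearMap.comp_zero, zero_add, ContinuousLinearMap.flip_apply,
    _root_.sum_apply, _root_.smul_apply, smul_eq_mul,
    ContinuousLinearMap.smulRight_apply] at h3
  refine h3.trans ?_
  conv_lhs => rw [← sum_basisVec w]
  simp only [Fin.sum_univ_two, map_add, map_smul, smul_eq_mul]
  module

/-- The Christoffel symbols of the first kind. -/
theorem sum_gram_mul_christoffel {z : Plane} (hz : z ∈ (extChartAt 𝓘(ℝ, Plane) x₀).target)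
    (m i j : Fin 2) : ∑ k, gram g x₀ z m k * christoffel g x₀ k i j z =
      1 / 2 * (dGram g x₀ i j m z + dGram g x₀ j i m z - dGram g x₀ m i j z) := by
  have hinv : ∀ l, ∑ k, gram g x₀ z m k * (gram g x₀ z)⁻¹ k l = if m = l then 1 else 0 := by
    intro l
    have := congrFun (congrFun (Matrix.mul_nonsing_inv (gram g x₀ z)
      (Ne.isUnit (det_gram_pos g x₀ hz).ne')) m) l
    rwa [Matrix.mul_apply, Matrix.one_apply] at this
  calc _ = ∑ k, ∑ l, 1 / 2 * ((gram g x₀ z m k * (gram g x₀ z)⁻¹ k l) *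
        (dGram g x₀ i j l z + dGram g x₀ j i l z - dGram g x₀ l i j z)) := by
        refine Finset.sum_congr rfl fun k _ => ?_
        rw [christoffel, Finset.mul_sum, Finset.mul_sum]
        exact Finset.sum_congr rfl fun l _ => by ring
    _ = ∑ l, 1 / 2 * ((∑ k, gram g x₀ z m k * (gram g x₀ z)⁻¹ k l) *
        (dGram g x₀ i j l z + dGram g x₀ j i l z - dGram g x₀ l i j z)) := by
        rw [Finset.sum_comm]
        refine Finset.sum_congr rfl fun l _ => ?_
        rw [Finset.sum_mul, Finset.mul_sum]
    _ = _ := by simp [hinv]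

/-- The Christoffel symbols with lowered index: the Euler-Lagrange equations of the energy. -/
theorem gramL_christoffelL {z : Plane} (hz : z ∈ (extChartAt 𝓘(ℝ, Plane) x₀).target)
    (v u : Plane) : gramL g x₀ z (christoffelL g x₀ z v v) u =
      fderiv ℝ (gramL g x₀) z v v u - (1 / 2) * fderiv ℝ (gramL g x₀) z u v v := by
  have h : gramL g x₀ z (christoffelL g x₀ z v v) u = ∑ m, ∑ i, ∑ j,
      (∑ k, gram g x₀ z m k * christoffel g x₀ k i j z) * v i * v j * u m := by
    rw [gramL_apply, ← christoffelVec_eq]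
    simp [christoffelVec, Fin.sum_univ_two, basisVec, gram_symm g x₀ z 1 0]
    ring
  rw [h, fderiv_gramL g x₀ hz, fderiv_gramL g x₀ hz]
  simp only [sum_gram_mul_christoffel g x₀ hz, Fin.sum_univ_two]
  ring

/-- The curvature in terms of the bilinear maps given by the Christoffel symbols. -/
theorem curvVec_eq {z : Plane} (hz : z ∈ (extChartAt 𝓘(ℝ, Plane) x₀).target) (u v w : Plane) :
    curvVec g x₀ z u v w = fderiv ℝ (christoffelL g x₀) z u v w
      - fderiv ℝ (christoffelL g x₀) z v u w
      + christoffelL g x₀ z u (christoffelL g x₀ z v w)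
      - christoffelL g x₀ z v (christoffelL g x₀ z u w) := by
  rw [fderiv_christoffelL g x₀ hz, fderiv_christoffelL g x₀ hz]
  simp only [← christoffelVec_eq, christoffelVec, curvVec, curvCoeff]
  ext l
  fin_cases l <;> simp [Fin.sum_univ_two, basisVec] <;> ring

end Chart

/-! ### Geodesics in charts -/

section Geodesics

variable {S : Type*} [TopologicalSpace S] [ChartedSpace Plane S]

theorem mem_extChartAt_source_iff {x₀ x : S} :
    x ∈ (extChartAt 𝓘(ℝ, Plane) x₀).source ↔ x ∈ (chartAt Plane x₀).source := by
  rw [extChartAt_source]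

theorem isOpen_sprayDom (x₀ : S) :
    IsOpen ((extChartAt 𝓘(ℝ, Plane) x₀).target ×ˢ (univ : Set Plane)) :=
  (isOpen_extChartAt_target x₀).prod isOpen_univ

theorem eventually_mem_source {c : ℝ → S} {t : ℝ} {T : Set ℝ} (hT : IsOpen T) (ht : t ∈ T)
    (hc : ContMDiffOn 𝓘(ℝ, ℝ) 𝓘(ℝ, Plane) ∞ c T) {x₀ : S}
    (hx : c t ∈ (chartAt Plane x₀).source) :
    ∀ᶠ s in 𝓝 t, s ∈ T ∧ c s ∈ (chartAt Plane x₀).source :=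
  (hT.eventually_mem ht).and
    ((hc.continuousOn.continuousAt (hT.mem_nhds ht)).eventually
      ((chartAt Plane x₀).open_source.mem_nhds hx))

variable [IsManifold 𝓘(ℝ, Plane) ∞ S]

theorem hasDerivAt_coordCurve {c : ℝ → S} {t : ℝ}
    (hc : MDifferentiableAt 𝓘(ℝ, ℝ) 𝓘(ℝ, Plane) c t) {x₀ : S}
    (hx : c t ∈ (chartAt Plane x₀).source) :
    HasDerivAt (coordCurve x₀ c) (toChart x₀ (c t) (velocity c t)) t := by
  have h1 : HasMFDerivAt 𝓘(ℝ, Plane) 𝓘(ℝ, Plane) (extChartAt 𝓘(ℝ, Plane) x₀) (c t)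
      (toChart x₀ (c t)) := (mdifferentiableAt_extChartAt hx).hasMFDerivAt
  have h2 := h1.comp t hc.hasMFDerivAt
  have h3 : HasFDerivAt (coordCurve x₀ c)
      ((toChart x₀ (c t)).comp (mfderiv 𝓘(ℝ, ℝ) 𝓘(ℝ, Plane) c t) : ℝ →L[ℝ] Plane) t :=
    h2.hasFDerivAt
  exact h3.hasDerivAt

theorem contDiffAt_coordCurve {c : ℝ → S} {t : ℝ} {T : Set ℝ} (hT : IsOpen T) (ht : t ∈ T)
    (hc : ContMDiffOn 𝓘(ℝ, ℝ) 𝓘(ℝ, Plane) ∞ c T) {x₀ : S}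
    (hx : c t ∈ (chartAt Plane x₀).source) : ContDiffAt ℝ ∞ (coordCurve x₀ c) t := by
  rw [← contMDiffAt_iff_contDiffAt]
  exact ContMDiffAt.comp t (contMDiffAt_extChartAt' hx) (hc.contMDiffAt (hT.mem_nhds ht))

variable (g : Metric S) (x₀ : S)

/-- The geodesic vector field `(x, v) ↦ (v, -Γ(v, v))` in the chart centred at `x₀`. -/
def spray (X : Plane × Plane) : Plane × Plane := (X.2, -christoffelL g x₀ X.1 X.2 X.2)

theorem contDiffOn_spray :
    ContDiffOn ℝ ∞ (spray g x₀) ((extChartAt 𝓘(ℝ, Plane) x₀).target ×ˢ univ) := by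
  have h : ContDiffOn ℝ ∞ (fun X : Plane × Plane => christoffelL g x₀ X.1)
      ((extChartAt 𝓘(ℝ, Plane) x₀).target ×ˢ univ) :=
    (contDiffOn_christoffelL g x₀).comp contDiff_fst.contDiffOn fun X hX => hX.1
  exact contDiff_snd.contDiffOn.prodMk ((h.clm_apply contDiff_snd.contDiffOn).clm_apply
    contDiff_snd.contDiffOn).neg

/-- Position and velocity of a curve in the chart centred at `x₀`. -/
def coordState (c : ℝ → S) (t : ℝ) : Plane × Plane :=
  (coordCurve x₀ c t, deriv (coordCurve x₀ c) t)

variable {g x₀}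

theorem continuousAt_coordState {c : ℝ → S} {t : ℝ} {T : Set ℝ} (hT : IsOpen T) (ht : t ∈ T)
    (hc : ContMDiffOn 𝓘(ℝ, ℝ) 𝓘(ℝ, Plane) ∞ c T)
    (hx : c t ∈ (chartAt Plane x₀).source) : ContinuousAt (coordState x₀ c) t := by
  have h1 := contDiffAt_coordCurve hT ht hc hx
  refine h1.continuousAt.prodMk ?_
  have h2 : ContDiffAt ℝ ∞ (deriv (coordCurve x₀ c)) t := by
    simpa [fderiv_apply_one_eq_deriv] using
      (h1.fderiv_right (m := ∞) (by simp)).clm_apply (contDiffAt_const (c := (1 : ℝ)))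
  exact h2.continuousAt

theorem IsGeodesicOn.hasDerivAt_coordState {c : ℝ → S} {t : ℝ} {T : Set ℝ}
    (hc : IsGeodesicOn g c T) (hT : IsOpen T) (ht : t ∈ T)
    (hx : c t ∈ (chartAt Plane x₀).source) :
    HasDerivAt (coordState x₀ c) (spray g x₀ (coordState x₀ c t)) t := by
  have h1 := contDiffAt_coordCurve hT ht hc.1 hx
  have h2 : ContDiffAt ℝ ∞ (deriv (coordCurve x₀ c)) t := by
    simpa [fderiv_apply_one_eq_deriv] using
      (h1.fderiv_right (m := ∞) (by simp)).clm_apply (contDiffAt_const (c := (1 : ℝ)))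
  have h3 := hc.2 t ht x₀ hx
  rw [chartCovDeriv, christoffelVec_eq, add_eq_zero_iff_eq_neg] at h3
  have h4 := (h2.differentiableAt (by simp)).hasDerivAt
  rw [h3] at h4
  exact (h1.differentiableAt (by simp)).hasDerivAt.prodMk h4

/-- Solutions of a smooth autonomous equation with the same value at `t` agree near `t`. -/
theorem eventuallyEq_of_hasDerivAt {E : Type*} [NormedAddCommGroup E] [NormedSpace ℝ E]
    {f : E → E} {t : ℝ} {y z : ℝ → E} (hf : ContDiffAt ℝ 1 f (z t))
    (hy : ∀ᶠ s in 𝓝 t, HasDerivAt y (f (y s)) s) (hz : ∀ᶠ s in 𝓝 t, HasDerivAt z (f (z s)) s)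
    (h : y t = z t) : y =ᶠ[𝓝 t] z := by
  obtain ⟨K, s, hs, hK⟩ := hf.exists_lipschitzOnWith
  refine ODE_solution_unique_of_eventually (v := fun _ => f) (s := fun _ => s) (K := K)
    (Eventually.of_forall fun _ => hK) ?_ ?_ h
  · refine hy.and (hy.self_of_nhds.continuousAt.eventually ?_)
    rw [h]
    exact hs
  · exact hz.and (hz.self_of_nhds.continuousAt.eventually hs)

/-- A geodesic of `S` that starts as a solution of the geodesic equation inside a chart follows it
as long as the solution exists; Hausdorffness of `S` prevents the two from branching. -/
theorem IsGeodesicOn.coordState_eq [T2Space S] {c : ℝ → S} {T : Set ℝ}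
    (hc : IsGeodesicOn g c T) (hT : IsOpen T) (hT' : IsPreconnected T) {y : ℝ → Plane × Plane}
    (hy : ∀ t ∈ T, (y t).1 ∈ (extChartAt 𝓘(ℝ, Plane) x₀).target ∧
      HasDerivAt y (spray g x₀ (y t)) t) {t₀ : ℝ} (ht₀ : t₀ ∈ T)
    (h₀ : c t₀ ∈ (chartAt Plane x₀).source) (h₀' : coordState x₀ c t₀ = y t₀) :
    ∀ t ∈ T, c t ∈ (chartAt Plane x₀).source ∧ coordState x₀ c t = y t := by
  set u : Set ℝ := {t | t ∈ T ∧ c t ∈ (chartAt Plane x₀).source ∧ coordState x₀ c t = y t}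
  have hu : IsOpen u := by
    rw [isOpen_iff_mem_nhds]
    rintro t ⟨ht, hx, he⟩
    have h1 := eventually_mem_source hT ht hc.1 hx
    have hf : ContDiffAt ℝ 1 (spray g x₀) (y t) :=
      ((contDiffOn_spray g x₀).contDiffAt ((isOpen_sprayDom x₀).mem_nhds
        ⟨(hy t ht).1, mem_univ _⟩)).of_le (by simp)
    have h2 := eventuallyEq_of_hasDerivAt hf
      (h1.mono fun s hs => hc.hasDerivAt_coordState hT hs.1 hs.2)
      ((hT.eventually_mem ht).mono fun s hs => (hy s hs).2) he
    filter_upwards [h1, h2] with s hs hs'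
    exact ⟨hs.1, hs.2, hs'⟩
  have hcl : closure u ∩ T ⊆ u := by
    rintro t ⟨htu, ht⟩
    have : (𝓝[u] t).NeBot := mem_closure_iff_nhdsWithin_neBot.1 htu
    have hyt := hy t ht
    have h1 : Tendsto c (𝓝[u] t) (𝓝 (c t)) :=
      (hc.1.continuousOn.continuousAt (hT.mem_nhds ht)).tendsto.mono_left nhdsWithin_le_nhds
    have h2 : Tendsto (fun s => (extChartAt 𝓘(ℝ, Plane) x₀).symm (y s).1) (𝓝[u] t)
        (𝓝 ((extChartAt 𝓘(ℝ, Plane) x₀).symm (y t).1)) :=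
      (ContinuousAt.comp (f := fun s => (y s).1) (continuousAt_extChartAt_symm'' hyt.1)
        hyt.2.continuousAt.fst).tendsto.mono_left nhdsWithin_le_nhds
    -- Limits in `S` are unique, so the geodesic cannot leave the chart at a limit time.
    have h3 : c t = (extChartAt 𝓘(ℝ, Plane) x₀).symm (y t).1 := by
      refine tendsto_nhds_unique h1 (h2.congr' ?_)
      filter_upwards [self_mem_nhdsWithin] with s hs
      rw [← hs.2.2]
      exact (extChartAt 𝓘(ℝ, Plane) x₀).left_inv (mem_extChartAt_source_iff.2 hs.2.1)
    have h4 : c t ∈ (chartAt Plane x₀).source := by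
      rw [← mem_extChartAt_source_iff, h3]
      exact (extChartAt 𝓘(ℝ, Plane) x₀).map_target hyt.1
    refine ⟨ht, h4, ?_⟩
    refine tendsto_nhds_unique ((continuousAt_coordState hT ht hc.1 h4).tendsto.mono_left
      (nhdsWithin_le_nhds (s := u))) ((hyt.2.continuousAt.tendsto.mono_left
      nhdsWithin_le_nhds).congr' ?_)
    filter_upwards [self_mem_nhdsWithin] with s hs
    exact hs.2.2.symm
  have := hT'.subset_of_closure_inter_subset hu ⟨t₀, ht₀, ht₀, h₀, h₀'⟩ hcl
  exact fun t ht => (this ht).2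

theorem deriv_comp_affine {E : Type*} [NormedAddCommGroup E] [NormedSpace ℝ E] (f : ℝ → E)
    (a b s : ℝ) : deriv (fun s => f (a + s * b)) s = b • deriv f (a + s * b) := by
  have h1 := deriv_comp_mul_left b (fun r => f (a + r)) s
  rw [deriv_comp_const_add] at h1
  simpa only [mul_comm b] using h1

/-- An affine reparametrization of a geodesic is a geodesic. -/
theorem IsGeodesicOn.comp_affine {c : ℝ → S} {T : Set ℝ} (hc : IsGeodesicOn g c T) (a b : ℝ) :
    IsGeodesicOn g (fun s => c (a + s * b)) {s | a + s * b ∈ T} := by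
  refine ⟨hc.1.comp (s := {s | a + s * b ∈ T}) (t := T) (f := fun s : ℝ => a + s * b) ?_
    fun s hs => hs, ?_⟩
  · rw [contMDiffOn_iff_contDiffOn]
    exact ContDiff.contDiffOn (by fun_prop)
  · intro s hs x₀ hx
    have h := hc.2 _ hs x₀ hx
    have h1 : coordCurve x₀ (fun s => c (a + s * b)) = fun s => coordCurve x₀ c (a + s * b) := rfl
    have h2 : deriv (fun s => coordCurve x₀ c (a + s * b)) =
        fun s => b • deriv (coordCurve x₀ c) (a + s * b) := by
      ext1 s
      exact deriv_comp_affine _ a b s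
    rw [chartCovDeriv, christoffelVec_eq] at h ⊢
    rw [h1, h2]
    have h3 : deriv (fun s => b • deriv (coordCurve x₀ c) (a + s * b)) s =
        b • b • deriv (deriv (coordCurve x₀ c)) (a + s * b) := by
      rw [deriv_fun_const_smul_field, deriv_comp_affine]
    rw [h3]
    simp only [map_smul, _root_.smul_apply]
    rw [← smul_add, ← smul_add, h, smul_zero, smul_zero]

end Geodesics

/-! ### Smoothness of the family of geodesics in all variables -/

section Smooth

variable {S : Type*} [TopologicalSpace S] [ChartedSpace Plane S] [IsManifold 𝓘(ℝ, Plane) ∞ S]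

theorem trivializationAt_tangent_snd {x₀ x : S} (hx : x ∈ (chartAt Plane x₀).source)
    (v : TangentSpace 𝓘(ℝ, Plane) x) :
    (trivializationAt Plane (TangentSpace 𝓘(ℝ, Plane)) x₀
      (⟨x, v⟩ : TangentBundle 𝓘(ℝ, Plane) S)).2 = toChart x₀ x v := by
  have h := TangentBundle.continuousLinearMapAt_trivializationAt (𝕜 := ℝ) (I := 𝓘(ℝ, Plane)) hx
  rw [toChart, ← h, Bundle.Trivialization.continuousLinearMapAt_apply,
    Bundle.Trivialization.coe_linearMapAt_of_mem _ (by simpa using hx)]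

/-- A vector field along a map is smooth if its components in a chart are. -/
theorem contMDiffAt_tangent_iff {E : Type*} [NormedAddCommGroup E] [NormedSpace ℝ E] {c : E → S}
    {J : ∀ t, TangentSpace 𝓘(ℝ, Plane) (c t)} {t : E} {x₀ : S}
    (hx : c t ∈ (chartAt Plane x₀).source) (hc : ContMDiffAt 𝓘(ℝ, E) 𝓘(ℝ, Plane) ∞ c t) :
    ContMDiffAt 𝓘(ℝ, E) 𝓘(ℝ, Plane).tangent ∞
      (fun t => (⟨c t, J t⟩ : TangentBundle 𝓘(ℝ, Plane) S)) t ↔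
    ContDiffAt ℝ ∞ (fun t => toChart x₀ (c t) (J t)) t := by
  rw [(trivializationAt Plane (TangentSpace 𝓘(ℝ, Plane)) x₀).contMDiffAt_iff
    (f := fun t => (⟨c t, J t⟩ : TangentBundle 𝓘(ℝ, Plane) S)) (by simpa using hx)]
  rw [and_iff_right hc, contMDiffAt_iff_contDiffAt]
  have h : (fun s => (trivializationAt Plane (TangentSpace 𝓘(ℝ, Plane)) x₀
      (⟨c s, J s⟩ : TangentBundle 𝓘(ℝ, Plane) S)).2) =ᶠ[𝓝 t] fun s => toChart x₀ (c s) (J s) := by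
    filter_upwards [hc.continuousAt.eventually ((chartAt Plane x₀).open_source.mem_nhds hx)]
      with s hs
    exact trivializationAt_tangent_snd hs _
  exact ⟨fun h' => h'.congr_of_eventuallyEq h.symm, fun h' => h'.congr_of_eventuallyEq h⟩

theorem IsGeodesicOn.mono {g : Metric S} {c : ℝ → S} {T T' : Set ℝ} (hc : IsGeodesicOn g c T)
    (h : T' ⊆ T) : IsGeodesicOn g c T' :=
  ⟨hc.1.mono h, fun t ht => hc.2 t (h ht)⟩

/-- A unit vector in an inner product plane is determined by its inner product with a vector `e`
and by the side of `e` to which it points. -/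
theorem unit_vector_eq {G : Plane →L[ℝ] Plane →L[ℝ] ℝ} (hs : ∀ u w, G u w = G w u)
    {e n v : Plane} (hee : 0 < G e e) (hn : G n n = 1) (hne : G n e = 0) (hv : G v v = 1)
    (hvn : 0 < G v n) :
    v = (G v e / G e e) • e + √(1 - G v e ^ 2 / G e e) • n ∧ 0 < 1 - G v e ^ 2 / G e e := by
  have hen : G e n = 0 := by rw [hs, hne]
  have hli : LinearIndependent ℝ ![e, n] := by
    rw [LinearIndependent.pair_iff]
    intro s t hst
    have h1 := congrArg (fun w => G w e) hst
    have h2 := congrArg (fun w => G w n) hst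
    simp only [map_add, map_smul, _root_.add_apply, _root_.smul_apply, smul_eq_mul, hne, hn, hen,
      map_zero, _root_.zero_apply, mul_zero, add_zero, zero_add, mul_one] at h1 h2
    exact ⟨(mul_eq_zero.1 h1).resolve_right hee.ne', h2⟩
  have hsp := hli.span_eq_top_of_card_eq_finrank' (by simp)
  have hmem : v ∈ Submodule.span ℝ {e, n} := by
    have : Set.range ![e, n] = {e, n} := by simp [Set.pair_comm]
    rw [← this, hsp]
    trivial
  obtain ⟨a, b, rfl⟩ := Submodule.mem_span_pair.1 hmem
  simp only [map_add, map_smul, _root_.add_apply, _root_.smul_apply, smul_eq_mul, hne, hn, hen,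
    mul_zero, add_zero, zero_add, mul_one] at *
  have h1 : a * G e e / G e e = a := by field_simp
  have h2 : 1 - (a * G e e) ^ 2 / G e e = b ^ 2 := by
    field_simp
    linarith
  rw [h1, h2, Real.sqrt_sq hvn.le]
  exact ⟨rfl, by positivity⟩

namespace GeodesicManifold

variable {g : Metric S} (𝓜 : GeodesicManifold g)

/-- The parameters `((y, η), t)` of points on geodesics of the family. -/
def pointDom : Set ((ℝ × ℝ) × ℝ) := {a | a.1 ∈ 𝓜.W ∧ a.2 ∈ 𝓜.dom a.1}

theorem isOpen_pointDom : IsOpen 𝓜.pointDom := 𝓜.isOpen_dom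

/-- The point with parameters `((y, η), t)`. -/
def point (a : (ℝ × ℝ) × ℝ) : S := 𝓜.γ a.1 a.2

theorem isOpen_dom_apply {p : ℝ × ℝ} (hp : p ∈ 𝓜.W) : IsOpen (𝓜.dom p) := by
  have h : 𝓜.dom p = (fun t => (p, t)) ⁻¹' 𝓜.pointDom := by
    ext t
    exact ⟨fun h => ⟨hp, h⟩, fun h => h.2⟩
  rw [h]
  exact 𝓜.isOpen_pointDom.preimage (by fun_prop)

/-- The map `((y, η), t) ↦ γ_(y, η)(t)` is smooth on a neighborhood of `a`. -/
def SmoothNear (a : (ℝ × ℝ) × ℝ) : Prop :=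
  ∃ O ∈ 𝓝 a, ContMDiffOn 𝓘(ℝ, (ℝ × ℝ) × ℝ) 𝓘(ℝ, Plane) ∞ 𝓜.point O

/-- The state at time `t'` depends smoothly on the geodesic for geodesics near `p₀`. -/
def SmoothState (x₀ : S) (p₀ : ℝ × ℝ) (t' : ℝ) : Prop :=
  ∃ O ∈ 𝓝 p₀, (∀ p ∈ O, 𝓜.γ p t' ∈ (chartAt Plane x₀).source) ∧
    ContDiffOn ℝ ∞ (fun p => coordState x₀ (𝓜.γ p) t') O

theorem SmoothNear.smoothState {p₀ : ℝ × ℝ} {t' : ℝ} (h : 𝓜.SmoothNear (p₀, t')) {x₀ : S}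
    (hx : 𝓜.γ p₀ t' ∈ (chartAt Plane x₀).source) : 𝓜.SmoothState x₀ p₀ t' := by
  obtain ⟨O, hO, hF⟩ := h
  have hc : ContinuousAt 𝓜.point (p₀, t') := hF.continuousOn.continuousAt hO
  have hev := hc.eventually ((chartAt Plane x₀).open_source.mem_nhds hx)
  obtain ⟨Q, hQ, hQo, hQa⟩ := _root_.mem_nhds_iff.1 (Filter.inter_mem hO hev)
  have hX : ContDiffOn ℝ ∞ (fun a => extChartAt 𝓘(ℝ, Plane) x₀ (𝓜.point a)) Q := by
    intro a ha
    refine ContDiffAt.contDiffWithinAt ?_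
    rw [← contMDiffAt_iff_contDiffAt]
    exact ContMDiffAt.comp a (contMDiffAt_extChartAt' (hQ ha).2)
      ((hF.mono fun b hb => (hQ hb).1).contMDiffAt (hQo.mem_nhds ha))
  have hι : Continuous fun p : ℝ × ℝ => (p, t') := by fun_prop
  refine ⟨(fun p => (p, t')) ⁻¹' Q, hι.continuousAt (hQo.mem_nhds hQa), fun p hp => (hQ hp).2, ?_⟩
  have h1 : ContDiffOn ℝ ∞ (fun p : ℝ × ℝ => (p, t')) ((fun p => (p, t')) ⁻¹' Q) :=
    ContDiff.contDiffOn (by fun_prop)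
  refine (hX.comp h1 fun p hp => hp).prodMk ?_
  have h2 := ((hX.fderiv_of_isOpen hQo (m := ∞) (by simp)).clm_apply
    (contDiffOn_const (c := ((0 : ℝ × ℝ), (1 : ℝ))))).comp h1 fun p hp => hp
  refine h2.congr fun p hp => ?_
  have h3 : HasDerivAt (fun t : ℝ => (p, t)) ((0 : ℝ × ℝ), (1 : ℝ)) t' :=
    (hasDerivAt_const t' p).prodMk (hasDerivAt_id t')
  have h4 := ((hX.contDiffAt (hQo.mem_nhds hp)).differentiableAt
    (by simp)).hasFDerivAt.comp_hasDerivAt t' h3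
  exact h4.deriv

/-- The initial velocity is `η / |h'|² • h' + √(1 - η² / |h'|²) • ν`, hence smooth in `(y, η)`. -/
theorem smoothState_zero {p₀ : ℝ × ℝ} (hp₀ : p₀ ∈ 𝓜.W) :
    𝓜.SmoothState (𝓜.γ p₀ 0) p₀ 0 := by
  set x₀ := 𝓜.γ p₀ 0 with hx₀
  have hs : 𝓜.h p₀.1 ∈ (chartAt Plane x₀).source := by
    rw [hx₀, 𝓜.start p₀ hp₀]
    exact mem_chart_source _ _
  have hev := eventually_mem_source 𝓜.isOpen_Y (𝓜.fst_mem p₀ hp₀) 𝓜.smooth_h hs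
  obtain ⟨Q, hQ, hQo, hQp⟩ := _root_.mem_nhds_iff.1 hev
  have hO : IsOpen (𝓜.W ∩ Prod.fst ⁻¹' Q) := 𝓜.isOpen_W.inter (hQo.preimage continuous_fst)
  have hγ : ∀ p ∈ 𝓜.W ∩ Prod.fst ⁻¹' Q, 𝓜.γ p 0 ∈ (chartAt Plane x₀).source := by
    intro p hp
    rw [𝓜.start p hp.1]
    exact (hQ hp.2).2
  refine ⟨𝓜.W ∩ Prod.fst ⁻¹' Q, hO.mem_nhds ⟨hp₀, hQp⟩, hγ, ?_⟩
  set e : ℝ → Plane := deriv (coordCurve x₀ 𝓜.h)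
  set n : ℝ → Plane := fun y => toChart x₀ (𝓜.h y) (𝓜.ν y)
  set G : ℝ → Plane →L[ℝ] Plane →L[ℝ] ℝ := fun y => gramL g x₀ (coordCurve x₀ 𝓜.h y)
  have hh : ContDiffOn ℝ ∞ (coordCurve x₀ 𝓜.h) Q := fun y hy =>
    (contDiffAt_coordCurve 𝓜.isOpen_Y (hQ hy).1 𝓜.smooth_h (hQ hy).2).contDiffWithinAt
  have he : ContDiffOn ℝ ∞ e Q := by
    simpa [fderiv_apply_one_eq_deriv] using
      (hh.fderiv_of_isOpen hQo (m := ∞) (by simp)).clm_apply (contDiffOn_const (c := (1 : ℝ)))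
  have hmap : ∀ y ∈ Q, coordCurve x₀ 𝓜.h y ∈ (extChartAt 𝓘(ℝ, Plane) x₀).target := fun y hy =>
    (extChartAt 𝓘(ℝ, Plane) x₀).map_source (mem_extChartAt_source_iff.2 (hQ hy).2)
  have hn : ContDiffOn ℝ ∞ n Q := fun y hy =>
    ((contMDiffAt_tangent_iff (hQ hy).2
      (𝓜.smooth_h.contMDiffAt (𝓜.isOpen_Y.mem_nhds (hQ hy).1))).1
      (𝓜.smooth_ν.contMDiffAt (𝓜.isOpen_Y.mem_nhds (hQ hy).1))).contDiffWithinAt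
  have hG : ContDiffOn ℝ ∞ G Q := (contDiffOn_gramL g x₀).comp hh hmap
  have hvel : ∀ y ∈ Q, e y = toChart x₀ (𝓜.h y) (velocity 𝓜.h y) := fun y hy =>
    (hasDerivAt_coordCurve ((𝓜.smooth_h.contMDiffAt
      (𝓜.isOpen_Y.mem_nhds (hQ hy).1)).mdifferentiableAt (by simp)) (hQ hy).2).deriv
  have hee : ∀ y ∈ Q, 0 < G y (e y) (e y) := by
    intro y hy
    refine gramL_pos g x₀ (hmap y hy) ?_
    rw [hvel y hy]
    intro h
    exact 𝓜.immersion_h y (hQ hy).1 (toChart_injective x₀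
      (mem_extChartAt_source_iff.2 (hQ hy).2) (h.trans (map_zero _).symm))
  have hv : ∀ p ∈ 𝓜.W ∩ Prod.fst ⁻¹' Q, coordState x₀ (𝓜.γ p) 0 = (coordCurve x₀ 𝓜.h p.1,
      (p.2 / G p.1 (e p.1) (e p.1)) • e p.1 + √(1 - p.2 ^ 2 / G p.1 (e p.1) (e p.1)) • n p.1) ∧
      0 < 1 - p.2 ^ 2 / G p.1 (e p.1) (e p.1) := by
    rintro p ⟨hpW, hpQ⟩
    have hsrc := mem_extChartAt_source_iff.2 (hQ hpQ).2
    obtain ⟨θ, hθ, h1, h2, h3⟩ := 𝓜.direction p hpW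
    rw [inner_eq_gramL g x₀ hsrc] at h1 h2 h3
    have h4 : deriv (coordCurve x₀ (𝓜.γ p)) 0 = toChart x₀ (𝓜.h p.1) θ := by
      rw [(hasDerivAt_coordCurve (((𝓜.geodesic p hpW).1.contMDiffAt
        ((𝓜.isOpen_dom_apply hpW).mem_nhds (𝓜.zero_mem p hpW))).mdifferentiableAt (by simp))
        (hγ p ⟨hpW, hpQ⟩)).deriv]
      exact congrArg (fun q : TangentBundle 𝓘(ℝ, Plane) S => toChart x₀ q.1 q.2) hθ
    rw [← hvel p.1 hpQ] at h2
    have h5 := 𝓜.unit_ν p.1 (hQ hpQ).1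
    have h6 := 𝓜.normal_ν p.1 (hQ hpQ).1
    rw [inner_eq_gramL g x₀ hsrc] at h5 h6
    rw [← hvel p.1 hpQ] at h6
    obtain ⟨h7, h8⟩ := unit_vector_eq (gramL_symm g x₀ _) (hee p.1 hpQ) h5 h6 h1 h3
    have h9 : G p.1 (toChart x₀ (𝓜.h p.1) θ) (e p.1) = p.2 := h2
    change _ = (G p.1 _ _ / _) • _ + √(1 - G p.1 _ _ ^ 2 / _) • n p.1 at h7
    change 0 < 1 - G p.1 _ _ ^ 2 / _ at h8
    rw [h9] at h7 h8
    refine ⟨Prod.ext ?_ (h4.trans h7), h8⟩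
    simp only [coordState, coordCurve, 𝓜.start p hpW]
  refine ContDiffOn.congr ?_ fun p hp => (hv p hp).1
  have hfst : ContDiffOn ℝ ∞ (Prod.fst : ℝ × ℝ → ℝ) (𝓜.W ∩ Prod.fst ⁻¹' Q) :=
    contDiff_fst.contDiffOn
  have hm : MapsTo Prod.fst (𝓜.W ∩ Prod.fst ⁻¹' Q) Q := fun p hp => hp.2
  have hGe : ContDiffOn ℝ ∞ (fun p : ℝ × ℝ => G p.1 (e p.1) (e p.1)) (𝓜.W ∩ Prod.fst ⁻¹' Q) :=
    ((hG.clm_apply he).clm_apply he).comp hfst hm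
  have hne : ∀ p ∈ 𝓜.W ∩ Prod.fst ⁻¹' Q, G p.1 (e p.1) (e p.1) ≠ 0 := fun p hp =>
    (hee p.1 hp.2).ne'
  refine (hh.comp hfst hm).prodMk (((contDiff_snd.contDiffOn.div hGe hne).smul
    (he.comp hfst hm)).add ((ContDiffOn.sqrt ?_ fun p hp => (hv p hp).2.ne').smul
    (hn.comp hfst hm)))
  exact contDiffOn_const.sub ((contDiff_snd.contDiffOn.pow 2).div hGe hne)

variable [T2Space S]

/-- Smoothness of the family near `(p₀, t₀)`, given smooth dependence of the state at one earlier or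
later time: in the chart centred at the point, the geodesics are given by the smooth local flow. -/
theorem exists_smoothNear_of_smoothState {p₀ : ℝ × ℝ} {t₀ : ℝ} (h : (p₀, t₀) ∈ 𝓜.pointDom) :
    ∃ ε > 0, ∀ t' ∈ ball t₀ ε, 𝓜.γ p₀ t' ∈ (chartAt Plane (𝓜.γ p₀ t₀)).source ∧
      (𝓜.SmoothState (𝓜.γ p₀ t₀) p₀ t' → ∀ t ∈ ball t₀ ε, 𝓜.SmoothNear (p₀, t)) := by
  set x₀ := 𝓜.γ p₀ t₀
  have hx₀ : 𝓜.γ p₀ t₀ ∈ (chartAt Plane x₀).source := mem_chart_source _ _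
  have hgeo := 𝓜.geodesic p₀ h.1
  have hdo := 𝓜.isOpen_dom_apply h.1
  obtain ⟨A, hA, δ, hδ, U, hU, hU'⟩ := exists_smooth_flow (isOpen_sprayDom x₀)
    (contDiffOn_spray g x₀) (x₀ := coordState x₀ (𝓜.γ p₀) t₀)
    ⟨(extChartAt 𝓘(ℝ, Plane) x₀).map_source (mem_extChartAt_source_iff.2 hx₀), mem_univ _⟩
  have hA' : interior A ∈ 𝓝 (coordState x₀ (𝓜.γ p₀) t₀) := interior_mem_nhds.2 hA
  have h1 := (eventually_mem_source hdo h.2 hgeo.1 hx₀).and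
    ((continuousAt_coordState hdo h.2 hgeo.1 hx₀).eventually hA')
  obtain ⟨ε₁, hε₁, h1⟩ := Metric.eventually_nhds_iff_ball.1 h1
  have h2 := 𝓜.isOpen_pointDom.mem_nhds h
  rw [nhds_prod_eq, Filter.mem_prod_iff] at h2
  obtain ⟨N, hN, N', hN', hNN⟩ := h2
  obtain ⟨ε₂, hε₂, h2⟩ := Metric.mem_nhds_iff.1 hN'
  -- The local flow is used at times `s ∈ (-2, 2)` with speeds `|τ| < 2 ε ≤ δ`. The times `t' + s
  -- τ` then satisfy `|t' + s τ - t₀| < ε + 2 * (2 * ε) ≤ ε₂`, so the geodesics are defined there.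
  have hε : 0 < min ε₁ (min (δ / 2) (ε₂ / 5)) := by positivity
  refine ⟨min ε₁ (min (δ / 2) (ε₂ / 5)), hε, fun t' ht' => ?_⟩
  set ε := min ε₁ (min (δ / 2) (ε₂ / 5)) with hεdef
  have e1 : ε ≤ ε₁ := min_le_left _ _
  have e2 : ε ≤ δ / 2 := (min_le_right _ _).trans (min_le_left _ _)
  have e3 : ε ≤ ε₂ / 5 := (min_le_right _ _).trans (min_le_right _ _)
  have ht1 := h1 t' (ball_subset_ball e1 ht')
  refine ⟨ht1.1.2, ?_⟩
  rintro ⟨O, hO, hOs, hOd⟩ t ht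
  have hst : ContinuousAt (fun p => coordState x₀ (𝓜.γ p) t') p₀ :=
    hOd.continuousOn.continuousAt hO
  obtain ⟨Q, hQ, hQo, hQp⟩ := _root_.mem_nhds_iff.1 (Filter.inter_mem (Filter.inter_mem hO hN)
    (hst.preimage_mem_nhds (isOpen_interior.mem_nhds ht1.2)))
  -- The geodesic `s ↦ γ_p(t' + s τ)` is the solution of the geodesic equation whose position is
  -- that of the flow with speed `τ`, and whose velocity is `τ` times that of the flow.
  have key : ∀ p ∈ Q, ∀ τ ∈ Ioo (-(2 * ε)) (2 * ε), 𝓜.point (p, t' + τ) =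
      (extChartAt 𝓘(ℝ, Plane) x₀).symm (U (coordState x₀ (𝓜.γ p) t') τ 1).1 ∧
      (U (coordState x₀ (𝓜.γ p) t') τ 1).1 ∈ (extChartAt 𝓘(ℝ, Plane) x₀).target := by
    intro p hp τ hτ
    have hpA : coordState x₀ (𝓜.γ p) t' ∈ A := interior_subset (hQ hp).2
    have hτδ : τ ∈ Ioo (-δ) δ := ⟨by linarith [hτ.1], by linarith [hτ.2]⟩
    obtain ⟨hU0, hU1⟩ := hU' _ hpA τ hτδ
    have hdom : ∀ s ∈ Ioo (-2 : ℝ) 2, (p, t' + s * τ) ∈ 𝓜.pointDom := by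
      intro s hs
      refine hNN ⟨(hQ hp).1.2, h2 ?_⟩
      rw [mem_ball, Real.dist_eq] at ht' ⊢
      have hs' : |s * τ| ≤ 2 * (2 * ε) := by
        rw [abs_mul]
        gcongr
        · exact abs_le.2 ⟨hs.1.le, hs.2.le⟩
        · exact abs_le.2 ⟨hτ.1.le, hτ.2.le⟩
      calc |t' + s * τ - t₀| = |(t' - t₀) + s * τ| := by ring_nf
        _ ≤ |t' - t₀| + |s * τ| := abs_add_le _ _
        _ < ε + 2 * (2 * ε) := by linarith
        _ ≤ ε₂ := by linarith
    have hpW : p ∈ 𝓜.W := (hdom 0 (by norm_num)).1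
    have hc : IsGeodesicOn g (fun s => 𝓜.γ p (t' + s * τ)) (Ioo (-2 : ℝ) 2) :=
      ((𝓜.geodesic p hpW).comp_affine t' τ).mono fun s hs => (hdom s hs).2
    have h0 : coordState x₀ (fun s => 𝓜.γ p (t' + s * τ)) 0 =
        ((coordState x₀ (𝓜.γ p) t').1, τ • (coordState x₀ (𝓜.γ p) t').2) := by
      have := deriv_comp_affine (coordCurve x₀ (𝓜.γ p)) t' τ 0
      rw [zero_mul, add_zero] at this
      refine Prod.ext ?_ this
      simp [coordState, coordCurve]
    have := hc.coordState_eq isOpen_Ioo isPreconnected_Ioo (x₀ := x₀)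
      (y := fun s => ((U (coordState x₀ (𝓜.γ p) t') τ s).1,
        τ • (U (coordState x₀ (𝓜.γ p) t') τ s).2)) (t₀ := 0) ?_ (by norm_num) ?_ ?_ 1 (by norm_num)
    · refine ⟨?_, (hU1 1 (by norm_num)).1.1⟩
      rw [← congrArg Prod.fst this.2]
      simp only [coordState, coordCurve, one_mul]
      rw [(extChartAt 𝓘(ℝ, Plane) x₀).left_inv]
      · rfl
      · simpa [mem_extChartAt_source_iff] using this.1
    · intro s hs
      refine ⟨(hU1 s hs).1.1, ?_⟩
      have h3 := (hU1 s hs).2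
      have h4 := ((ContinuousLinearMap.fst ℝ Plane Plane).prod
        (τ • ContinuousLinearMap.snd ℝ Plane Plane)).hasFDerivAt.comp_hasDerivAt s h3
      refine HasDerivAt.congr_deriv h4 ?_
      simp [spray]
    · simpa using hOs p (hQ hp).1.1
    · rw [h0, hU0]
  refine ⟨Q ×ˢ ball t' (2 * ε), (hQo.prod isOpen_ball).mem_nhds ⟨hQp, ?_⟩, ?_⟩
  · have := dist_triangle_right t t' t₀
    simp only [mem_ball] at *
    linarith
  · rintro ⟨p, r⟩ ⟨hp, hr⟩
    refine ContMDiffAt.contMDiffWithinAt ?_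
    have hmem : ∀ r ∈ ball t' (2 * ε), r - t' ∈ Ioo (-(2 * ε)) (2 * ε) := by
      intro r hr
      rw [mem_ball, Real.dist_eq] at hr
      exact abs_lt.1 hr
    have hpA : coordState x₀ (𝓜.γ p) t' ∈ A := interior_subset (hQ hp).2
    have hτδ : r - t' ∈ Ioo (-δ) δ :=
      ⟨by linarith [(hmem r hr).1], by linarith [(hmem r hr).2]⟩
    have h3 : ContDiffAt ℝ ∞ (fun a : (ℝ × ℝ) × ℝ =>
        (coordState x₀ (𝓜.γ a.1) t', a.2 - t')) (p, r) := by
      refine ContDiffAt.prodMk (f := fun a : (ℝ × ℝ) × ℝ => coordState x₀ (𝓜.γ a.1) t') ?_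
        (by fun_prop)
      exact ContDiffAt.comp (p, r) (f := Prod.fst) (g := fun p => coordState x₀ (𝓜.γ p) t')
        (hOd.contDiffAt (Filter.mem_of_superset (hQo.mem_nhds hp) fun q hq => (hQ hq).1.1))
        contDiffAt_fst
    have h4 := contDiffAt_fst.comp (p, r) (ContDiffAt.comp (p, r) (hU _ hpA _ hτδ) h3)
    have h5 : ContMDiffAt 𝓘(ℝ, Plane) 𝓘(ℝ, Plane) ∞ (extChartAt 𝓘(ℝ, Plane) x₀).symm
        (U (coordState x₀ (𝓜.γ p) t') (r - t') 1).1 :=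
      (contMDiffOn_extChartAt_symm x₀).contMDiffAt
        ((isOpen_extChartAt_target x₀).mem_nhds (key p hp _ (hmem r hr)).2)
    refine (ContMDiffAt.comp (p, r) h5 (contMDiffAt_iff_contDiffAt.2 h4)).congr_of_eventuallyEq ?_
    filter_upwards [(hQo.prod isOpen_ball).mem_nhds (mk_mem_prod hp hr)] with a ha
    have := (key a.1 ha.1 _ (hmem a.2 ha.2)).1
    rw [add_sub_cancel] at this
    exact this

/-- The map `((y, η), t) ↦ γ_(y, η)(t)` is smooth. -/
theorem smoothNear {a : (ℝ × ℝ) × ℝ} (ha : a ∈ 𝓜.pointDom) : 𝓜.SmoothNear a := by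
  obtain ⟨p₀, t₁⟩ := a
  have hp₀ : p₀ ∈ 𝓜.W := ha.1
  set u : Set ℝ := {t | t ∈ 𝓜.dom p₀ ∧ 𝓜.SmoothNear (p₀, t)}
  have h0 : (0 : ℝ) ∈ u := by
    refine ⟨𝓜.zero_mem p₀ hp₀, ?_⟩
    obtain ⟨ε, hε, h⟩ := 𝓜.exists_smoothNear_of_smoothState (p₀ := p₀) (t₀ := 0)
      ⟨hp₀, 𝓜.zero_mem p₀ hp₀⟩
    exact (h 0 (mem_ball_self hε)).2 (𝓜.smoothState_zero hp₀) 0 (mem_ball_self hε)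
  have hu : IsOpen u := by
    rw [isOpen_iff_mem_nhds]
    rintro t ⟨ht, O, hO, hF⟩
    obtain ⟨Q, hQ, hQo, hQp⟩ := _root_.mem_nhds_iff.1 hO
    have hι : Continuous fun s : ℝ => (p₀, s) := by fun_prop
    filter_upwards [(𝓜.isOpen_dom_apply hp₀).mem_nhds ht,
      hι.continuousAt.preimage_mem_nhds (hQo.mem_nhds hQp)] with s hs hs'
    exact ⟨hs, O, Filter.mem_of_superset (hQo.mem_nhds hs') hQ, hF⟩
  have hcl : closure u ∩ 𝓜.dom p₀ ⊆ u := by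
    rintro t ⟨htu, ht⟩
    refine ⟨ht, ?_⟩
    obtain ⟨ε, hε, h⟩ := 𝓜.exists_smoothNear_of_smoothState (p₀ := p₀) (t₀ := t) ⟨hp₀, ht⟩
    obtain ⟨t', ht'u, ht'⟩ := Metric.mem_closure_iff.1 htu ε hε
    rw [dist_comm] at ht'
    obtain ⟨h1, h2⟩ := h t' ht'
    exact h2 (ht'u.2.smoothState 𝓜 h1) t (mem_ball_self hε)
  -- The set of times near which the family is smooth contains `0` and is open and closed.
  have := ((𝓜.interval_dom p₀ hp₀).isPreconnected).subset_of_closure_inter_subset hu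
    ⟨0, 𝓜.zero_mem p₀ hp₀, h0⟩ hcl
  exact (this ha.2).2

theorem contMDiffAt_point {a : (ℝ × ℝ) × ℝ} (ha : a ∈ 𝓜.pointDom) :
    ContMDiffAt 𝓘(ℝ, (ℝ × ℝ) × ℝ) 𝓘(ℝ, Plane) ∞ 𝓜.point a := by
  obtain ⟨O, hO, h⟩ := 𝓜.smoothNear ha
  exact h.contMDiffAt hO

end GeodesicManifold

end Smooth

/-! ### The contact form on the space of points of geodesics -/

section Exterior

variable {E F : Type*} [NormedAddCommGroup E] [NormedSpace ℝ E] [NormedAddCommGroup F]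
  [NormedSpace ℝ F]

theorem fderiv_fderiv_swap {f : E → F} {a : E} (hf : ContDiffAt ℝ 2 f a) (v w : E) :
    fderiv ℝ (fun b => fderiv ℝ f b v) a w = fderiv ℝ (fun b => fderiv ℝ f b w) a v := by
  have hd : DifferentiableAt ℝ (fderiv ℝ f) a :=
    (hf.fderiv_right (m := 1) (by norm_num)).differentiableAt (by simp)
  have h : ∀ u, fderiv ℝ (fun b => fderiv ℝ f b u) a = (fderiv ℝ (fderiv ℝ f) a).flip u := by
    intro u
    rw [(hd.hasFDerivAt.clm_apply (hasFDerivAt_const u a)).fderiv]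
    simp
  rw [h, h]
  exact (hf.isSymmSndFDerivAt (by simp)).eq w v

/-- The exterior derivative of the pullback `Ξ dX` of the canonical one-form under `(X, Ξ)`. -/
theorem exterior_deriv_pullback {X : E → F} {Ξ : E → F →L[ℝ] ℝ} {a : E} (hX : ContDiffAt ℝ 2 X a)
    (hΞ : DifferentiableAt ℝ Ξ a) {v w : E} {α β : E → ℝ}
    (hα : ∀ᶠ b in 𝓝 a, Ξ b (fderiv ℝ X b v) = α b)
    (hβ : ∀ᶠ b in 𝓝 a, Ξ b (fderiv ℝ X b w) = β b) :
    fderiv ℝ Ξ a v (fderiv ℝ X a w) - fderiv ℝ Ξ a w (fderiv ℝ X a v) =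
      fderiv ℝ β a v - fderiv ℝ α a w := by
  have hd : DifferentiableAt ℝ (fderiv ℝ X) a :=
    (hX.fderiv_right (m := 1) (by norm_num)).differentiableAt (by simp)
  have h : ∀ u u', fderiv ℝ (fun b => Ξ b (fderiv ℝ X b u)) a u' =
      fderiv ℝ Ξ a u' (fderiv ℝ X a u) + Ξ a (fderiv ℝ (fun b => fderiv ℝ X b u) a u') := by
    intro u u'
    rw [(hΞ.hasFDerivAt.clm_apply (hd.clm_apply
      (differentiableAt_const u)).hasFDerivAt).fderiv]
    simp [add_comm]
  rw [← Filter.EventuallyEq.fderiv_eq hα, ← Filter.EventuallyEq.fderiv_eq hβ, h, h,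
    fderiv_fderiv_swap hX v w]
  ring

end Exterior

namespace GeodesicManifold

variable {S : Type*} [TopologicalSpace S] [ChartedSpace Plane S] [IsManifold 𝓘(ℝ, Plane) ∞ S]
variable {g : Metric S} (𝓜 : GeodesicManifold g) (x₀ : S)

/-- The parameters of points in the domain of the chart centred at `x₀`. -/
def chartDom : Set ((ℝ × ℝ) × ℝ) := {a | a ∈ 𝓜.pointDom ∧ 𝓜.point a ∈ (chartAt Plane x₀).source}

/-- The coordinates of the point with given parameters. -/
def coordPoint (a : (ℝ × ℝ) × ℝ) : Plane := extChartAt 𝓘(ℝ, Plane) x₀ (𝓜.point a)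

/-- The components of the velocity at the point with given parameters. -/
def coordVel (a : (ℝ × ℝ) × ℝ) : Plane := fderiv ℝ (𝓜.coordPoint x₀) a (0, 1)

/-- The components of the covector dual to the velocity at the point with given parameters. -/
def coordMom (a : (ℝ × ℝ) × ℝ) : Plane →L[ℝ] ℝ :=
  gramL g x₀ (𝓜.coordPoint x₀ a) (𝓜.coordVel x₀ a)

theorem coordPoint_mem {a : (ℝ × ℝ) × ℝ} (ha : a ∈ 𝓜.chartDom x₀) :
    𝓜.coordPoint x₀ a ∈ (extChartAt 𝓘(ℝ, Plane) x₀).target :=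
  (extChartAt 𝓘(ℝ, Plane) x₀).map_source (mem_extChartAt_source_iff.2 ha.2)

variable [T2Space S]

theorem isOpen_chartDom : IsOpen (𝓜.chartDom x₀) := by
  rw [isOpen_iff_mem_nhds]
  intro a ha
  exact (𝓜.isOpen_pointDom.eventually_mem ha.1).and
    ((𝓜.contMDiffAt_point ha.1).continuousAt.eventually
      ((chartAt Plane x₀).open_source.mem_nhds ha.2))

theorem contDiffOn_coordPoint : ContDiffOn ℝ ∞ (𝓜.coordPoint x₀) (𝓜.chartDom x₀) := by
  intro a ha
  refine ContDiffAt.contDiffWithinAt ?_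
  rw [← contMDiffAt_iff_contDiffAt]
  exact ContMDiffAt.comp a (contMDiffAt_extChartAt' ha.2) (𝓜.contMDiffAt_point ha.1)

theorem contDiffAt_coordPoint {a : (ℝ × ℝ) × ℝ} (ha : a ∈ 𝓜.chartDom x₀) :
    ContDiffAt ℝ ∞ (𝓜.coordPoint x₀) a :=
  (𝓜.contDiffOn_coordPoint x₀).contDiffAt ((𝓜.isOpen_chartDom x₀).mem_nhds ha)

theorem contDiffOn_fderiv_coordPoint (w : (ℝ × ℝ) × ℝ) :
    ContDiffOn ℝ ∞ (fun a => fderiv ℝ (𝓜.coordPoint x₀) a w) (𝓜.chartDom x₀) :=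
  ((𝓜.contDiffOn_coordPoint x₀).fderiv_of_isOpen (𝓜.isOpen_chartDom x₀) (m := ∞)
    (by simp)).clm_apply contDiffOn_const

theorem contDiffAt_fderiv_coordPoint (w : (ℝ × ℝ) × ℝ) {a : (ℝ × ℝ) × ℝ}
    (ha : a ∈ 𝓜.chartDom x₀) : ContDiffAt ℝ ∞ (fun a => fderiv ℝ (𝓜.coordPoint x₀) a w) a :=
  (𝓜.contDiffOn_fderiv_coordPoint x₀ w).contDiffAt ((𝓜.isOpen_chartDom x₀).mem_nhds ha)

theorem hasFDerivAt_coordPoint {a : (ℝ × ℝ) × ℝ} (ha : a ∈ 𝓜.chartDom x₀) :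
    HasFDerivAt (𝓜.coordPoint x₀) (fderiv ℝ (𝓜.coordPoint x₀) a) a :=
  ((𝓜.contDiffAt_coordPoint x₀ ha).differentiableAt (by simp)).hasFDerivAt

theorem hasFDerivAt_coordVel {a : (ℝ × ℝ) × ℝ} (ha : a ∈ 𝓜.chartDom x₀) :
    HasFDerivAt (𝓜.coordVel x₀) (fderiv ℝ (𝓜.coordVel x₀) a) a :=
  ((𝓜.contDiffAt_fderiv_coordPoint x₀ _ ha).differentiableAt (by simp)).hasFDerivAt

theorem hasDerivAt_line {p : ℝ × ℝ} {t : ℝ} :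
    HasDerivAt (fun s : ℝ => (p, s)) ((0 : ℝ × ℝ), (1 : ℝ)) t :=
  (hasDerivAt_const t p).prodMk (hasDerivAt_id t)

theorem hasDerivAt_coordCurve_γ {p : ℝ × ℝ} {t : ℝ} (ha : (p, t) ∈ 𝓜.chartDom x₀) :
    HasDerivAt (coordCurve x₀ (𝓜.γ p)) (𝓜.coordVel x₀ (p, t)) t :=
  (𝓜.hasFDerivAt_coordPoint x₀ ha).comp_hasDerivAt t hasDerivAt_line

theorem coordVel_eq_toChart {p : ℝ × ℝ} {t : ℝ} (ha : (p, t) ∈ 𝓜.chartDom x₀) :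
    𝓜.coordVel x₀ (p, t) = toChart x₀ (𝓜.γ p t) (velocity (𝓜.γ p) t) :=
  (𝓜.hasDerivAt_coordCurve_γ x₀ ha).unique (hasDerivAt_coordCurve
    (((𝓜.geodesic p ha.1.1).1.contMDiffAt
      ((𝓜.isOpen_dom_apply ha.1.1).mem_nhds ha.1.2)).mdifferentiableAt (by simp)) ha.2)

/-- The geodesic equation. -/
theorem fderiv_coordVel {a : (ℝ × ℝ) × ℝ} (ha : a ∈ 𝓜.chartDom x₀) :
    fderiv ℝ (𝓜.coordVel x₀) a (0, 1) =
      -christoffelL g x₀ (𝓜.coordPoint x₀ a) (𝓜.coordVel x₀ a) (𝓜.coordVel x₀ a) := by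
  obtain ⟨p, t⟩ := a
  have h := (𝓜.geodesic p ha.1.1).2 t ha.1.2 x₀ ha.2
  rw [chartCovDeriv, christoffelVec_eq, (𝓜.hasDerivAt_coordCurve_γ x₀ ha).deriv,
    add_eq_zero_iff_eq_neg] at h
  refine Eq.trans (HasDerivAt.deriv ?_).symm h
  have h1 := (𝓜.hasFDerivAt_coordVel x₀ ha).comp_hasDerivAt t hasDerivAt_line
  refine h1.congr_of_eventuallyEq ?_
  have hι : Continuous fun s : ℝ => (p, s) := by fun_prop
  filter_upwards [hι.continuousAt.preimage_mem_nhds ((𝓜.isOpen_chartDom x₀).mem_nhds ha)] with s hs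
  exact (𝓜.hasDerivAt_coordCurve_γ x₀ hs).deriv

theorem hasFDerivAt_gramL_coordPoint {a : (ℝ × ℝ) × ℝ} (ha : a ∈ 𝓜.chartDom x₀) :
    HasFDerivAt (fun b => gramL g x₀ (𝓜.coordPoint x₀ b))
      ((fderiv ℝ (gramL g x₀) (𝓜.coordPoint x₀ a)).comp (fderiv ℝ (𝓜.coordPoint x₀) a)) a :=
  HasFDerivAt.comp (g := gramL g x₀) a (hasFDerivAt_gramL g x₀ (𝓜.coordPoint_mem x₀ ha))
    (𝓜.hasFDerivAt_coordPoint x₀ ha)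

/-- The Euler-Lagrange equations: `d/dt g(γ', ∂_w γ) = ∂_w |γ'|² / 2`. -/
theorem fderiv_gramL_coordVel {a : (ℝ × ℝ) × ℝ} (ha : a ∈ 𝓜.chartDom x₀) (w : (ℝ × ℝ) × ℝ) :
    fderiv ℝ (fun b => 𝓜.coordMom x₀ b (fderiv ℝ (𝓜.coordPoint x₀) b w)) a (0, 1) =
      1 / 2 * fderiv ℝ (fun b => 𝓜.coordMom x₀ b (𝓜.coordVel x₀ b)) a w := by
  have hw : HasFDerivAt (fun b => fderiv ℝ (𝓜.coordPoint x₀) b w)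
      (fderiv ℝ (fun b => fderiv ℝ (𝓜.coordPoint x₀) b w) a) a :=
    ((𝓜.contDiffAt_fderiv_coordPoint x₀ w ha).differentiableAt (by simp)).hasFDerivAt
  have h1 := ((𝓜.hasFDerivAt_gramL_coordPoint x₀ ha).clm_apply
    (𝓜.hasFDerivAt_coordVel x₀ ha)).clm_apply hw
  have h2 := ((𝓜.hasFDerivAt_gramL_coordPoint x₀ ha).clm_apply
    (𝓜.hasFDerivAt_coordVel x₀ ha)).clm_apply (𝓜.hasFDerivAt_coordVel x₀ ha)
  simp only [coordMom]
  rw [h1.fderiv, h2.fderiv]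
  have h3 : fderiv ℝ (fun b => fderiv ℝ (𝓜.coordPoint x₀) b w) a (0, 1) =
      fderiv ℝ (𝓜.coordVel x₀) a w :=
    fderiv_fderiv_swap ((𝓜.contDiffAt_coordPoint x₀ ha).of_le ENat.LEInfty.out) _ _
  have h4 : fderiv ℝ (𝓜.coordPoint x₀) a (0, 1) = 𝓜.coordVel x₀ a := rfl
  simp only [_root_.add_apply, ContinuousLinearMap.comp_apply, ContinuousLinearMap.flip_apply, h3,
    h4, 𝓜.fderiv_coordVel x₀ ha, map_neg, _root_.neg_apply,
    gramL_christoffelL g x₀ (𝓜.coordPoint_mem x₀ ha)]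
  rw [gramL_symm g x₀ _ (fderiv ℝ (𝓜.coordVel x₀) a w)]
  ring

/-- The pairing of the velocity with the derivative of the family of geodesics in the direction
`w`. -/
def velPairing (w a : (ℝ × ℝ) × ℝ) : ℝ :=
  g.inner (𝓜.point a) (mfderiv 𝓘(ℝ, (ℝ × ℝ) × ℝ) 𝓘(ℝ, Plane) 𝓜.point a (0, 1))
    (mfderiv 𝓘(ℝ, (ℝ × ℝ) × ℝ) 𝓘(ℝ, Plane) 𝓜.point a w)

theorem toChart_mfderiv_point {a : (ℝ × ℝ) × ℝ} (ha : a ∈ 𝓜.chartDom x₀) (w : (ℝ × ℝ) × ℝ) :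
    toChart x₀ (𝓜.point a) (mfderiv 𝓘(ℝ, (ℝ × ℝ) × ℝ) 𝓘(ℝ, Plane) 𝓜.point a w) =
      fderiv ℝ (𝓜.coordPoint x₀) a w := by
  have h1 : HasMFDerivAt 𝓘(ℝ, Plane) 𝓘(ℝ, Plane) (extChartAt 𝓘(ℝ, Plane) x₀) (𝓜.point a)
      (toChart x₀ (𝓜.point a)) := (mdifferentiableAt_extChartAt ha.2).hasMFDerivAt
  have h2 := h1.comp a ((𝓜.contMDiffAt_point ha.1).mdifferentiableAt (by simp)).hasMFDerivAt
  have h3 : HasFDerivAt (𝓜.coordPoint x₀) ((toChart x₀ (𝓜.point a)).comp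
      (mfderiv 𝓘(ℝ, (ℝ × ℝ) × ℝ) 𝓘(ℝ, Plane) 𝓜.point a) : (ℝ × ℝ) × ℝ →L[ℝ] Plane) a :=
    h2.hasFDerivAt
  rw [h3.fderiv]
  rfl

theorem velPairing_eq {a : (ℝ × ℝ) × ℝ} (ha : a ∈ 𝓜.chartDom x₀) (w : (ℝ × ℝ) × ℝ) :
    𝓜.velPairing w a = 𝓜.coordMom x₀ a (fderiv ℝ (𝓜.coordPoint x₀) a w) := by
  rw [velPairing, inner_eq_gramL g x₀ (mem_extChartAt_source_iff.2 ha.2),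
    𝓜.toChart_mfderiv_point x₀ ha, 𝓜.toChart_mfderiv_point x₀ ha]
  rfl

theorem velPairing_eventuallyEq {a : (ℝ × ℝ) × ℝ} (ha : a ∈ 𝓜.chartDom x₀)
    (w : (ℝ × ℝ) × ℝ) : 𝓜.velPairing w =ᶠ[𝓝 a]
      fun b => 𝓜.coordMom x₀ b (fderiv ℝ (𝓜.coordPoint x₀) b w) := by
  filter_upwards [(𝓜.isOpen_chartDom x₀).mem_nhds ha] with b hb
  exact 𝓜.velPairing_eq x₀ hb w

theorem contDiffOn_coordMom : ContDiffOn ℝ ∞ (𝓜.coordMom x₀) (𝓜.chartDom x₀) :=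
  ((contDiffOn_gramL g x₀).comp (𝓜.contDiffOn_coordPoint x₀)
    fun _ ha => 𝓜.coordPoint_mem x₀ ha).clm_apply (𝓜.contDiffOn_fderiv_coordPoint x₀ _)

theorem hasFDerivAt_coordMom {a : (ℝ × ℝ) × ℝ} (ha : a ∈ 𝓜.chartDom x₀) :
    HasFDerivAt (𝓜.coordMom x₀) (fderiv ℝ (𝓜.coordMom x₀) a) a :=
  (((𝓜.contDiffOn_coordMom x₀).contDiffAt ((𝓜.isOpen_chartDom x₀).mem_nhds ha)).differentiableAt
    (by simp)).hasFDerivAt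

theorem differentiableAt_velPairing {a : (ℝ × ℝ) × ℝ} (ha : a ∈ 𝓜.pointDom)
    (w : (ℝ × ℝ) × ℝ) : DifferentiableAt ℝ (𝓜.velPairing w) a := by
  have ha' : a ∈ 𝓜.chartDom (𝓜.point a) := ⟨ha, mem_chart_source _ _⟩
  refine DifferentiableAt.congr_of_eventuallyEq ?_ (𝓜.velPairing_eventuallyEq _ ha' w)
  exact ((𝓜.hasFDerivAt_coordMom _ ha').clm_apply ((𝓜.contDiffAt_fderiv_coordPoint _ w
    ha').differentiableAt (by simp)).hasFDerivAt).differentiableAt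

theorem fderiv_velPairing {a : (ℝ × ℝ) × ℝ} (ha : a ∈ 𝓜.pointDom) (w : (ℝ × ℝ) × ℝ) :
    fderiv ℝ (𝓜.velPairing w) a (0, 1) = 1 / 2 * fderiv ℝ (𝓜.velPairing (0, 1)) a w := by
  have ha' : a ∈ 𝓜.chartDom (𝓜.point a) := ⟨ha, mem_chart_source _ _⟩
  rw [(𝓜.velPairing_eventuallyEq _ ha' w).fderiv_eq,
    (𝓜.velPairing_eventuallyEq _ ha' (0, 1)).fderiv_eq]
  exact 𝓜.fderiv_gramL_coordVel _ ha' w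

/-- A pairing `g(γ', ∂_w γ)` with vanishing time derivative is constant along geodesics. -/
theorem velPairing_eq_of_fderiv_eq_zero {w : (ℝ × ℝ) × ℝ}
    (hw : ∀ a ∈ 𝓜.pointDom, fderiv ℝ (𝓜.velPairing w) a (0, 1) = 0) {p : ℝ × ℝ} {t : ℝ}
    (h : (p, t) ∈ 𝓜.pointDom) : 𝓜.velPairing w (p, t) = 𝓜.velPairing w (p, 0) := by
  have hd : ∀ s ∈ 𝓜.dom p, HasDerivAt (fun s => 𝓜.velPairing w (p, s)) 0 s := by
    intro s hs
    have hs' : (p, s) ∈ 𝓜.pointDom := ⟨h.1, hs⟩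
    have := (𝓜.differentiableAt_velPairing hs' w).hasFDerivAt.comp_hasDerivAt s hasDerivAt_line
    rwa [hw _ hs'] at this
  exact (𝓜.isOpen_dom_apply h.1).is_const_of_deriv_eq_zero
    (𝓜.interval_dom p h.1).isPreconnected
    (fun s hs => (hd s hs).differentiableAt.differentiableWithinAt)
    (fun s hs => (hd s hs).deriv) h.2 (𝓜.zero_mem p h.1)

/-- At time `0` the family is `(y, η) ↦ h(y)`, and `g(γ', h') = η`. -/
theorem velPairing_zero {p : ℝ × ℝ} (hp : p ∈ 𝓜.W) (w : (ℝ × ℝ) × ℝ) :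
    𝓜.velPairing w (p, 0) = p.2 * w.1.1 + w.2 := by
  have ha : (p, (0 : ℝ)) ∈ 𝓜.pointDom := ⟨hp, 𝓜.zero_mem p hp⟩
  set x₀ := 𝓜.γ p 0 with hx₀
  have ha' : (p, (0 : ℝ)) ∈ 𝓜.chartDom x₀ := ⟨ha, mem_chart_source _ _⟩
  obtain ⟨θ, hθ, h1, h2, -⟩ := 𝓜.direction p hp
  have hs : 𝓜.h p.1 ∈ (chartAt Plane x₀).source := by
    rw [hx₀, 𝓜.start p hp]
    exact mem_chart_source _ _
  rw [inner_eq_gramL g x₀ (mem_extChartAt_source_iff.2 hs)] at h1 h2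
  have hv : 𝓜.coordVel x₀ (p, 0) = toChart x₀ (𝓜.h p.1) θ := by
    rw [𝓜.coordVel_eq_toChart x₀ ha']
    exact congrArg (fun q : TangentBundle 𝓘(ℝ, Plane) S => toChart x₀ q.1 q.2) hθ
  have hX : 𝓜.coordPoint x₀ (p, 0) = extChartAt 𝓘(ℝ, Plane) x₀ (𝓜.h p.1) :=
    congrArg _ (𝓜.start p hp)
  have hh := hasDerivAt_coordCurve ((𝓜.smooth_h.contMDiffAt
    (𝓜.isOpen_Y.mem_nhds (𝓜.fst_mem p hp))).mdifferentiableAt (by simp)) hs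
  have hw : fderiv ℝ (𝓜.coordPoint x₀) (p, 0) w =
      w.1.1 • toChart x₀ (𝓜.h p.1) (velocity 𝓜.h p.1) + w.2 • 𝓜.coordVel x₀ (p, 0) := by
    have hsplit : w = (w.1, 0) + w.2 • ((0 : ℝ × ℝ), (1 : ℝ)) := by
      ext <;> simp
    have h3 : HasFDerivAt (fun q : ℝ × ℝ => (q, (0 : ℝ)))
        ((ContinuousLinearMap.id ℝ (ℝ × ℝ)).prod 0) p :=
      (hasFDerivAt_id p).prodMk (hasFDerivAt_const 0 p)
    have h4 := HasFDerivAt.comp (g := 𝓜.coordPoint x₀) p (𝓜.hasFDerivAt_coordPoint x₀ ha') h3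
    have h5 : HasFDerivAt (fun q : ℝ × ℝ => coordCurve x₀ 𝓜.h q.1) _ p :=
      HasFDerivAt.comp (g := coordCurve x₀ 𝓜.h) p hh.hasFDerivAt hasFDerivAt_fst
    have h6 : (𝓜.coordPoint x₀ ∘ fun q : ℝ × ℝ => (q, (0 : ℝ))) =ᶠ[𝓝 p]
        fun q : ℝ × ℝ => coordCurve x₀ 𝓜.h q.1 := by
      filter_upwards [𝓜.isOpen_W.mem_nhds hp] with q hq
      exact congrArg _ (𝓜.start q hq)
    have h7 := congrArg (fun L : ℝ × ℝ →L[ℝ] Plane => L w.1)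
      (h4.unique (h5.congr_of_eventuallyEq h6))
    simp only [ContinuousLinearMap.comp_apply, ContinuousLinearMap.prod_apply,
      ContinuousLinearMap.id_apply, _root_.zero_apply] at h7
    conv_lhs => rw [hsplit]
    rw [map_add, map_smul, h7]
    simp [coordVel]
  rw [𝓜.velPairing_eq x₀ ha', hw]
  simp only [coordMom, hv, hX, map_add, map_smul, smul_eq_mul, h1, h2]
  ring

/-- The pullback of the one-form `g(γ', ·)` to the space of points of geodesics is the contact form
`η dy + dt`. -/
theorem coordMom_fderiv {a : (ℝ × ℝ) × ℝ} (ha : a ∈ 𝓜.chartDom x₀) (w : (ℝ × ℝ) × ℝ) :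
    𝓜.coordMom x₀ a (fderiv ℝ (𝓜.coordPoint x₀) a w) = a.1.2 * w.1.1 + w.2 := by
  -- The geodesics have unit speed, so the right-hand side of the Euler-Lagrange equations
  -- vanishes.
  have hE : ∀ b ∈ 𝓜.pointDom, 𝓜.velPairing (0, 1) b = 1 := by
    intro b hb
    rw [𝓜.velPairing_eq_of_fderiv_eq_zero (fun c hc => ?_) (p := b.1) (t := b.2) hb,
      𝓜.velPairing_zero hb.1]
    · simp
    · linarith [𝓜.fderiv_velPairing hc (0, 1)]
  rw [← 𝓜.velPairing_eq x₀ ha, 𝓜.velPairing_eq_of_fderiv_eq_zero (fun c hc => ?_) (p := a.1)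
    (t := a.2) ha.1, 𝓜.velPairing_zero ha.1.1]
  have h1 : 𝓜.velPairing (0, 1) =ᶠ[𝓝 c] fun _ => (1 : ℝ) := by
    filter_upwards [𝓜.isOpen_pointDom.mem_nhds hc] with b hb
    exact hE b hb
  rw [𝓜.fderiv_velPairing hc, h1.fderiv_eq]
  simp

/-- The exterior derivative of the contact form is `dη ∧ dy`. -/
theorem fderiv_coordMom {a : (ℝ × ℝ) × ℝ} (ha : a ∈ 𝓜.chartDom x₀) (m w : (ℝ × ℝ) × ℝ) :
    fderiv ℝ (𝓜.coordMom x₀) a m (fderiv ℝ (𝓜.coordPoint x₀) a w) -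
      fderiv ℝ (𝓜.coordMom x₀) a w (fderiv ℝ (𝓜.coordPoint x₀) a m) =
      m.1.2 * w.1.1 - w.1.2 * m.1.1 := by
  have h : ∀ w : (ℝ × ℝ) × ℝ, ∀ᶠ b in 𝓝 a,
      𝓜.coordMom x₀ b (fderiv ℝ (𝓜.coordPoint x₀) b w) = b.1.2 * w.1.1 + w.2 := by
    intro w
    filter_upwards [(𝓜.isOpen_chartDom x₀).mem_nhds ha] with b hb
    exact 𝓜.coordMom_fderiv x₀ hb w
  have hd : ∀ w v : (ℝ × ℝ) × ℝ,
      fderiv ℝ (fun b : (ℝ × ℝ) × ℝ => b.1.2 * w.1.1 + w.2) a v = v.1.2 * w.1.1 := by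
    intro w v
    have h1 : HasFDerivAt (fun b : (ℝ × ℝ) × ℝ => b.1.2)
        ((ContinuousLinearMap.snd ℝ ℝ ℝ).comp (ContinuousLinearMap.fst ℝ (ℝ × ℝ) ℝ)) a :=
      ((ContinuousLinearMap.snd ℝ ℝ ℝ).comp (ContinuousLinearMap.fst ℝ (ℝ × ℝ) ℝ)).hasFDerivAt
    rw [((h1.mul_const w.1.1).add_const w.2).fderiv]
    simp [mul_comm]
  rw [exterior_deriv_pullback ((𝓜.contDiffAt_coordPoint x₀ ha).of_le ENat.LEInfty.out)
    (𝓜.hasFDerivAt_coordMom x₀ ha).differentiableAt (h m) (h w), hd, hd]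

/-- The derivative `j'` of a Jacobi field `j = ∂_m γ + d t γ'` where `j` vanishes. -/
theorem gramL_fderiv_coordVel {a m : (ℝ × ℝ) × ℝ} (ha : a ∈ 𝓜.chartDom x₀)
    (hm : fderiv ℝ (𝓜.coordPoint x₀) a m = 0) (d : ℝ) (w : (ℝ × ℝ) × ℝ) :
    gramL g x₀ (𝓜.coordPoint x₀ a) (fderiv ℝ (𝓜.coordVel x₀) a m + d • 𝓜.coordVel x₀ a)
      (fderiv ℝ (𝓜.coordPoint x₀) a w) =
      m.1.2 * w.1.1 - w.1.2 * m.1.1 + d * (a.1.2 * w.1.1 + w.2) := by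
  have h1 := 𝓜.fderiv_coordMom x₀ ha m w
  have h2 : fderiv ℝ (𝓜.coordMom x₀) a m =
      gramL g x₀ (𝓜.coordPoint x₀ a) (fderiv ℝ (𝓜.coordVel x₀) a m) := by
    have h3 := (𝓜.hasFDerivAt_gramL_coordPoint x₀ ha).clm_apply (𝓜.hasFDerivAt_coordVel x₀ ha)
    have h5 : fderiv ℝ (𝓜.coordMom x₀) a = _ := h3.fderiv
    rw [h5]
    simp [hm]
  rw [hm, map_zero, sub_zero, h2] at h1
  have h4 : gramL g x₀ (𝓜.coordPoint x₀ a) (𝓜.coordVel x₀ a) = 𝓜.coordMom x₀ a := rfl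
  rw [map_add, map_smul, _root_.add_apply, _root_.smul_apply, h1, h4, 𝓜.coordMom_fderiv x₀ ha,
    smul_eq_mul]

theorem coordVel_ne_zero {a : (ℝ × ℝ) × ℝ} (ha : a ∈ 𝓜.chartDom x₀) : 𝓜.coordVel x₀ a ≠ 0 := by
  intro h
  have := 𝓜.coordMom_fderiv x₀ ha (0, 1)
  simp [coordMom, h] at this

/-- The Jacobi fields `∂_m γ + d t γ'` are linearly independent to first order at every point, since
`dη ∧ dy` is nondegenerate on the space of geodesics. -/
theorem eq_zero_of_jacobi_eq_zero {a m : (ℝ × ℝ) × ℝ} (ha : a ∈ 𝓜.chartDom x₀) {d : ℝ}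
    (hm : fderiv ℝ (𝓜.coordPoint x₀) a m = 0)
    (hd : fderiv ℝ (𝓜.coordVel x₀) a m + d • 𝓜.coordVel x₀ a = 0) : m = 0 ∧ d = 0 := by
  have h := 𝓜.gramL_fderiv_coordVel x₀ ha hm d
  rw [hd] at h
  have h1 := h (0, 1)
  have h2 := h ((1, 0), 0)
  have h3 := h ((0, 1), 0)
  simp at h1 h2 h3
  rw [← h1] at h2
  simp at h2
  refine ⟨?_, h1.symm⟩
  obtain ⟨⟨m₁, m₂⟩, m₃⟩ := m
  simp only at h2 h3
  obtain rfl : m₁ = 0 := by linarith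
  obtain rfl : m₂ = 0 := by linarith
  have h4 : ((((0 : ℝ), (0 : ℝ)), m₃) : (ℝ × ℝ) × ℝ) = m₃ • ((0 : ℝ × ℝ), (1 : ℝ)) := by
    ext <;> simp
  rw [h4, map_smul, smul_eq_zero] at hm
  rcases hm with rfl | hm
  · rfl
  · exact absurd hm (𝓜.coordVel_ne_zero x₀ ha)

end GeodesicManifold

/-! ### Jacobi fields -/

section Jacobi

variable {S : Type*} [TopologicalSpace S] [ChartedSpace Plane S]

theorem coordField_eq {x₀ : S} (c : ℝ → S) (J : ∀ t, TangentSpace 𝓘(ℝ, Plane) (c t)) (t : ℝ) :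
    coordField x₀ c J t = toChart x₀ (c t) (J t) := rfl

variable [IsManifold 𝓘(ℝ, Plane) ∞ S] (g : Metric S) (x₀ : S)

theorem fderiv_christoffelL_symm {z : Plane} (hz : z ∈ (extChartAt 𝓘(ℝ, Plane) x₀).target)
    (w u v : Plane) :
    fderiv ℝ (christoffelL g x₀) z w u v = fderiv ℝ (christoffelL g x₀) z w v u := by
  have h : ∀ u v, HasFDerivAt (fun z => christoffelL g x₀ z u v)
      (((fderiv ℝ (christoffelL g x₀) z).flip u).flip v) z := by
    intro u v
    refine HasFDerivAt.congr_fderiv (((hasFDerivAt_christoffelL g x₀ hz).clm_apply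
      (hasFDerivAt_const u z)).clm_apply (hasFDerivAt_const v z)) ?_
    ext w
    simp
  have h1 := (h u v).unique ((h v u).congr_of_eventuallyEq
    (Eventually.of_forall fun z => christoffelL_symm g x₀ z u v))
  exact congrArg (fun L : Plane →L[ℝ] Plane => L w) h1

/-- The acceleration of a solution of the linearized geodesic equation. -/
def linAccel (x v j k : Plane) : Plane :=
  -((2 : ℝ) • christoffelL g x₀ x v k + fderiv ℝ (christoffelL g x₀) x j v v)

/-- Along a geodesic, the Jacobi equation is the linearization of the geodesic equation. -/
theorem chartCovDeriv_chartCovDeriv {x j : ℝ → Plane} {t : ℝ}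
    (hz : x t ∈ (extChartAt 𝓘(ℝ, Plane) x₀).target) (hx : ContDiffAt ℝ ∞ x t)
    (hj : ContDiffAt ℝ ∞ j t)
    (hgeo : deriv (deriv x) t = -christoffelL g x₀ (x t) (deriv x t) (deriv x t)) :
    chartCovDeriv g x₀ x (chartCovDeriv g x₀ x j) t
      + curvVec g x₀ (x t) (j t) (deriv x t) (deriv x t) =
      deriv (deriv j) t - linAccel g x₀ (x t) (deriv x t) (j t) (deriv j t) := by
  have hd : ∀ {y : ℝ → Plane}, ContDiffAt ℝ ∞ y t →
      HasDerivAt y (deriv y t) t ∧ HasDerivAt (deriv y) (deriv (deriv y) t) t := by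
    intro y hy
    refine ⟨(hy.differentiableAt (by simp)).hasDerivAt, DifferentiableAt.hasDerivAt ?_⟩
    have : ContDiffAt ℝ ∞ (deriv y) t := by
      simpa [fderiv_apply_one_eq_deriv] using
        (hy.fderiv_right (m := ∞) (by simp)).clm_apply (contDiffAt_const (c := (1 : ℝ)))
    exact this.differentiableAt (by simp)
  have hΓ : HasDerivAt (fun s => christoffelL g x₀ (x s))
      (fderiv ℝ (christoffelL g x₀) (x t) (deriv x t)) t :=
    HasFDerivAt.comp_hasDerivAt (l := christoffelL g x₀) t (hasFDerivAt_christoffelL g x₀ hz)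
      (hd hx).1
  have h1 : HasDerivAt (chartCovDeriv g x₀ x j) (deriv (deriv j) t +
      ((fderiv ℝ (christoffelL g x₀) (x t) (deriv x t) (deriv x t)
        + christoffelL g x₀ (x t) (deriv (deriv x) t)) (j t)
        + christoffelL g x₀ (x t) (deriv x t) (deriv j t))) t := by
    refine HasDerivAt.congr_of_eventuallyEq
      ((hd hj).2.add ((hΓ.clm_apply (hd hx).2).clm_apply (hd hj).1))
      (Eventually.of_forall fun s => ?_)
    simp only [chartCovDeriv, christoffelVec_eq]
    rfl
  rw [chartCovDeriv, h1.deriv, curvVec_eq g x₀ hz, christoffelVec_eq]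
  simp only [chartCovDeriv, christoffelVec_eq, linAccel, hgeo, map_add, map_neg,
    _root_.add_apply, _root_.neg_apply]
  rw [fderiv_christoffelL_symm g x₀ hz (deriv x t) (j t) (deriv x t),
    christoffelL_symm g x₀ _ (j t) (christoffelL g x₀ (x t) (deriv x t) (deriv x t)),
    christoffelL_symm g x₀ _ (j t) (deriv x t)]
  module

/-- The joint geodesic and Jacobi equations in a chart, as an autonomous first order system. -/
def jacobiSpray (X : (Plane × Plane) × (Plane × Plane)) : (Plane × Plane) × (Plane × Plane) :=
  (spray g x₀ X.1, (X.2.2, linAccel g x₀ X.1.1 X.1.2 X.2.1 X.2.2))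

theorem contDiffAt_jacobiSpray {X : (Plane × Plane) × (Plane × Plane)}
    (hX : X.1.1 ∈ (extChartAt 𝓘(ℝ, Plane) x₀).target) :
    ContDiffAt ℝ ∞ (jacobiSpray g x₀) X := by
  have hn := (isOpen_extChartAt_target (I := 𝓘(ℝ, Plane)) x₀).mem_nhds hX
  have h1 : ContDiffAt ℝ ∞ (spray g x₀) X.1 :=
    (contDiffOn_spray g x₀).contDiffAt ((isOpen_sprayDom x₀).mem_nhds ⟨hX, mem_univ _⟩)
  have h2 : ContDiffAt ℝ ∞ (fun X : (Plane × Plane) × (Plane × Plane) =>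
      christoffelL g x₀ X.1.1) X :=
    ContDiffAt.comp (g := christoffelL g x₀) X ((contDiffOn_christoffelL g x₀).contDiffAt hn)
      (contDiffAt_fst.comp X contDiffAt_fst)
  have hv : ContDiffAt ℝ ∞ (fun X : (Plane × Plane) × (Plane × Plane) => X.1.2) X :=
    contDiffAt_snd.comp X contDiffAt_fst
  have hj : ContDiffAt ℝ ∞ (fun X : (Plane × Plane) × (Plane × Plane) => X.2.1) X :=
    contDiffAt_fst.comp X contDiffAt_snd
  have hk : ContDiffAt ℝ ∞ (fun X : (Plane × Plane) × (Plane × Plane) => X.2.2) X :=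
    contDiffAt_snd.comp X contDiffAt_snd
  have h3 : ContDiffAt ℝ ∞ (fun X : (Plane × Plane) × (Plane × Plane) =>
      fderiv ℝ (christoffelL g x₀) X.1.1 X.2.1 X.1.2 X.1.2) X := by
    have hc : ∀ i {f : (Plane × Plane) × (Plane × Plane) → Plane}, ContDiffAt ℝ ∞ f X →
        ContDiffAt ℝ ∞ (fun X => f X i) X := fun i f hf =>
      (EuclideanSpace.proj (𝕜 := ℝ) i : Plane →L[ℝ] ℝ).contDiff.contDiffAt.comp X hf
    have hd : ∀ k i j l, ContDiffAt ℝ ∞ (fun X : (Plane × Plane) × (Plane × Plane) =>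
        fderiv ℝ (christoffel g x₀ k i j) X.1.1 (basisVec l)) X := fun k i j l =>
      ContDiffAt.comp (g := fun z => fderiv ℝ (christoffel g x₀ k i j) z (basisVec l)) X
        ((((contDiffOn_christoffel g x₀ k i j).fderiv_of_isOpen (isOpen_extChartAt_target x₀)
          (m := ∞) (by simp)).clm_apply contDiffOn_const).contDiffAt hn)
        (contDiffAt_fst.comp X contDiffAt_fst)
    refine ContDiffAt.congr_of_eventuallyEq (ContDiffAt.sum (s := Finset.univ) fun k _ =>
      (ContDiffAt.sum (s := Finset.univ) fun l _ => ContDiffAt.sum (s := Finset.univ) fun i _ =>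
        ContDiffAt.sum (s := Finset.univ) fun j _ =>
        (((hd k i j l).mul (hc l hj)).mul (hc i hv)).mul (hc j hv)).smul
        (contDiffAt_const (c := basisVec k))) ?_
    filter_upwards [(continuous_fst.comp continuous_fst).continuousAt.preimage_mem_nhds hn]
      with Z hZ
    exact fderiv_christoffelL g x₀ hZ _ _ _
  have h4 : ContDiffAt ℝ ∞ (fun X : (Plane × Plane) × (Plane × Plane) =>
      (2 : ℝ) • christoffelL g x₀ X.1.1 X.1.2 X.2.2) X :=
    ((h2.clm_apply hv).clm_apply hk).const_smul (2 : ℝ)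
  have h5 : ContDiffAt ℝ ∞ (fun X : (Plane × Plane) × (Plane × Plane) =>
      linAccel g x₀ X.1.1 X.1.2 X.2.1 X.2.2) X := (h4.add h3).neg
  have h6 : ContDiffAt ℝ ∞ (fun X : (Plane × Plane) × (Plane × Plane) => spray g x₀ X.1) X :=
    h1.comp X contDiffAt_fst
  exact h6.prodMk (hk.prodMk h5)

variable {g x₀}

theorem contDiffAt_deriv {F : Type*} [NormedAddCommGroup F] [NormedSpace ℝ F] {y : ℝ → F} {t : ℝ}
    (hy : ContDiffAt ℝ ∞ y t) : ContDiffAt ℝ ∞ (deriv y) t := by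
  simpa [fderiv_apply_one_eq_deriv] using
    (hy.fderiv_right (m := ∞) (by simp)).clm_apply (contDiffAt_const (c := (1 : ℝ)))

section Curve

variable {c : ℝ → S} {T : Set ℝ} {J : ∀ t, TangentSpace 𝓘(ℝ, Plane) (c t)}

theorem IsJacobiOn.contDiffAt (hJ : IsJacobiOn g c J T) (hT : IsOpen T)
    (hc : ContMDiffOn 𝓘(ℝ, ℝ) 𝓘(ℝ, Plane) ∞ c T) {t : ℝ} (ht : t ∈ T)
    (hx : c t ∈ (chartAt Plane x₀).source) : ContDiffAt ℝ ∞ (coordField x₀ c J) t :=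
  (contMDiffAt_tangent_iff hx (hc.contMDiffAt (hT.mem_nhds ht))).1
    (hJ.1.contMDiffAt (hT.mem_nhds ht))

theorem IsGeodesicOn.deriv_deriv (hc : IsGeodesicOn g c T) {t : ℝ} (ht : t ∈ T)
    (hx : c t ∈ (chartAt Plane x₀).source) : deriv (deriv (coordCurve x₀ c)) t =
      -christoffelL g x₀ (coordCurve x₀ c t) (deriv (coordCurve x₀ c) t)
        (deriv (coordCurve x₀ c) t) := by
  have h := hc.2 t ht x₀ hx
  rwa [chartCovDeriv, christoffelVec_eq, add_eq_zero_iff_eq_neg] at h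

/-- Jacobi fields along geodesics are the fields that satisfy the linearized geodesic equation in
all charts. -/
theorem isJacobiOn_iff (hc : IsGeodesicOn g c T) (hT : IsOpen T) : IsJacobiOn g c J T ↔
    ∀ t ∈ T, ∀ x₀ : S, c t ∈ (chartAt Plane x₀).source →
      ContDiffAt ℝ ∞ (coordField x₀ c J) t ∧ deriv (deriv (coordField x₀ c J)) t =
        linAccel g x₀ (coordCurve x₀ c t) (deriv (coordCurve x₀ c) t) (coordField x₀ c J t)
          (deriv (coordField x₀ c J) t) := by
  have key : ∀ t ∈ T, ∀ x₀ : S, c t ∈ (chartAt Plane x₀).source →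
      ContDiffAt ℝ ∞ (coordField x₀ c J) t → _ :=
    fun t ht x₀ hx hj => chartCovDeriv_chartCovDeriv g x₀ (x := coordCurve x₀ c)
      ((extChartAt 𝓘(ℝ, Plane) x₀).map_source (mem_extChartAt_source_iff.2 hx))
      (contDiffAt_coordCurve hT ht hc.1 hx) hj (hc.deriv_deriv ht hx)
  constructor
  · intro hJ t ht x₀ hx
    have hj := hJ.contDiffAt hT hc.1 ht hx
    refine ⟨hj, sub_eq_zero.1 ?_⟩
    rw [← key t ht x₀ hx hj]
    exact hJ.2 t ht x₀ hx
  · intro h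
    refine ⟨fun t ht => ContMDiffAt.contMDiffWithinAt ?_, fun t ht x₀ hx => ?_⟩
    · have hx : c t ∈ (chartAt Plane (c t)).source := mem_chart_source _ _
      exact (contMDiffAt_tangent_iff hx (hc.1.contMDiffAt (hT.mem_nhds ht))).2
        (h t ht _ hx).1
    · rw [key t ht x₀ hx (h t ht x₀ hx).1]
      exact sub_eq_zero.2 (h t ht x₀ hx).2

variable {J' : ∀ t, TangentSpace 𝓘(ℝ, Plane) (c t)}

/-- Together with the geodesic, a Jacobi field solves an autonomous first order system. -/
theorem IsJacobiOn.eventually_eq (hc : IsGeodesicOn g c T) (hT : IsOpen T)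
    (hJ : IsJacobiOn g c J T) (hJ' : IsJacobiOn g c J' T) {t : ℝ} (ht : t ∈ T)
    (hx : c t ∈ (chartAt Plane x₀).source) (h0 : coordField x₀ c J t = coordField x₀ c J' t)
    (h1 : deriv (coordField x₀ c J) t = deriv (coordField x₀ c J') t) :
    ∀ᶠ s in 𝓝 t, J s = J' s := by
  have hev := eventually_mem_source hT ht hc.1 hx
  have key : ∀ {J : ∀ t, TangentSpace 𝓘(ℝ, Plane) (c t)}, IsJacobiOn g c J T →
      ∀ᶠ s in 𝓝 t, HasDerivAt
        (fun s => (coordState x₀ c s, (coordField x₀ c J s, deriv (coordField x₀ c J) s)))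
        (jacobiSpray g x₀ (coordState x₀ c s, (coordField x₀ c J s, deriv (coordField x₀ c J) s)))
        s := by
    intro J hJ
    filter_upwards [hev] with s hs
    have h := (isJacobiOn_iff hc hT).1 hJ s hs.1 x₀ hs.2
    have h2 := ((contDiffAt_deriv h.1).differentiableAt (by simp)).hasDerivAt
    rw [h.2] at h2
    exact (hc.hasDerivAt_coordState hT hs.1 hs.2).prodMk
      ((h.1.differentiableAt (by simp)).hasDerivAt.prodMk h2)
  have h2 := eventuallyEq_of_hasDerivAt ((contDiffAt_jacobiSpray g x₀
    ((extChartAt 𝓘(ℝ, Plane) x₀).map_source (mem_extChartAt_source_iff.2 hx))).of_le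
      (by simp)) (key hJ) (key hJ') (by rw [h0, h1])
  filter_upwards [h2, hev] with s hs hs'
  exact toChart_injective x₀ (mem_extChartAt_source_iff.2 hs'.2) (Prod.ext_iff.1
    (Prod.ext_iff.1 hs).2).1

/-- Jacobi fields that agree to first order at one time agree. -/
theorem IsJacobiOn.eq_of_eq (hc : IsGeodesicOn g c T) (hT : IsOpen T) (hT' : IsPreconnected T)
    (hJ : IsJacobiOn g c J T) (hJ' : IsJacobiOn g c J' T) {t₀ : ℝ} (ht₀ : t₀ ∈ T)
    (hx : c t₀ ∈ (chartAt Plane x₀).source) (h0 : coordField x₀ c J t₀ = coordField x₀ c J' t₀)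
    (h1 : deriv (coordField x₀ c J) t₀ = deriv (coordField x₀ c J') t₀) :
    ∀ t ∈ T, J t = J' t := by
  -- The set of times near which the fields agree is open and closed.
  set u : Set ℝ := {t | ∀ᶠ s in 𝓝 t, J s = J' s}
  have hu : IsOpen u := isOpen_iff_mem_nhds.2 fun t ht => eventually_eventually_nhds.2 ht
  have hcl : closure u ∩ T ⊆ u := by
    rintro t ⟨htu, ht⟩
    have : (𝓝[u] t).NeBot := mem_closure_iff_nhdsWithin_neBot.1 htu
    have hxt : c t ∈ (chartAt Plane (c t)).source := mem_chart_source _ _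
    have hj := hJ.contDiffAt hT hc.1 ht hxt
    have hj' := hJ'.contDiffAt hT hc.1 ht hxt
    refine IsJacobiOn.eventually_eq hc hT hJ hJ' ht hxt ?_ ?_
    · refine tendsto_nhds_unique (hj.continuousAt.tendsto.mono_left
        (nhdsWithin_le_nhds (s := u))) ((hj'.continuousAt.tendsto.mono_left
        nhdsWithin_le_nhds).congr' ?_)
      filter_upwards [self_mem_nhdsWithin] with s hs
      rw [coordField_eq, coordField_eq, (show ∀ᶠ s in 𝓝 s, J s = J' s from hs).self_of_nhds]
    · refine tendsto_nhds_unique ((contDiffAt_deriv hj).continuousAt.tendsto.mono_left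
        (nhdsWithin_le_nhds (s := u))) (((contDiffAt_deriv hj').continuousAt.tendsto.mono_left
        nhdsWithin_le_nhds).congr' ?_)
      filter_upwards [self_mem_nhdsWithin] with s hs
      refine Filter.EventuallyEq.deriv_eq ?_
      filter_upwards [show ∀ᶠ s in 𝓝 s, J s = J' s from hs] with r hr
      rw [coordField_eq, coordField_eq, hr]
  have h := hT'.subset_of_closure_inter_subset hu
    ⟨t₀, ht₀, IsJacobiOn.eventually_eq hc hT hJ hJ' ht₀ hx h0 h1⟩ hcl
  exact fun t ht => (show ∀ᶠ s in 𝓝 t, J s = J' s from h ht).self_of_nhds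

/-- Where a field along a curve vanishes, its covariant derivative is the ordinary derivative of its
components. -/
theorem toChart_covDeriv {t : ℝ} (h : J t = 0) : toChart (c t) (c t) (covDeriv g c J t) =
    deriv (coordField (c t) c J) t := by
  have h1 : (toChart (c t) (c t)).IsInvertible :=
    isInvertible_mfderiv_extChartAt (mem_extChartAt_source (I := 𝓘(ℝ, Plane)) (c t))
  have h2 : coordField (c t) c J t = 0 := by rw [coordField_eq, h, map_zero]
  have h3 : covDeriv g c J t =
      (toChart (c t) (c t)).inverse (deriv (coordField (c t) c J) t) := by
    rw [covDeriv, chartCovDeriv, christoffelVec_eq, h2, map_zero, add_zero]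
    rfl
  rw [h3]
  exact h1.self_apply_inverse _

end Curve

end Jacobi

/-! ### Jacobi fields along geodesics of the family -/

namespace GeodesicManifold

variable {S : Type*} [TopologicalSpace S] [ChartedSpace Plane S] [IsManifold 𝓘(ℝ, Plane) ∞ S]
variable {g : Metric S} (𝓜 : GeodesicManifold g) (x₀ : S)

/-- The derivative of the family of geodesics. -/
def dPoint (a : (ℝ × ℝ) × ℝ) : (ℝ × ℝ) × ℝ →L[ℝ] TangentSpace 𝓘(ℝ, Plane) (𝓜.point a) :=
  mfderiv 𝓘(ℝ, (ℝ × ℝ) × ℝ) 𝓘(ℝ, Plane) 𝓜.point a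

theorem isOpen_segmentDom {p : ℝ × ℝ} (hp : p ∈ 𝓜.W) (t₁ t₂ : ℝ) :
    IsOpen (𝓜.segmentDom p t₁ t₂) :=
  (𝓜.isOpen_dom_apply hp).preimage (f := fun s : ℝ => t₁ + s * (t₂ - t₁)) (by fun_prop)

theorem isPreconnected_segmentDom {p : ℝ × ℝ} (hp : p ∈ 𝓜.W) (t₁ t₂ : ℝ) :
    IsPreconnected (𝓜.segmentDom p t₁ t₂) := by
  have h : Convex ℝ (𝓜.dom p) := (𝓜.interval_dom p hp).convex
  refine Convex.isPreconnected fun s hs s' hs' a b ha hb hab => ?_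
  have := h hs hs' ha hb hab
  simp only [smul_eq_mul] at this
  show t₁ + (a • s + b • s') * (t₂ - t₁) ∈ 𝓜.dom p
  convert this using 1
  simp only [smul_eq_mul]
  linear_combination (-t₁) * hab

theorem isGeodesicOn_segment {p : ℝ × ℝ} (hp : p ∈ 𝓜.W) (t₁ t₂ : ℝ) :
    IsGeodesicOn g (𝓜.segment p t₁ t₂) (𝓜.segmentDom p t₁ t₂) :=
  (𝓜.geodesic p hp).comp_affine t₁ (t₂ - t₁)

theorem zero_mem_segmentDom {p : ℝ × ℝ} {t₁ t₂ : ℝ} (h : t₁ ∈ 𝓜.dom p) :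
    0 ∈ 𝓜.segmentDom p t₁ t₂ := by
  simpa [segmentDom] using h

theorem one_mem_segmentDom {p : ℝ × ℝ} {t₁ t₂ : ℝ} (h : t₂ ∈ 𝓜.dom p) :
    1 ∈ 𝓜.segmentDom p t₁ t₂ := by
  simpa [segmentDom] using h

/-- The parameters of the points of a segment of a geodesic. -/
def segParam (p : ℝ × ℝ) (t₁ t₂ s : ℝ) : (ℝ × ℝ) × ℝ := (p, t₁ + s * (t₂ - t₁))

/-- The field `∂_m γ + s d γ'` along a segment of a geodesic. -/
def variationField (p : ℝ × ℝ) (t₁ t₂ : ℝ) (m : (ℝ × ℝ) × ℝ) (d s : ℝ) :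
    TangentSpace 𝓘(ℝ, Plane) (𝓜.segment p t₁ t₂ s) :=
  𝓜.dPoint (segParam p t₁ t₂ s) (m + (s * d) • ((0 : ℝ × ℝ), (1 : ℝ)))

theorem hasDerivAt_segParam (p : ℝ × ℝ) (t₁ t₂ s : ℝ) :
    HasDerivAt (segParam p t₁ t₂) ((t₂ - t₁) • ((0 : ℝ × ℝ), (1 : ℝ))) s := by
  have h : HasDerivAt (fun s : ℝ => t₁ + s * (t₂ - t₁)) (1 * (t₂ - t₁)) s :=
    ((hasDerivAt_id s).mul_const (t₂ - t₁)).const_add t₁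
  refine ((hasDerivAt_const s p).prodMk h).congr_deriv ?_
  ext <;> simp

theorem segParam_mem {p : ℝ × ℝ} (hp : p ∈ 𝓜.W) {t₁ t₂ s : ℝ} (hs : s ∈ 𝓜.segmentDom p t₁ t₂)
    (hx : 𝓜.segment p t₁ t₂ s ∈ (chartAt Plane x₀).source) :
    segParam p t₁ t₂ s ∈ 𝓜.chartDom x₀ := ⟨⟨hp, hs⟩, hx⟩

theorem variationField_zero_eq (p : ℝ × ℝ) (t₁ t₂ : ℝ) (m : (ℝ × ℝ) × ℝ) (s : ℝ) :
    𝓜.variationField p t₁ t₂ m 0 s = 𝓜.dPoint (segParam p t₁ t₂ s) m := by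
  rw [variationField, mul_zero, zero_smul, add_zero]

variable [T2Space S]

theorem toChart_dPoint {a : (ℝ × ℝ) × ℝ} (ha : a ∈ 𝓜.chartDom x₀) (w : (ℝ × ℝ) × ℝ) :
    toChart x₀ (𝓜.point a) (𝓜.dPoint a w) = fderiv ℝ (𝓜.coordPoint x₀) a w :=
  𝓜.toChart_mfderiv_point x₀ ha w

section Variation

variable {𝓜} {x₀} {p : ℝ × ℝ} {t₁ t₂ s : ℝ} (ha : segParam p t₁ t₂ s ∈ 𝓜.chartDom x₀)

include ha

theorem eventually_segParam_mem : ∀ᶠ r in 𝓝 s, segParam p t₁ t₂ r ∈ 𝓜.chartDom x₀ :=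
  (hasDerivAt_segParam p t₁ t₂ s).continuousAt.eventually ((𝓜.isOpen_chartDom x₀).mem_nhds ha)

theorem hasDerivAt_coordVel_segParam : HasDerivAt (fun s => 𝓜.coordVel x₀ (segParam p t₁ t₂ s))
    ((t₂ - t₁) • fderiv ℝ (𝓜.coordVel x₀) (segParam p t₁ t₂ s) (0, 1)) s :=
  ((𝓜.hasFDerivAt_coordVel x₀ ha).comp_hasDerivAt s (hasDerivAt_segParam p t₁ t₂ s)).congr_deriv
    (by rw [map_smul])

theorem deriv_coordCurve_segment : deriv (coordCurve x₀ (𝓜.segment p t₁ t₂)) s =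
    (t₂ - t₁) • 𝓜.coordVel x₀ (segParam p t₁ t₂ s) := by
  have h := (𝓜.hasFDerivAt_coordPoint x₀ ha).comp_hasDerivAt s (hasDerivAt_segParam p t₁ t₂ s)
  rw [map_smul] at h
  exact h.deriv

variable (m : (ℝ × ℝ) × ℝ) (d : ℝ)

theorem coordField_variationField :
    coordField x₀ (𝓜.segment p t₁ t₂) (𝓜.variationField p t₁ t₂ m d) s =
      fderiv ℝ (𝓜.coordPoint x₀) (segParam p t₁ t₂ s) m +
        (s * d) • 𝓜.coordVel x₀ (segParam p t₁ t₂ s) := by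
  have h := 𝓜.toChart_dPoint x₀ ha (m + (s * d) • ((0 : ℝ × ℝ), (1 : ℝ)))
  rw [map_add (fderiv ℝ (𝓜.coordPoint x₀) _), map_smul (fderiv ℝ (𝓜.coordPoint x₀) _)] at h
  exact h

theorem hasDerivAt_coordField_variationField :
    HasDerivAt (coordField x₀ (𝓜.segment p t₁ t₂) (𝓜.variationField p t₁ t₂ m d))
      ((t₂ - t₁) • fderiv ℝ (𝓜.coordVel x₀) (segParam p t₁ t₂ s) m +
        ((s * d) • ((t₂ - t₁) • fderiv ℝ (𝓜.coordVel x₀) (segParam p t₁ t₂ s) (0, 1)) +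
          d • 𝓜.coordVel x₀ (segParam p t₁ t₂ s))) s := by
  have h1 : HasDerivAt (fun s => fderiv ℝ (𝓜.coordPoint x₀) (segParam p t₁ t₂ s) m)
      ((t₂ - t₁) • fderiv ℝ (𝓜.coordVel x₀) (segParam p t₁ t₂ s) m) s := by
    have h2 := ((𝓜.contDiffAt_fderiv_coordPoint x₀ m ha).differentiableAt
      (by simp)).hasFDerivAt.comp_hasDerivAt s (hasDerivAt_segParam p t₁ t₂ s)
    rw [map_smul, fderiv_fderiv_swap ((𝓜.contDiffAt_coordPoint x₀ ha).of_le
      ENat.LEInfty.out)] at h2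
    exact h2
  have h3 : HasDerivAt (fun s : ℝ => s * d) d s := by
    simpa using (hasDerivAt_id s).mul_const d
  refine (h1.add (h3.smul (hasDerivAt_coordVel_segParam ha))).congr_of_eventuallyEq ?_
  filter_upwards [eventually_segParam_mem ha] with r hr
  exact coordField_variationField hr m d

theorem contDiffAt_coordField_variationField :
    ContDiffAt ℝ ∞ (coordField x₀ (𝓜.segment p t₁ t₂) (𝓜.variationField p t₁ t₂ m d)) s := by
  have hp : ContDiffAt ℝ ∞ (segParam p t₁ t₂) s :=
    contDiffAt_const.prodMk (ContDiff.contDiffAt (by fun_prop))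
  have h1 : ContDiffAt ℝ ∞ (fun s => fderiv ℝ (𝓜.coordPoint x₀) (segParam p t₁ t₂ s) m) s :=
    ContDiffAt.comp (g := fun a => fderiv ℝ (𝓜.coordPoint x₀) a m) s
      (𝓜.contDiffAt_fderiv_coordPoint x₀ m ha) hp
  have h2 : ContDiffAt ℝ ∞ (fun s => 𝓜.coordVel x₀ (segParam p t₁ t₂ s)) s :=
    ContDiffAt.comp (g := 𝓜.coordVel x₀) s (𝓜.contDiffAt_fderiv_coordPoint x₀ (0, 1) ha) hp
  have h3 : ContDiffAt ℝ ∞ (fun s : ℝ => s * d) s := ContDiff.contDiffAt (by fun_prop)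
  refine (h1.add (h3.smul h2)).congr_of_eventuallyEq ?_
  filter_upwards [eventually_segParam_mem ha] with r hr
  exact coordField_variationField hr m d

omit ha in
/-- The derivative of the geodesic equation in a direction `w`. -/
theorem fderiv_fderiv_coordVel {a : (ℝ × ℝ) × ℝ} (ha : a ∈ 𝓜.chartDom x₀) (w : (ℝ × ℝ) × ℝ) :
    fderiv ℝ (fun b => fderiv ℝ (𝓜.coordVel x₀) b w) a (0, 1) =
      linAccel g x₀ (𝓜.coordPoint x₀ a) (𝓜.coordVel x₀ a) (fderiv ℝ (𝓜.coordPoint x₀) a w)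
        (fderiv ℝ (𝓜.coordVel x₀) a w) := by
  have h1 : (fun b => fderiv ℝ (𝓜.coordVel x₀) b (0, 1)) =ᶠ[𝓝 a] fun b =>
      -christoffelL g x₀ (𝓜.coordPoint x₀ b) (𝓜.coordVel x₀ b) (𝓜.coordVel x₀ b) := by
    filter_upwards [(𝓜.isOpen_chartDom x₀).mem_nhds ha] with b hb
    exact 𝓜.fderiv_coordVel x₀ hb
  have h2 : HasFDerivAt (fun b => christoffelL g x₀ (𝓜.coordPoint x₀ b))
      ((fderiv ℝ (christoffelL g x₀) (𝓜.coordPoint x₀ a)).comp (fderiv ℝ (𝓜.coordPoint x₀) a)) a :=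
    HasFDerivAt.comp (g := christoffelL g x₀) a
      (hasFDerivAt_christoffelL g x₀ (𝓜.coordPoint_mem x₀ ha)) (𝓜.hasFDerivAt_coordPoint x₀ ha)
  have h3 := ((h2.clm_apply (𝓜.hasFDerivAt_coordVel x₀ ha)).clm_apply
    (𝓜.hasFDerivAt_coordVel x₀ ha)).fun_neg
  have hV : ContDiffAt ℝ ∞ (𝓜.coordVel x₀) a := 𝓜.contDiffAt_fderiv_coordPoint x₀ (0, 1) ha
  rw [fderiv_fderiv_swap (hV.of_le ENat.LEInfty.out), h1.fderiv_eq, h3.fderiv]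
  simp only [linAccel, _root_.neg_apply, _root_.add_apply, ContinuousLinearMap.comp_apply,
    ContinuousLinearMap.flip_apply]
  rw [christoffelL_symm g x₀ _ (fderiv ℝ (𝓜.coordVel x₀) a w)]
  module

theorem deriv_deriv_coordField_variationField :
    deriv (deriv (coordField x₀ (𝓜.segment p t₁ t₂) (𝓜.variationField p t₁ t₂ m d))) s =
      linAccel g x₀ (coordCurve x₀ (𝓜.segment p t₁ t₂) s)
        (deriv (coordCurve x₀ (𝓜.segment p t₁ t₂)) s)
        (coordField x₀ (𝓜.segment p t₁ t₂) (𝓜.variationField p t₁ t₂ m d) s)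
        (deriv (coordField x₀ (𝓜.segment p t₁ t₂) (𝓜.variationField p t₁ t₂ m d)) s) := by
  have hX : coordCurve x₀ (𝓜.segment p t₁ t₂) s = 𝓜.coordPoint x₀ (segParam p t₁ t₂ s) := rfl
  have h0 : ∀ w, HasDerivAt (fun s => fderiv ℝ (𝓜.coordVel x₀) (segParam p t₁ t₂ s) w)
      ((t₂ - t₁) • linAccel g x₀ (𝓜.coordPoint x₀ (segParam p t₁ t₂ s))
        (𝓜.coordVel x₀ (segParam p t₁ t₂ s))
        (fderiv ℝ (𝓜.coordPoint x₀) (segParam p t₁ t₂ s) w)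
        (fderiv ℝ (𝓜.coordVel x₀) (segParam p t₁ t₂ s) w)) s := by
    intro w
    have hd : ContDiffAt ℝ ∞ (fun a => fderiv ℝ (𝓜.coordVel x₀) a w) (segParam p t₁ t₂ s) :=
      ((𝓜.contDiffAt_fderiv_coordPoint x₀ (0, 1) ha).fderiv_right (m := ∞) (by simp)).clm_apply
        contDiffAt_const
    have h2 := (hd.differentiableAt (by simp)).hasFDerivAt.comp_hasDerivAt s
      (hasDerivAt_segParam p t₁ t₂ s)
    rw [map_smul, fderiv_fderiv_coordVel ha] at h2
    exact h2
  have h3 : HasDerivAt (fun s : ℝ => s * d) d s := by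
    simpa using (hasDerivAt_id s).mul_const d
  have h4 := ((h0 m).fun_const_smul (t₂ - t₁)).add ((h3.smul ((h0 (0, 1)).fun_const_smul
    (t₂ - t₁))).add ((hasDerivAt_coordVel_segParam ha).fun_const_smul d))
  have h5 : deriv (coordField x₀ (𝓜.segment p t₁ t₂) (𝓜.variationField p t₁ t₂ m d)) =ᶠ[𝓝 s]
      fun s => (t₂ - t₁) • fderiv ℝ (𝓜.coordVel x₀) (segParam p t₁ t₂ s) m +
        ((s * d) • ((t₂ - t₁) • fderiv ℝ (𝓜.coordVel x₀) (segParam p t₁ t₂ s) (0, 1)) +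
          d • 𝓜.coordVel x₀ (segParam p t₁ t₂ s)) := by
    filter_upwards [eventually_segParam_mem ha] with r hr
    exact (hasDerivAt_coordField_variationField hr m d).deriv
  have h6 : fderiv ℝ (𝓜.coordPoint x₀) (segParam p t₁ t₂ s) (0, 1) =
    𝓜.coordVel x₀ (segParam p t₁ t₂ s) := rfl
  rw [(h4.congr_of_eventuallyEq h5).deriv, (hasDerivAt_coordField_variationField ha m d).deriv,
    coordField_variationField ha, deriv_coordCurve_segment ha, hX]
  simp only [linAccel, h6, 𝓜.fderiv_coordVel x₀ ha, map_add, map_smul, map_neg, _root_.add_apply,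
    _root_.smul_apply]
  module

end Variation

theorem isJacobiOn_variationField {p : ℝ × ℝ} (hp : p ∈ 𝓜.W) (t₁ t₂ : ℝ) (m : (ℝ × ℝ) × ℝ)
    (d : ℝ) : IsJacobiOn g (𝓜.segment p t₁ t₂) (𝓜.variationField p t₁ t₂ m d)
      (𝓜.segmentDom p t₁ t₂) := by
  rw [isJacobiOn_iff (𝓜.isGeodesicOn_segment hp t₁ t₂) (𝓜.isOpen_segmentDom hp t₁ t₂)]
  intro s hs x₀ hx
  have ha := 𝓜.segParam_mem x₀ hp hs hx
  exact ⟨contDiffAt_coordField_variationField ha m d,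
    deriv_deriv_coordField_variationField ha m d⟩

/-- Every Jacobi field along a segment of a geodesic comes from a variation through geodesics of
the family and an affine reparametrization: both spaces have dimension four. -/
theorem exists_eq_variationField {p : ℝ × ℝ} (hp : p ∈ 𝓜.W) {t₁ t₂ : ℝ} (ht₁ : t₁ ∈ 𝓜.dom p)
    (ht : t₁ ≠ t₂) {J : ∀ s, TangentSpace 𝓘(ℝ, Plane) (𝓜.segment p t₁ t₂ s)}
    (hJ : IsJacobiOn g (𝓜.segment p t₁ t₂) J (𝓜.segmentDom p t₁ t₂)) :
    ∃ m d, ∀ s ∈ 𝓜.segmentDom p t₁ t₂, J s = 𝓜.variationField p t₁ t₂ m d s := by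
  have h0 := 𝓜.zero_mem_segmentDom (t₂ := t₂) ht₁
  set x₀ := 𝓜.segment p t₁ t₂ 0 with hx₀
  have hx : 𝓜.segment p t₁ t₂ 0 ∈ (chartAt Plane x₀).source := mem_chart_source _ _
  have ha := 𝓜.segParam_mem x₀ hp h0 hx
  have hL : t₂ - t₁ ≠ 0 := sub_ne_zero.2 ht.symm
  -- The initial values of the field and of its derivative, as a linear map of the variation and of
  -- the reparametrization.
  let A : ((ℝ × ℝ) × ℝ) × ℝ →ₗ[ℝ] Plane × Plane :=
    { toFun := fun w => (fderiv ℝ (𝓜.coordPoint x₀) (segParam p t₁ t₂ 0) w.1,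
        (t₂ - t₁) • fderiv ℝ (𝓜.coordVel x₀) (segParam p t₁ t₂ 0) w.1 +
          w.2 • 𝓜.coordVel x₀ (segParam p t₁ t₂ 0))
      map_add' := fun w w' => by
        ext1
        · simp
        · simp only [Prod.fst_add, Prod.snd_add, map_add]
          module
      map_smul' := fun r w => by
        ext1
        · simp
        · simp only [Prod.smul_fst, Prod.smul_snd, map_smul, RingHom.id_apply, smul_eq_mul]
          module }
  have hA : Function.Injective A := by
    rw [injective_iff_map_eq_zero]
    rintro ⟨m, d⟩ h
    have h1 : fderiv ℝ (𝓜.coordPoint x₀) (segParam p t₁ t₂ 0) m = 0 := congrArg Prod.fst h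
    have h2 : (t₂ - t₁) • fderiv ℝ (𝓜.coordVel x₀) (segParam p t₁ t₂ 0) m +
      d • 𝓜.coordVel x₀ (segParam p t₁ t₂ 0) = 0 := congrArg Prod.snd h
    have h3 := 𝓜.eq_zero_of_jacobi_eq_zero x₀ ha (d := (t₂ - t₁)⁻¹ * d) h1 (by
      have h4 := congrArg (fun v => (t₂ - t₁)⁻¹ • v) h2
      simpa [smul_add, smul_smul, hL] using h4)
    have h5 : d = 0 := by simpa [hL] using h3.2
    rw [h3.1, h5]
    rfl
  have hA' : Function.Surjective A :=
    (LinearMap.injective_iff_surjective_of_finrank_eq_finrank (by simp)).1 hA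
  obtain ⟨⟨m, d⟩, hmd⟩ := hA' (coordField x₀ (𝓜.segment p t₁ t₂) J 0,
    deriv (coordField x₀ (𝓜.segment p t₁ t₂) J) 0)
  refine ⟨m, d, IsJacobiOn.eq_of_eq (𝓜.isGeodesicOn_segment hp t₁ t₂)
    (𝓜.isOpen_segmentDom hp t₁ t₂) (𝓜.isPreconnected_segmentDom hp t₁ t₂) hJ
    (𝓜.isJacobiOn_variationField hp t₁ t₂ m d) h0 hx ?_ ?_⟩
  · rw [coordField_variationField ha]
    refine (congrArg Prod.fst hmd).symm.trans ?_
    simp [A]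
  · rw [(hasDerivAt_coordField_variationField ha m d).deriv]
    refine (congrArg Prod.snd hmd).symm.trans ?_
    simp [A]

/-- A vanishing variation is in the kernel of the contact form `η dy + dt`. -/
theorem contact_eq_zero {a w : (ℝ × ℝ) × ℝ} (ha : a ∈ 𝓜.pointDom) (h : 𝓜.dPoint a w = 0) :
    a.1.2 * w.1.1 + w.2 = 0 := by
  have ha' : a ∈ 𝓜.chartDom (𝓜.point a) := ⟨ha, mem_chart_source _ _⟩
  rw [← 𝓜.coordMom_fderiv _ ha', ← 𝓜.toChart_dPoint _ ha', h, map_zero, map_zero]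

/-- A Jacobi field vanishing at both ends of a segment comes from a variation through geodesics of
the family, without reparametrization, that is normal to the geodesic. -/
theorem exists_eq_variationField_of_eq_zero {p : ℝ × ℝ} (hp : p ∈ 𝓜.W) {t₁ t₂ : ℝ}
    (ht₁ : t₁ ∈ 𝓜.dom p) (ht₂ : t₂ ∈ 𝓜.dom p)
    (ht : t₁ ≠ t₂) {J : ∀ s, TangentSpace 𝓘(ℝ, Plane) (𝓜.segment p t₁ t₂ s)}
    (hJ : IsJacobiOn g (𝓜.segment p t₁ t₂) J (𝓜.segmentDom p t₁ t₂)) (hJ0 : J 0 = 0)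
    (hJ1 : J 1 = 0) :
    ∃ a b, ∀ s ∈ 𝓜.segmentDom p t₁ t₂,
      J s = 𝓜.variationField p t₁ t₂ ((a, b), -(p.2 * a)) 0 s := by
  obtain ⟨⟨⟨a, b⟩, c⟩, d, h⟩ := 𝓜.exists_eq_variationField hp ht₁ ht hJ
  have h0 := 𝓜.zero_mem_segmentDom (t₂ := t₂) ht₁
  have h1 := 𝓜.one_mem_segmentDom (t₁ := t₁) ht₂
  have e0 := 𝓜.contact_eq_zero (a := segParam p t₁ t₂ 0) ⟨hp, h0⟩ ((h 0 h0).symm.trans hJ0)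
  have e1 := 𝓜.contact_eq_zero (a := segParam p t₁ t₂ 1) ⟨hp, h1⟩ ((h 1 h1).symm.trans hJ1)
  simp [segParam] at e0 e1
  -- The contact form takes the value `η a + c + s d` on the variation at time `s`; it vanishes at
  -- `s = 0` and at `s = 1`.
  obtain rfl : d = 0 := by linarith
  obtain rfl : c = -(p.2 * a) := by linarith
  exact ⟨a, b, h⟩

/-- Variations vanishing at the same point have parallel `(y, η)`-components: the pairing `dη ∧ dy`
of these components is the exterior derivative of a form pulled back by `γ`, and the variations are
in the kernel of the derivative of `γ`. -/
theorem mul_eq_mul_of_dPoint_eq_zero {a m w : (ℝ × ℝ) × ℝ} (ha : a ∈ 𝓜.pointDom)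
    (hm : 𝓜.dPoint a m = 0) (hw : 𝓜.dPoint a w = 0) : m.1.2 * w.1.1 = w.1.2 * m.1.1 := by
  have ha' : a ∈ 𝓜.chartDom (𝓜.point a) := ⟨ha, mem_chart_source _ _⟩
  have h := 𝓜.fderiv_coordMom _ ha' m w
  rw [← 𝓜.toChart_dPoint _ ha', ← 𝓜.toChart_dPoint _ ha', hm, hw] at h
  simp only [map_zero, sub_zero] at h
  linarith

/-- Fields vanishing at both ends come from vectors `(a, b, -η a)`, and vanishing at the same point
forces the pairs `(a, b)` to be parallel. -/
theorem conjugacyFieldUnique : 𝓜.ConjugacyFieldUnique := by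
  intro p hp t₁ ht₁ t₂ ht₂ ht J J' hJ hJ'
  obtain ⟨a, b, h⟩ := 𝓜.exists_eq_variationField_of_eq_zero hp ht₁ ht₂ ht hJ.1 hJ.2.2.1 hJ.2.2.2
  obtain ⟨a', b', h'⟩ :=
    𝓜.exists_eq_variationField_of_eq_zero hp ht₁ ht₂ ht hJ'.1 hJ'.2.2.1 hJ'.2.2.2
  have h0 := 𝓜.zero_mem_segmentDom (t₂ := t₂) ht₁
  simp only [variationField_zero_eq] at h h'
  have hab : b * a' = b' * a := 𝓜.mul_eq_mul_of_dPoint_eq_zero (a := segParam p t₁ t₂ 0)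
    (m := ((a, b), -(p.2 * a))) (w := ((a', b'), -(p.2 * a'))) ⟨hp, h0⟩
    ((h 0 h0).symm.trans hJ.2.2.1) ((h' 0 h0).symm.trans hJ'.2.2.1)
  have key : ∀ k, a' = k * a → b' = k * b → ∃ k : ℝ, ∀ s ∈ 𝓜.segmentDom p t₁ t₂,
      J' s = k • J s := by
    rintro k rfl rfl
    refine ⟨k, fun s hs => ?_⟩
    have e : (((k * a, k * b), -(p.2 * (k * a))) : (ℝ × ℝ) × ℝ) = k • ((a, b), -(p.2 * a)) := by
      ext <;> simp
      ring
    rw [h s hs, h' s hs, e]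
    exact map_smul _ _ _
  by_cases ha : a = 0
  · by_cases hb : b = 0
    · exfalso
      obtain ⟨s, hs, hne⟩ := hJ.2.1
      refine hne ((h s hs).trans ?_)
      have e : (((a, b), -(p.2 * a)) : (ℝ × ℝ) × ℝ) = 0 := by
        ext <;> simp [ha, hb]
      rw [e]
      exact map_zero _
    · refine key (b' / b) ?_ ?_
      · rw [ha, mul_zero]
        rw [ha, mul_zero] at hab
        exact (mul_eq_zero.1 hab).resolve_left hb
      · field_simp
  · refine key (a' / a) ?_ ?_
    · field_simp
    · field_simp
      linarith

/-- The covariant derivative of a variation without reparametrization where it vanishes. -/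
theorem inner_covDeriv_variationField {p : ℝ × ℝ} (hp : p ∈ 𝓜.W) {t₁ t₂ s : ℝ}
    (hs : s ∈ 𝓜.segmentDom p t₁ t₂) {J : ∀ s, TangentSpace 𝓘(ℝ, Plane) (𝓜.segment p t₁ t₂ s)}
    {m : (ℝ × ℝ) × ℝ}
    (hJ : ∀ s ∈ 𝓜.segmentDom p t₁ t₂, J s = 𝓜.variationField p t₁ t₂ m 0 s)
    (h0 : J s = 0) (w : (ℝ × ℝ) × ℝ) :
    g.inner (𝓜.segment p t₁ t₂ s) (covDeriv g (𝓜.segment p t₁ t₂) J s)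
      (𝓜.dPoint (segParam p t₁ t₂ s) w) =
      (t₂ - t₁) * (m.1.2 * w.1.1 - w.1.2 * m.1.1) := by
  set x₀ := 𝓜.segment p t₁ t₂ s with hx₀
  have hx : 𝓜.segment p t₁ t₂ s ∈ (chartAt Plane x₀).source := mem_chart_source _ _
  have ha := 𝓜.segParam_mem x₀ hp hs hx
  have h1 : toChart x₀ x₀ (covDeriv g (𝓜.segment p t₁ t₂) J s) =
      (t₂ - t₁) • fderiv ℝ (𝓜.coordVel x₀) (segParam p t₁ t₂ s) m := by
    rw [hx₀, toChart_covDeriv h0]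
    have h2 : coordField x₀ (𝓜.segment p t₁ t₂) J =ᶠ[𝓝 s]
        coordField x₀ (𝓜.segment p t₁ t₂) (𝓜.variationField p t₁ t₂ m 0) := by
      filter_upwards [(𝓜.isOpen_segmentDom hp t₁ t₂).mem_nhds hs] with r hr
      rw [coordField_eq, coordField_eq, hJ r hr]
    rw [← hx₀, h2.deriv_eq, (hasDerivAt_coordField_variationField ha m 0).deriv]
    simp
  have h3 : fderiv ℝ (𝓜.coordPoint x₀) (segParam p t₁ t₂ s) m = 0 := by
    rw [← 𝓜.toChart_dPoint x₀ ha, ← variationField_zero_eq]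
    have h4 := (hJ s hs).symm.trans h0
    exact (congrArg (toChart x₀ (𝓜.segment p t₁ t₂ s)) h4).trans (map_zero _)
  have h5 := 𝓜.gramL_fderiv_coordVel x₀ ha h3 0 w
  have h6 := 𝓜.toChart_dPoint x₀ ha w
  have h7 := inner_eq_gramL g x₀ (x := x₀) (mem_extChartAt_source_iff.2 hx)
    (covDeriv g (𝓜.segment p t₁ t₂) J s) (𝓜.dPoint (segParam p t₁ t₂ s) w)
  rw [h7, h1]
  have h8 : toChart x₀ x₀ (𝓜.dPoint (segParam p t₁ t₂ s) w) =
    fderiv ℝ (𝓜.coordPoint x₀) (segParam p t₁ t₂ s) w := h6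
  have h9 : extChartAt 𝓘(ℝ, Plane) x₀ x₀ = 𝓜.coordPoint x₀ (segParam p t₁ t₂ s) := rfl
  rw [h8, h9, map_smul, _root_.smul_apply, smul_eq_mul]
  simp only [zero_smul, add_zero, zero_mul] at h5
  rw [h5]

end GeodesicManifold

/-! ### Charts of the cotangent bundle -/

/-- The inverse function theorem for smooth maps, between spaces of the same finite dimension. -/
theorem exists_openPartialHomeomorph_of_injective {E F : Type*} [NormedAddCommGroup E]
    [NormedSpace ℝ E] [FiniteDimensional ℝ E] [NormedAddCommGroup F] [NormedSpace ℝ F]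
    [FiniteDimensional ℝ F] (hdim : Module.finrank ℝ E = Module.finrank ℝ F) {f : E → F}
    {U : Set E} (hU : IsOpen U) (hf : ContDiffOn ℝ ∞ f U) {a : E} (ha : a ∈ U)
    (hinj : ∀ v, fderiv ℝ f a v = 0 → v = 0) :
    ∃ e : OpenPartialHomeomorph E F, a ∈ e.source ∧ e.source ⊆ U ∧ ⇑e = f ∧
      ContDiffOn ℝ ∞ e.symm e.target := by
  have : CompleteSpace E := FiniteDimensional.complete ℝ E
  let L : E ≃L[ℝ] F := (LinearEquiv.ofInjectiveOfFinrankEq (fderiv ℝ f a : E →ₗ[ℝ] F)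
    ((injective_iff_map_eq_zero _).2 hinj) hdim).toContinuousLinearEquiv
  refine exists_openPartialHomeomorph_of_contDiffOn hU hf ha L ?_
  have h : (L : E →L[ℝ] F) = fderiv ℝ f a := by
    ext v
    rfl
  rw [h]
  exact ((hf.contDiffAt (hU.mem_nhds ha)).differentiableAt (by simp)).hasFDerivAt

theorem finrank_plane_prod_dual : Module.finrank ℝ (Plane × (Plane →L[ℝ] ℝ)) = 4 := by
  have h : Module.finrank ℝ (Plane →L[ℝ] ℝ) = 2 := by
    rw [← (LinearMap.toContinuousLinearMap (𝕜 := ℝ) (E := Plane) (F' := ℝ)).finrank_eq]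
    simp
  rw [Module.finrank_prod, h]
  simp

/-- The area form of the plane. -/
def areaL : Plane →L[ℝ] Plane →L[ℝ] ℝ :=
  (EuclideanSpace.proj (𝕜 := ℝ) 0).smulRight (EuclideanSpace.proj (𝕜 := ℝ) 1) -
    (EuclideanSpace.proj (𝕜 := ℝ) 1).smulRight (EuclideanSpace.proj (𝕜 := ℝ) 0)

theorem areaL_apply (v w : Plane) : areaL v w = v 0 * w 1 - v 1 * w 0 := by
  simp [areaL]

theorem areaL_self (v : Plane) : areaL v v = 0 := by
  rw [areaL_apply]
  ring

theorem eq_zero_of_areaL_eq_zero {v : Plane} (h : areaL v = 0) : v = 0 := by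
  have h0 := congrArg (fun L : Plane →L[ℝ] ℝ => L (basisVec 0)) h
  have h1 := congrArg (fun L : Plane →L[ℝ] ℝ => L (basisVec 1)) h
  simp [areaL_apply, basisVec] at h0 h1
  ext i
  fin_cases i
  · exact h1
  · exact h0

/-- A covector annihilating a nonzero vector `v` of the plane is a multiple of `areaL v`. -/
theorem exists_eq_smul_areaL {v : Plane} (hv : v ≠ 0) {ξ : Plane →L[ℝ] ℝ} (h : ξ v = 0) :
    ∃ l : ℝ, ξ = l • areaL v := by
  have hn : v 0 ^ 2 + v 1 ^ 2 ≠ 0 := by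
    intro h0
    apply hv
    ext i
    fin_cases i
    · simp
      nlinarith [sq_nonneg (v 0), sq_nonneg (v 1)]
    · simp
      nlinarith [sq_nonneg (v 0), sq_nonneg (v 1)]
  -- The factor is the pairing of `ξ` with the rotated vector `(-v 1, v 0)`, divided by `|v|²`.
  refine ⟨(ξ (basisVec 1) * v 0 - ξ (basisVec 0) * v 1) / (v 0 ^ 2 + v 1 ^ 2), ?_⟩
  rw [← sum_basisVec v, map_add, map_smul, map_smul, smul_eq_mul, smul_eq_mul] at h
  ext w
  conv_lhs => rw [← sum_basisVec w]
  rw [map_add, map_smul, map_smul, _root_.smul_apply, areaL_apply, smul_eq_mul, smul_eq_mul,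
    smul_eq_mul]
  field_simp
  linear_combination (v 1 * w 1 + v 0 * w 0) * h

section Cotangent

variable {S : Type*} [TopologicalSpace S] [ChartedSpace Plane S] [IsManifold 𝓘(ℝ, Plane) ∞ S]

theorem mem_cotChart_source {q₀ q : Cotangent S} :
    q ∈ (extChartAt cotModel q₀).source ↔ q.proj ∈ (chartAt Plane q₀.proj).source := by
  rw [FiberBundle.extChartAt]
  simp only [PartialEquiv.trans_source, PartialEquiv.prod_source, PartialEquiv.refl_source,
    mem_inter_iff, mem_preimage, mem_prod, mem_univ, and_true,
    OpenPartialHomeomorph.toFun_eq_coe, Bundle.Trivialization.coe_coe,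
    hom_trivializationAt_apply, hom_trivializationAt_source]
  simp

theorem cotChart_fst {q₀ q : Cotangent S} :
    (extChartAt cotModel q₀ q).1 = extChartAt 𝓘(ℝ, Plane) q₀.proj q.proj := by
  rw [FiberBundle.extChartAt]
  rfl

/-- The second component of the canonical coordinates consists of the components of the covector
with respect to the chart of the base. -/
theorem cotChart_snd {q₀ q : Cotangent S} (h : q.proj ∈ (chartAt Plane q₀.proj).source)
    (v : TangentSpace 𝓘(ℝ, Plane) q.proj) :
    (extChartAt cotModel q₀ q).2 (toChart q₀.proj q.proj v) = q.snd v := by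
  have h1 : (extChartAt cotModel q₀ q).2 = ContinuousLinearMap.inCoordinates Plane
      (TangentSpace 𝓘(ℝ, Plane)) ℝ (Bundle.Trivial S ℝ) q₀.proj q.proj q₀.proj q.proj q.snd := by
    rw [FiberBundle.extChartAt]
    rfl
  have h2 : (trivializationAt Plane (TangentSpace 𝓘(ℝ, Plane)) q₀.proj).symmL ℝ q.proj
      (toChart q₀.proj q.proj v) = v := by
    rw [toChart, ← TangentBundle.continuousLinearMapAt_trivializationAt (𝕜 := ℝ)
      (I := 𝓘(ℝ, Plane)) h]
    exact Bundle.Trivialization.symmL_continuousLinearMapAt _ (by simpa using h) v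
  rw [h1, ContinuousLinearMap.inCoordinates]
  simp only [ContinuousLinearMap.comp_apply, h2]
  simp

theorem cotChart_target (q₀ : Cotangent S) :
    (extChartAt cotModel q₀).target = (extChartAt 𝓘(ℝ, Plane) q₀.proj).target ×ˢ univ := by
  ext z
  constructor
  · intro hz
    have h := (extChartAt cotModel q₀).map_target hz
    rw [mem_cotChart_source, ← mem_extChartAt_source_iff] at h
    have h1 := (extChartAt 𝓘(ℝ, Plane) q₀.proj).map_source h
    rw [← cotChart_fst, (extChartAt cotModel q₀).right_inv hz] at h1
    exact ⟨h1, mem_univ _⟩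
  · intro hz
    rw [FiberBundle.extChartAt_target]
    refine ⟨⟨hz.1, ?_⟩, hz.2⟩
    have h := (extChartAt 𝓘(ℝ, Plane) q₀.proj).map_target hz.1
    rw [mem_extChartAt_source_iff] at h
    rw [mem_preimage, hom_trivializationAt_baseSet]
    simpa using h

theorem continuous_proj : Continuous (fun q : Cotangent S => q.proj) :=
  FiberBundle.continuous_proj (Plane →L[ℝ] ℝ)
    (fun x : S => TangentSpace 𝓘(ℝ, Plane) x →L[ℝ] Bundle.Trivial S ℝ x)

end Cotangent

/-! ### The canonical map -/

namespace GeodesicManifold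

variable {S : Type*} [TopologicalSpace S] [ChartedSpace Plane S] [IsManifold 𝓘(ℝ, Plane) ∞ S]
variable {g : Metric S} (𝓜 : GeodesicManifold g) (M : Set S)

/-- The covector `q` is conormal to the geodesic with coordinates `a.1` at time `a.2`. -/
def IsParam (a : (ℝ × ℝ) × ℝ) (q : Cotangent S) : Prop :=
  ∃ ξ : TangentSpace 𝓘(ℝ, Plane) (𝓜.γ a.1 a.2) →L[ℝ] ℝ,
    𝓜.IsConormal M a.1 a.2 ξ ∧ q = ⟨𝓜.γ a.1 a.2, ξ⟩

theorem mem_V_iff {q : Cotangent S} : q ∈ 𝓜.V M ↔ ∃ a, 𝓜.IsParam M a q := by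
  constructor
  · rintro ⟨-, ⟨p, t, ξ, h, rfl⟩, rfl⟩
    exact ⟨(p, t), ξ, h, rfl⟩
  · rintro ⟨a, ξ, h, rfl⟩
    exact ⟨_, ⟨a.1, a.2, ξ, h, rfl⟩, rfl⟩

variable {M} in
theorem UniqueConormal.isParam_unique (hM : 𝓜.UniqueConormal M) {a b : (ℝ × ℝ) × ℝ}
    {q : Cotangent S} (ha : 𝓜.IsParam M a q) (hb : 𝓜.IsParam M b q) : a = b := by
  obtain ⟨ξ, h, rfl⟩ := ha
  obtain ⟨ξ', h', he⟩ := hb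
  obtain ⟨h1, h2⟩ := hM _ _ _ _ _ _ h h' he
  exact Prod.ext h1 h2

variable {M} in
theorem UniqueConormal.mapC_eq (hM : 𝓜.UniqueConormal M) {p : ℝ × ℝ} {t : ℝ}
    {ξ : TangentSpace 𝓘(ℝ, Plane) (𝓜.γ p t) →L[ℝ] ℝ} (h : 𝓜.IsConormal M p t ξ) :
    𝓜.mapC M ⟨𝓜.γ p t, ξ⟩ = (p, (ξ (𝓜.dy p t), ξ (𝓜.dη p t))) := by
  have h1 : (𝓜.mapC M ⟨𝓜.γ p t, ξ⟩, (⟨𝓜.γ p t, ξ⟩ : Cotangent S)) ∈ 𝓜.relC M :=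
    Classical.epsilon_spec (p := fun z => (z, (⟨𝓜.γ p t, ξ⟩ : Cotangent S)) ∈ 𝓜.relC M)
      ⟨_, p, t, ξ, h, rfl⟩
  obtain ⟨p', t', ξ', h', he⟩ := h1
  have he2 := congrArg Prod.snd he
  obtain ⟨rfl, rfl⟩ := hM _ _ _ _ _ _ h h' he2
  obtain rfl : ξ = ξ' := eq_of_heq (Bundle.TotalSpace.mk.inj he2).2
  exact congrArg Prod.fst he

/-- The parameters of the point at which a covector in `V` is conormal to a geodesic. -/
def param (q : Cotangent S) : (ℝ × ℝ) × ℝ := Classical.epsilon fun a => 𝓜.IsParam M a q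

variable {M} in
theorem isParam_param {q : Cotangent S} (hq : q ∈ 𝓜.V M) : 𝓜.IsParam M (𝓜.param M q) q :=
  Classical.epsilon_spec (p := fun a => 𝓜.IsParam M a q) ((𝓜.mem_V_iff M).1 hq)

variable {M} in
theorem IsParam.scale {a : (ℝ × ℝ) × ℝ} {q : Cotangent S} (h : 𝓜.IsParam M a q) {r : ℝ}
    (hr : r ≠ 0) : 𝓜.IsParam M a (scale r q) := by
  obtain ⟨ξ, h, rfl⟩ := h
  refine ⟨r • ξ, ⟨h.1, h.2.1, h.2.2.1, smul_ne_zero hr h.2.2.2.1, ?_⟩, rfl⟩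
  rw [_root_.smul_apply, h.2.2.2.2, smul_zero]

variable {M} in
/-- The canonical map is homogeneous of degree one in the fibres. -/
theorem UniqueConormal.mapC_scale (hM : 𝓜.UniqueConormal M) {q : Cotangent S} (hq : q ∈ 𝓜.V M)
    {r : ℝ} (hr : r ≠ 0) :
    𝓜.mapC M (XRay.scale r q) = ((𝓜.mapC M q).1, r • (𝓜.mapC M q).2) := by
  obtain ⟨⟨p, t⟩, ξ, h, rfl⟩ := (𝓜.mem_V_iff M).1 hq
  obtain ⟨ξ', h', he⟩ := IsParam.scale 𝓜 ⟨ξ, h, rfl⟩ hr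
  obtain rfl : ξ' = r • ξ := (eq_of_heq (Bundle.TotalSpace.mk.inj he).2).symm
  rw [he, UniqueConormal.mapC_eq 𝓜 hM h', UniqueConormal.mapC_eq 𝓜 hM h]
  rfl

variable [T2Space S]

/-- Derivatives of curves of points of geodesics. -/
theorem mfderiv_point_comp {c : ℝ → (ℝ × ℝ) × ℝ} {s : ℝ} {w : (ℝ × ℝ) × ℝ}
    (hc : HasDerivAt c w s) (hs : c s ∈ 𝓜.pointDom) :
    mfderiv 𝓘(ℝ, ℝ) 𝓘(ℝ, Plane) (fun s => 𝓜.point (c s)) s (1 : ℝ) = 𝓜.dPoint (c s) w := by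
  have h1 := ((𝓜.contMDiffAt_point hs).mdifferentiableAt (by simp)).hasMFDerivAt
  have h2 : HasMFDerivAt 𝓘(ℝ, ℝ) 𝓘(ℝ, (ℝ × ℝ) × ℝ) c s
      (ContinuousLinearMap.smulRight (1 : ℝ →L[ℝ] ℝ) w) := hc.hasFDerivAt.hasMFDerivAt
  have h3 := (h1.comp s h2).mfderiv
  have h4 := congrArg (fun L : ℝ →L[ℝ] Plane => L 1) h3
  refine h4.trans ?_
  show 𝓜.dPoint (c s) ((ContinuousLinearMap.smulRight (1 : ℝ →L[ℝ] ℝ) w) (1 : ℝ)) = _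
  simp

theorem velocity_eq {p : ℝ × ℝ} {t : ℝ} (h : (p, t) ∈ 𝓜.pointDom) :
    velocity (𝓜.γ p) t = 𝓜.dPoint (p, t) (0, 1) :=
  𝓜.mfderiv_point_comp (c := fun s => (p, s)) hasDerivAt_line h

theorem dy_eq {p : ℝ × ℝ} {t : ℝ} (h : (p, t) ∈ 𝓜.pointDom) :
    𝓜.dy p t = 𝓜.dPoint (p, t) ((1, 0), 0) :=
  𝓜.mfderiv_point_comp (c := fun y => ((y, p.2), t)) (s := p.1)
    (((hasDerivAt_id p.1).prodMk (hasDerivAt_const p.1 p.2)).prodMk (hasDerivAt_const p.1 t)) h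

theorem dη_eq {p : ℝ × ℝ} {t : ℝ} (h : (p, t) ∈ 𝓜.pointDom) :
    𝓜.dη p t = 𝓜.dPoint (p, t) ((0, 1), 0) :=
  𝓜.mfderiv_point_comp (c := fun η => ((p.1, η), t)) (s := p.2)
    (((hasDerivAt_const p.2 p.1).prodMk (hasDerivAt_id p.2)).prodMk (hasDerivAt_const p.2 t)) h

variable {M}

/-- Conormality in canonical coordinates. -/
theorem isParam_iff {q₀ q : Cotangent S} (hq : q.proj ∈ (chartAt Plane q₀.proj).source)
    {a : (ℝ × ℝ) × ℝ} : 𝓜.IsParam M a q ↔ a ∈ 𝓜.chartDom q₀.proj ∧ 𝓜.point a ∈ interior M ∧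
      𝓜.coordPoint q₀.proj a = (extChartAt cotModel q₀ q).1 ∧ (extChartAt cotModel q₀ q).2 ≠ 0 ∧
      (extChartAt cotModel q₀ q).2 (𝓜.coordVel q₀.proj a) = 0 := by
  obtain ⟨p, t⟩ := a
  constructor
  · rintro ⟨ξ, ⟨h1, h2, h3, h4, h5⟩, rfl⟩
    have ha : (p, t) ∈ 𝓜.chartDom q₀.proj := ⟨⟨h1, h2⟩, hq⟩
    refine ⟨ha, h3, (cotChart_fst (q := (⟨𝓜.γ p t, ξ⟩ : Cotangent S))).symm, fun h => h4 ?_, ?_⟩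
    · ext v
      have := cotChart_snd hq v
      rw [h] at this
      exact this.symm
    · rw [𝓜.coordVel_eq_toChart _ ha]
      exact (cotChart_snd hq _).trans h5
  · rintro ⟨ha, h3, h4, h5, h6⟩
    obtain ⟨x, ξ⟩ := q
    rw [cotChart_fst] at h4
    have hx : 𝓜.γ p t = x := (extChartAt 𝓘(ℝ, Plane) q₀.proj).injOn
      (mem_extChartAt_source_iff.2 ha.2) (mem_extChartAt_source_iff.2 hq) h4
    subst hx
    refine ⟨ξ, ⟨ha.1.1, ha.1.2, h3, ?_, ?_⟩, rfl⟩
    · rintro rfl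
      apply h5
      ext u
      obtain ⟨v, rfl⟩ := toChart_surjective q₀.proj (mem_extChartAt_source_iff.2 hq) u
      exact cotChart_snd hq v
    · rw [𝓜.coordVel_eq_toChart _ ha] at h6
      exact (cotChart_snd hq _).symm.trans h6

theorem UniqueConormal.mapC_eq_coord (hM : 𝓜.UniqueConormal M) {q₀ q : Cotangent S}
    (hq : q.proj ∈ (chartAt Plane q₀.proj).source) {a : (ℝ × ℝ) × ℝ} (h : 𝓜.IsParam M a q) :
    𝓜.mapC M q = (a.1,
      ((extChartAt cotModel q₀ q).2 (fderiv ℝ (𝓜.coordPoint q₀.proj) a ((1, 0), 0)),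
        (extChartAt cotModel q₀ q).2 (fderiv ℝ (𝓜.coordPoint q₀.proj) a ((0, 1), 0)))) := by
  have ha := ((𝓜.isParam_iff hq).1 h).1
  obtain ⟨p, t⟩ := a
  obtain ⟨ξ, h, rfl⟩ := h
  rw [UniqueConormal.mapC_eq 𝓜 hM h, 𝓜.dy_eq ha.1, 𝓜.dη_eq ha.1, ← 𝓜.toChart_dPoint _ ha,
    ← 𝓜.toChart_dPoint _ ha]
  refine congrArg (Prod.mk p) (Prod.ext ?_ ?_)
  · exact (cotChart_snd hq _).symm
  · exact (cotChart_snd hq _).symm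

theorem isOpen_interiorDom (x₀ : S) :
    IsOpen {a | a ∈ 𝓜.chartDom x₀ ∧ 𝓜.point a ∈ interior M} := by
  rw [isOpen_iff_mem_nhds]
  intro a ha
  exact ((𝓜.isOpen_chartDom x₀).eventually_mem ha.1).and
    ((𝓜.contMDiffAt_point ha.1.1).continuousAt.eventually (isOpen_interior.mem_nhds ha.2))

/-- The covectors conormal to geodesics, in canonical coordinates, as a function of the parameters
of their base points and of a scalar. -/
def conormalCoord (x₀ : S) (b : ((ℝ × ℝ) × ℝ) × ℝ) : Plane × (Plane →L[ℝ] ℝ) :=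
  (𝓜.coordPoint x₀ b.1, b.2 • areaL (𝓜.coordVel x₀ b.1))

theorem contDiffOn_conormalCoord (x₀ : S) :
    ContDiffOn ℝ ∞ (𝓜.conormalCoord x₀) (𝓜.chartDom x₀ ×ˢ univ) := by
  have h1 : ContDiffOn ℝ ∞ (fun b : ((ℝ × ℝ) × ℝ) × ℝ => 𝓜.coordPoint x₀ b.1)
      (𝓜.chartDom x₀ ×ˢ univ) :=
    (𝓜.contDiffOn_coordPoint x₀).comp contDiff_fst.contDiffOn fun b hb => hb.1
  have h2 : ContDiffOn ℝ ∞ (fun b : ((ℝ × ℝ) × ℝ) × ℝ => 𝓜.coordVel x₀ b.1)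
      (𝓜.chartDom x₀ ×ˢ univ) :=
    (𝓜.contDiffOn_fderiv_coordPoint x₀ (0, 1)).comp contDiff_fst.contDiffOn fun b hb => hb.1
  exact h1.prodMk (contDiff_snd.contDiffOn.smul (areaL.contDiff.comp_contDiffOn h2))

theorem fderiv_conormalCoord {x₀ : S} {b : ((ℝ × ℝ) × ℝ) × ℝ} (hb : b.1 ∈ 𝓜.chartDom x₀)
    (w : ((ℝ × ℝ) × ℝ) × ℝ) : fderiv ℝ (𝓜.conormalCoord x₀) b w =
      (fderiv ℝ (𝓜.coordPoint x₀) b.1 w.1,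
        areaL (b.2 • fderiv ℝ (𝓜.coordVel x₀) b.1 w.1 + w.2 • 𝓜.coordVel x₀ b.1)) := by
  have h1 := HasFDerivAt.comp (g := 𝓜.coordPoint x₀) b (𝓜.hasFDerivAt_coordPoint x₀ hb)
    hasFDerivAt_fst
  have h2 := HasFDerivAt.comp (g := 𝓜.coordVel x₀) b (𝓜.hasFDerivAt_coordVel x₀ hb)
    hasFDerivAt_fst
  have h3 := HasFDerivAt.comp (g := areaL) b areaL.hasFDerivAt h2
  have h4 : HasFDerivAt (𝓜.conormalCoord x₀) _ b := h1.prodMk (hasFDerivAt_snd.smul h3)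
  rw [h4.fderiv]
  simp

/-- The derivative is injective by the first order independence of Jacobi fields: its kernel
consists of vanishing variations whose derivative is a multiple of the velocity. -/
theorem eq_zero_of_fderiv_conormalCoord {x₀ : S} {b : ((ℝ × ℝ) × ℝ) × ℝ}
    (hb : b.1 ∈ 𝓜.chartDom x₀) (hb' : b.2 ≠ 0) {w : ((ℝ × ℝ) × ℝ) × ℝ}
    (hw : fderiv ℝ (𝓜.conormalCoord x₀) b w = 0) : w = 0 := by
  rw [𝓜.fderiv_conormalCoord hb] at hw
  have h1 : fderiv ℝ (𝓜.coordPoint x₀) b.1 w.1 = 0 := congrArg Prod.fst hw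
  have h2 := eq_zero_of_areaL_eq_zero (congrArg Prod.snd hw)
  have h3 := 𝓜.eq_zero_of_jacobi_eq_zero x₀ hb (d := b.2⁻¹ * w.2) h1 (by
    have h4 := congrArg (fun v => b.2⁻¹ • v) h2
    simpa [smul_add, smul_smul, hb'] using h4)
  have h5 : w.2 = 0 := by simpa [hb'] using h3.2
  exact Prod.ext h3.1 h5

/-- Near a covector in `V`, the parameters of the geodesic to which a covector is conormal are
smooth functions of the covector. -/
theorem exists_conormalCoord_homeomorph {q₀ : Cotangent S} (hq₀ : q₀ ∈ 𝓜.V M) :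
    ∃ e : OpenPartialHomeomorph (((ℝ × ℝ) × ℝ) × ℝ) (Plane × (Plane →L[ℝ] ℝ)),
      ⇑e = 𝓜.conormalCoord q₀.proj ∧ extChartAt cotModel q₀ q₀ ∈ e.target ∧
      e.target ⊆ (extChartAt cotModel q₀).target ∧
      (∀ b ∈ e.source, b.1 ∈ 𝓜.chartDom q₀.proj ∧ b.2 ≠ 0) ∧
      ContDiffOn ℝ ∞ e.symm e.target ∧
      ∀ z ∈ e.target, 𝓜.IsParam M (e.symm z).1 ((extChartAt cotModel q₀).symm z) := by
  obtain ⟨a, ha⟩ := (𝓜.mem_V_iff M).1 hq₀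
  obtain ⟨h1, h2, h3, h4, h5⟩ :=
    (𝓜.isParam_iff (q₀ := q₀) (mem_chart_source _ _)).1 ha
  obtain ⟨l, hl⟩ := exists_eq_smul_areaL (𝓜.coordVel_ne_zero _ h1) h5
  have hl0 : l ≠ 0 := by
    rintro rfl
    exact h4 (by rw [hl, zero_smul])
  -- The map `conormalCoord` is a local diffeomorphism between spaces of dimension four where `l ≠
  -- 0`.
  let U : Set (((ℝ × ℝ) × ℝ) × ℝ) :=
    {a | a ∈ 𝓜.chartDom q₀.proj ∧ 𝓜.point a ∈ interior M} ×ˢ {l | l ≠ 0}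
  have hU : IsOpen U := (𝓜.isOpen_interiorDom q₀.proj).prod isOpen_ne
  obtain ⟨e, he1, he2, he3, he4⟩ := exists_openPartialHomeomorph_of_injective
    (by rw [finrank_plane_prod_dual]; simp) hU
    ((𝓜.contDiffOn_conormalCoord q₀.proj).mono fun b hb => ⟨hb.1.1, mem_univ _⟩)
    (a := (a, l)) ⟨⟨h1, h2⟩, hl0⟩
    (fun w hw => 𝓜.eq_zero_of_fderiv_conormalCoord h1 hl0 hw)
  have hsrc : ∀ z ∈ e.target, e.symm z ∈ U ∧ 𝓜.conormalCoord q₀.proj (e.symm z) = z := by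
    intro z hz
    refine ⟨he2 (e.map_target hz), ?_⟩
    rw [← he3]
    exact e.right_inv hz
  have htar : e.target ⊆ (extChartAt cotModel q₀).target := by
    intro z hz
    rw [cotChart_target, ← (hsrc z hz).2]
    exact ⟨𝓜.coordPoint_mem _ (hsrc z hz).1.1.1, mem_univ _⟩
  refine ⟨e, he3, ?_, htar, fun b hb => ⟨(he2 hb).1.1, (he2 hb).2⟩, he4, fun z hz => ?_⟩
  · have h6 : extChartAt cotModel q₀ q₀ = e (a, l) := by
      rw [he3]
      exact Prod.ext h3.symm hl
    rw [h6]
    exact e.map_source he1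
  · have h6 := (extChartAt cotModel q₀).map_target (htar hz)
    rw [𝓜.isParam_iff (mem_cotChart_source.1 h6), (extChartAt cotModel q₀).right_inv (htar hz)]
    obtain ⟨⟨⟨h7, h8⟩, h9⟩, h10⟩ := hsrc z hz
    refine ⟨h7, h8, congrArg Prod.fst h10, ?_, ?_⟩
    · rw [← congrArg Prod.snd h10]
      exact smul_ne_zero h9 fun h => 𝓜.coordVel_ne_zero _ h7 (eq_zero_of_areaL_eq_zero h)
    · rw [← congrArg Prod.snd h10]
      simp [conormalCoord, areaL_self]

/-- Covectors of `ℝ × ℝ` in coordinates. -/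
def dualPairing : ℝ × ℝ →L[ℝ] ℝ × ℝ →L[ℝ] ℝ :=
  (ContinuousLinearMap.fst ℝ ℝ ℝ).smulRight (ContinuousLinearMap.fst ℝ ℝ ℝ) +
    (ContinuousLinearMap.snd ℝ ℝ ℝ).smulRight (ContinuousLinearMap.snd ℝ ℝ ℝ)

theorem dualPairing_apply (u v : ℝ × ℝ) : dualPairing u v = u.1 * v.1 + u.2 * v.2 := by
  simp [dualPairing]

/-- The canonical symplectic form of the cotangent bundle of the space of geodesics. -/
def symplecticGeod (v w : (ℝ × ℝ) × (ℝ × ℝ)) : ℝ := dualPairing v.2 w.1 - dualPairing w.2 v.1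

end GeodesicManifold

/-! ### The canonical map is a local symplectomorphism -/

namespace GeodesicManifold

variable {S : Type*} [TopologicalSpace S] [ChartedSpace Plane S] [IsManifold 𝓘(ℝ, Plane) ∞ S]
variable {g : Metric S} (𝓜 : GeodesicManifold g) {M : Set S}

theorem mapC_eventuallyEq (q₀ : Cotangent S) : 𝓜.mapC M =ᶠ[𝓝 q₀]
    (fun z => 𝓜.mapC M ((extChartAt cotModel q₀).symm z)) ∘ extChartAt cotModel q₀ := by
  filter_upwards [extChartAt_source_mem_nhds (I := cotModel) q₀] with q hq
  simp only [Function.comp]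
  rw [(extChartAt cotModel q₀).left_inv hq]

variable [T2Space S]

/-- In canonical coordinates `(x, ξ)` the canonical map is smooth, and it pulls back the canonical
one-form `ŷ dy + η̂ dη` to `ξ dx`. -/
theorem exists_contDiffOn_mapC (hM : 𝓜.UniqueConormal M) {q₀ : Cotangent S} (hq₀ : q₀ ∈ 𝓜.V M) :
    ∃ O : Set (Plane × (Plane →L[ℝ] ℝ)), IsOpen O ∧ extChartAt cotModel q₀ q₀ ∈ O ∧
      O ⊆ (extChartAt cotModel q₀).target ∧ (∀ z ∈ O, (extChartAt cotModel q₀).symm z ∈ 𝓜.V M) ∧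
      ContDiffOn ℝ ∞ (fun z => 𝓜.mapC M ((extChartAt cotModel q₀).symm z)) O ∧
      ContDiffOn ℝ ∞ (fun z => 𝓜.param M ((extChartAt cotModel q₀).symm z)) O ∧
      ∀ z ∈ O, ∀ w, dualPairing (𝓜.mapC M ((extChartAt cotModel q₀).symm z)).2
        (fderiv ℝ (fun z => 𝓜.mapC M ((extChartAt cotModel q₀).symm z)) z w).1 = z.2 w.1 := by
  obtain ⟨e, he, h0, htar, hsrc, hsm, hpar⟩ := 𝓜.exists_conormalCoord_homeomorph hq₀
  set C := extChartAt cotModel q₀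
  have hmem : ∀ z ∈ e.target, (e.symm z).1 ∈ 𝓜.chartDom q₀.proj := fun z hz =>
    (hsrc _ (e.map_target hz)).1
  have hinv : ∀ z ∈ e.target, 𝓜.conormalCoord q₀.proj (e.symm z) = z := by
    intro z hz
    rw [← he]
    exact e.right_inv hz
  have hF : ∀ z ∈ e.target, 𝓜.mapC M (C.symm z) = ((e.symm z).1.1,
      (z.2 (fderiv ℝ (𝓜.coordPoint q₀.proj) (e.symm z).1 ((1, 0), 0)),
        z.2 (fderiv ℝ (𝓜.coordPoint q₀.proj) (e.symm z).1 ((0, 1), 0)))) := by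
    intro z hz
    have h1 := UniqueConormal.mapC_eq_coord 𝓜 hM
      (mem_cotChart_source.1 (C.map_target (htar hz))) (hpar z hz)
    rwa [C.right_inv (htar hz)] at h1
  have hsm1 : ContDiffOn ℝ ∞ (fun z => (e.symm z).1) e.target := contDiff_fst.comp_contDiffOn hsm
  have hX : ∀ w, ContDiffOn ℝ ∞ (fun z : Plane × (Plane →L[ℝ] ℝ) =>
      z.2 (fderiv ℝ (𝓜.coordPoint q₀.proj) (e.symm z).1 w)) e.target := fun w =>
    contDiff_snd.contDiffOn.clm_apply
      ((𝓜.contDiffOn_fderiv_coordPoint q₀.proj w).comp hsm1 fun z hz => hmem z hz)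
  have hFsm : ContDiffOn ℝ ∞ (fun z => 𝓜.mapC M (C.symm z)) e.target :=
    ((contDiff_fst.comp_contDiffOn hsm1).prodMk ((hX _).prodMk (hX _))).congr hF
  refine ⟨e.target, e.open_target, h0, htar, fun z hz => (𝓜.mem_V_iff M).2 ⟨_, hpar z hz⟩, hFsm,
    hsm1.congr fun z hz => ?_, fun z hz w => ?_⟩
  · exact UniqueConormal.isParam_unique 𝓜 hM
      (𝓜.isParam_param ((𝓜.mem_V_iff M).2 ⟨_, hpar z hz⟩)) (hpar z hz)
  · have hn := e.open_target.mem_nhds hz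
    have ha := hmem z hz
    have hd : HasFDerivAt (fun z => (e.symm z).1) (fderiv ℝ (fun z => (e.symm z).1) z) z :=
      ((hsm1.contDiffAt hn).differentiableAt (by simp)).hasFDerivAt
    have hdF : HasFDerivAt (fun z => 𝓜.mapC M (C.symm z))
        (fderiv ℝ (fun z => 𝓜.mapC M (C.symm z)) z) z :=
      ((hFsm.contDiffAt hn).differentiableAt (by simp)).hasFDerivAt
    set m := fderiv ℝ (fun z => (e.symm z).1) z w with hm
    have h1 : (fderiv ℝ (fun z => 𝓜.mapC M (C.symm z)) z w).1 = m.1 := by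
      have h2 := HasFDerivAt.comp (g := Prod.fst) z hasFDerivAt_fst hdF
      have h3 := HasFDerivAt.comp (g := Prod.fst) z hasFDerivAt_fst hd
      have h4 : (Prod.fst ∘ fun z => 𝓜.mapC M (C.symm z)) =ᶠ[𝓝 z]
          (Prod.fst ∘ fun z => (e.symm z).1) := by
        filter_upwards [hn] with y hy
        exact congrArg Prod.fst (hF y hy)
      exact congrArg (fun L : Plane × (Plane →L[ℝ] ℝ) →L[ℝ] ℝ × ℝ => L w)
        (h2.unique (h3.congr_of_eventuallyEq h4))
    -- Differentiating `γ(y, η, t) = x` and applying `ξ`, which annihilates `∂_t γ`, gives the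
    -- claim.
    have h5 : fderiv ℝ (𝓜.coordPoint q₀.proj) (e.symm z).1 m = w.1 := by
      have h2 := HasFDerivAt.comp (g := 𝓜.coordPoint q₀.proj) z
        (𝓜.hasFDerivAt_coordPoint q₀.proj ha) hd
      have h3 : (𝓜.coordPoint q₀.proj ∘ fun z => (e.symm z).1) =ᶠ[𝓝 z] Prod.fst := by
        filter_upwards [hn] with y hy
        exact congrArg Prod.fst (hinv y hy)
      exact congrArg (fun L : Plane × (Plane →L[ℝ] ℝ) →L[ℝ] Plane => L w)
        (h2.unique (hasFDerivAt_fst.congr_of_eventuallyEq h3))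
    have h6 : z.2 (𝓜.coordVel q₀.proj (e.symm z).1) = 0 := by
      rw [← congrArg Prod.snd (hinv z hz)]
      simp [conormalCoord, areaL_self]
    have h7 : m = m.1.1 • ((1, 0), 0) + m.1.2 • ((0, 1), 0) + m.2 • ((0 : ℝ × ℝ), (1 : ℝ)) := by
      ext <;> simp
    have h8 := congrArg z.2 h5
    rw [h7] at h8
    simp only [map_add, map_smul, smul_eq_mul] at h8
    have h9 : z.2 (fderiv ℝ (𝓜.coordPoint q₀.proj) (e.symm z).1 (0, 1)) = 0 := h6
    rw [h9] at h8
    rw [h1, hF z hz, dualPairing_apply, ← h8]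
    ring

/-- The canonical map preserves the symplectic forms, since it preserves the canonical
one-forms. -/
theorem symplecticGeod_fderiv {F : Plane × (Plane →L[ℝ] ℝ) → (ℝ × ℝ) × (ℝ × ℝ)}
    {O : Set (Plane × (Plane →L[ℝ] ℝ))} (hO : IsOpen O) (hF : ContDiffOn ℝ ∞ F O)
    (h : ∀ z ∈ O, ∀ w, dualPairing (F z).2 (fderiv ℝ F z w).1 = z.2 w.1)
    {z : Plane × (Plane →L[ℝ] ℝ)} (hz : z ∈ O) (v w : Plane × (Plane →L[ℝ] ℝ)) :
    symplecticGeod (fderiv ℝ F z v) (fderiv ℝ F z w) = v.2 w.1 - w.2 v.1 := by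
  have hd : ∀ y ∈ O, HasFDerivAt F (fderiv ℝ F y) y := fun y hy =>
    ((hF.contDiffAt (hO.mem_nhds hy)).differentiableAt (by simp)).hasFDerivAt
  have h1 : ∀ y ∈ O, HasFDerivAt (fun y => (F y).1)
      ((ContinuousLinearMap.fst ℝ _ _).comp (fderiv ℝ F y)) y := fun y hy =>
    HasFDerivAt.comp (g := Prod.fst) y hasFDerivAt_fst (hd y hy)
  have h2 : HasFDerivAt (fun y => dualPairing (F y).2)
      (dualPairing.comp ((ContinuousLinearMap.snd ℝ _ _).comp (fderiv ℝ F z))) z :=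
    HasFDerivAt.comp (g := dualPairing) z dualPairing.hasFDerivAt
      (HasFDerivAt.comp (g := Prod.snd) z hasFDerivAt_snd (hd z hz))
  have h3 : ∀ w, ∀ᶠ y in 𝓝 z, dualPairing (F y).2 (fderiv ℝ (fun y => (F y).1) y w) =
      y.2 w.1 := by
    intro w
    filter_upwards [hO.mem_nhds hz] with y hy
    rw [(h1 y hy).fderiv]
    exact h y hy w
  have h4 := exterior_deriv_pullback (X := fun y => (F y).1)
    (((contDiff_fst.comp_contDiffOn hF).contDiffAt (hO.mem_nhds hz)).of_le ENat.LEInfty.out)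
    h2.differentiableAt (h3 v) (h3 w)
  have h5 : ∀ w v : Plane × (Plane →L[ℝ] ℝ),
      fderiv ℝ (fun y : Plane × (Plane →L[ℝ] ℝ) => y.2 w.1) z v = v.2 w.1 := by
    intro w v
    have h6 : HasFDerivAt (fun y : Plane × (Plane →L[ℝ] ℝ) => y.2 w.1) _ z :=
      hasFDerivAt_snd.clm_apply (hasFDerivAt_const w.1 z)
    rw [h6.fderiv]
    simp
  rw [h5, h5, h2.fderiv, (h1 z hz).fderiv] at h4
  exact h4

theorem UniqueConormal.contMDiffAt_mapC (hM : 𝓜.UniqueConormal M) {q₀ : Cotangent S}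
    (hq₀ : q₀ ∈ 𝓜.V M) :
    ContMDiffAt cotModel 𝓘(ℝ, (ℝ × ℝ) × (ℝ × ℝ)) ∞ (𝓜.mapC M) q₀ := by
  obtain ⟨O, hO, h0, -, -, hF, -⟩ := 𝓜.exists_contDiffOn_mapC hM hq₀
  exact (ContMDiffAt.comp q₀ (hF.contDiffAt (hO.mem_nhds h0)).contMDiffAt
    contMDiffAt_extChartAt).congr_of_eventuallyEq (𝓜.mapC_eventuallyEq q₀)

theorem UniqueConormal.continuousAt_param (hM : 𝓜.UniqueConormal M) {q₀ : Cotangent S}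
    (hq₀ : q₀ ∈ 𝓜.V M) : ContinuousAt (𝓜.param M) q₀ := by
  obtain ⟨O, hO, h0, -, -, -, hF, -⟩ := 𝓜.exists_contDiffOn_mapC hM hq₀
  refine ContinuousAt.congr (ContinuousAt.comp (hF.contDiffAt (hO.mem_nhds h0)).continuousAt
    (continuousAt_extChartAt (I := cotModel) q₀)) ?_
  filter_upwards [extChartAt_source_mem_nhds (I := cotModel) q₀] with q hq
  simp only [Function.comp]
  rw [(extChartAt cotModel q₀).left_inv hq]

/-- The symplectic form of `T*S` is the pullback of the symplectic form of the cotangent bundle of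
the space of geodesics under the canonical map. -/
theorem UniqueConormal.symplecticForm_eq (hM : 𝓜.UniqueConormal M) {q : Cotangent S}
    (hq : q ∈ 𝓜.V M) (v w : TangentSpace cotModel q) :
    symplecticForm q v w =
      symplecticGeod (mfderiv cotModel 𝓘(ℝ, (ℝ × ℝ) × (ℝ × ℝ)) (𝓜.mapC M) q v)
        (mfderiv cotModel 𝓘(ℝ, (ℝ × ℝ) × (ℝ × ℝ)) (𝓜.mapC M) q w) := by
  obtain ⟨O, hO, h0, -, -, hF, -, htaut⟩ := 𝓜.exists_contDiffOn_mapC hM hq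
  have h1 : HasMFDerivAt cotModel 𝓘(ℝ, Plane × (Plane →L[ℝ] ℝ)) (extChartAt cotModel q) q
      (mfderiv cotModel 𝓘(ℝ, Plane × (Plane →L[ℝ] ℝ)) (extChartAt cotModel q) q) :=
    (mdifferentiableAt_extChartAt (mem_chart_source _ q)).hasMFDerivAt
  have h2 := ((hF.contDiffAt (hO.mem_nhds h0)).differentiableAt (by simp)).hasFDerivAt.hasMFDerivAt
  have h3 := ((h2.comp q h1).congr_of_eventuallyEq (𝓜.mapC_eventuallyEq q)).mfderiv
  have h4 : ∀ v : TangentSpace cotModel q,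
      mfderiv cotModel 𝓘(ℝ, (ℝ × ℝ) × (ℝ × ℝ)) (𝓜.mapC M) q v =
      fderiv ℝ (fun z => 𝓜.mapC M ((extChartAt cotModel q).symm z)) (extChartAt cotModel q q)
        (mfderiv cotModel 𝓘(ℝ, Plane × (Plane →L[ℝ] ℝ)) (extChartAt cotModel q) q v) := by
    intro v
    rw [h3]
    rfl
  rw [h4, h4]
  exact (symplecticGeod_fderiv hO hF htaut h0 _ _).symm

/-- The canonical map is a local diffeomorphism: its differential is injective because it preserves
the symplectic forms. -/
theorem UniqueConormal.exists_local_inverse (hM : 𝓜.UniqueConormal M) {q₀ : Cotangent S}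
    (hq₀ : q₀ ∈ 𝓜.V M) {A : Set (Cotangent S)} (hA : A ∈ 𝓝 q₀) :
    ∃ N ⊆ A, IsOpen N ∧ q₀ ∈ N ∧ N ⊆ 𝓜.V M ∧ InjOn (𝓜.mapC M) N ∧ IsOpen (𝓜.mapC M '' N) ∧
      ∃ Ψ : (ℝ × ℝ) × (ℝ × ℝ) → Cotangent S,
        ContMDiffOn 𝓘(ℝ, (ℝ × ℝ) × (ℝ × ℝ)) cotModel ∞ Ψ (𝓜.mapC M '' N) ∧
        ∀ q ∈ N, Ψ (𝓜.mapC M q) = q := by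
  obtain ⟨O, hO, h0, hOt, hOV, hF, -, htaut⟩ := 𝓜.exists_contDiffOn_mapC hM hq₀
  set C := extChartAt cotModel q₀ with hC
  have hU : IsOpen (O ∩ (C.target ∩ C.symm ⁻¹' interior A)) :=
    hO.inter ((continuousOn_extChartAt_symm (I := cotModel) q₀).isOpen_inter_preimage
      (isOpen_extChartAt_target q₀) isOpen_interior)
  have h0' : C q₀ ∈ O ∩ (C.target ∩ C.symm ⁻¹' interior A) := by
    refine ⟨h0, hOt h0, ?_⟩
    rw [mem_preimage, C.left_inv (mem_extChartAt_source (I := cotModel) q₀)]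
    exact mem_interior_iff_mem_nhds.2 hA
  obtain ⟨e, he1, he2, he3, he4⟩ := exists_openPartialHomeomorph_of_injective
    (by rw [finrank_plane_prod_dual]; simp) hU (hF.mono inter_subset_left) h0' (by
      intro v hv
      have h1 := symplecticGeod_fderiv hO hF htaut h0 v
      simp only [hv, symplecticGeod, Prod.fst_zero, Prod.snd_zero, map_zero,
        _root_.zero_apply, sub_zero] at h1
      have h2 : v.2 = 0 := by
        ext u
        simpa using (h1 (u, 0)).symm
      have h3 : ∀ ξ : Plane →L[ℝ] ℝ, ξ v.1 = 0 := fun ξ => by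
        simpa using h1 (0, ξ)
      refine Prod.ext ?_ h2
      ext i
      exact h3 (EuclideanSpace.proj i))
  have hsrc : ∀ z ∈ e.source, z ∈ O ∧ z ∈ C.target ∧ C.symm z ∈ interior A := fun z hz =>
    ⟨(he2 hz).1, (he2 hz).2.1, (he2 hz).2.2⟩
  have hval : ∀ q ∈ C.source ∩ C ⁻¹' e.source, 𝓜.mapC M q = e (C q) := by
    intro q hq
    rw [he3]
    simp only
    rw [C.left_inv hq.1]
  have him : 𝓜.mapC M '' (C.source ∩ C ⁻¹' e.source) = e.target := by
    ext y
    constructor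
    · rintro ⟨q, hq, rfl⟩
      rw [hval q hq]
      exact e.map_source hq.2
    · intro hy
      have h1 := e.map_target hy
      have h2 := C.right_inv (hsrc _ h1).2.1
      have h3 : C.symm (e.symm y) ∈ C.source ∩ C ⁻¹' e.source := by
        refine ⟨C.map_target (hsrc _ h1).2.1, ?_⟩
        rw [mem_preimage, h2]
        exact h1
      refine ⟨_, h3, ?_⟩
      rw [hval _ h3, h2, e.right_inv hy]
  refine ⟨C.source ∩ C ⁻¹' e.source, ?_, ?_, ⟨mem_extChartAt_source q₀, he1⟩, ?_, ?_, ?_,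
    fun y => C.symm (e.symm y), ?_, ?_⟩
  · intro q hq
    have := (hsrc _ hq.2).2.2
    rw [C.left_inv hq.1] at this
    exact interior_subset this
  · exact (continuousOn_extChartAt (I := cotModel) q₀).isOpen_inter_preimage
      (isOpen_extChartAt_source q₀) e.open_source
  · intro q hq
    have := hOV _ (hsrc _ hq.2).1
    rwa [C.left_inv hq.1] at this
  · intro q hq q' hq' h
    rw [hval q hq, hval q' hq'] at h
    exact C.injOn hq.1 hq'.1 (e.injOn hq.2 hq'.2 h)
  · rw [him]
    exact e.open_target
  · rw [him]
    exact (contMDiffOn_extChartAt_symm (I := cotModel) q₀).comp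
      (contMDiffOn_iff_contDiffOn.2 he4) fun y hy => (hsrc _ (e.map_target hy)).2.1
  · intro q hq
    simp only
    rw [hval q hq, e.left_inv hq.2, C.left_inv hq.1]

theorem UniqueConormal.isOpen_image_mapC (hM : 𝓜.UniqueConormal M) {A : Set (Cotangent S)}
    (hA : IsOpen A) (hAV : A ⊆ 𝓜.V M) : IsOpen (𝓜.mapC M '' A) := by
  rw [isOpen_iff_mem_nhds]
  rintro - ⟨q, hq, rfl⟩
  obtain ⟨N, hN, -, hqN, -, -, ho, -⟩ :=
    UniqueConormal.exists_local_inverse 𝓜 hM (hAV hq) (hA.mem_nhds hq)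
  exact mem_of_superset (ho.mem_nhds (mem_image_of_mem _ hqN)) (image_mono hN)

end GeodesicManifold

/-! ### Homogeneity in the fibres -/

/-- A vector of the plane that is parallel to `v` and is annihilated by a covector `α` with `α v ≠ 0`
vanishes. -/
theorem eq_zero_of_areaL_of_apply {v u : Plane} (hv : v ≠ 0) {α : Plane →L[ℝ] ℝ} (hα : α v ≠ 0)
    (h : areaL v u = 0) (hu : α u = 0) : u = 0 := by
  have h1 : areaL u v = 0 := by
    rw [areaL_apply] at h ⊢
    linarith
  obtain ⟨l, hl⟩ := exists_eq_smul_areaL hv h1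
  have h2 : u - l • v = 0 := eq_zero_of_areaL_eq_zero (by rw [map_sub, map_smul, hl, sub_self])
  rw [sub_eq_zero] at h2
  rw [h2, map_smul, smul_eq_mul] at hu
  rw [h2, (mul_eq_zero.1 hu).resolve_right hα, zero_smul]

section Cotangent

variable {S : Type*} [TopologicalSpace S] [ChartedSpace Plane S] [IsManifold 𝓘(ℝ, Plane) ∞ S]

theorem scale_scale (r s : ℝ) (q : Cotangent S) : scale r (scale s q) = scale (r * s) q :=
  congrArg (Bundle.TotalSpace.mk q.proj) (smul_smul r s q.snd)

theorem scale_one (q : Cotangent S) : scale 1 q = q := by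
  simp only [scale, one_smul]

theorem scale_injective {r : ℝ} (hr : r ≠ 0) :
    Function.Injective (scale r : Cotangent S → Cotangent S) := by
  intro q q' h
  have := congrArg (scale r⁻¹) h
  simpa only [scale_scale, inv_mul_cancel₀ hr, scale_one] using this

theorem cotChart_scale {q₀ q : Cotangent S} (h : q.proj ∈ (chartAt Plane q₀.proj).source) (r : ℝ) :
    extChartAt cotModel q₀ (scale r q) =
      ((extChartAt cotModel q₀ q).1, r • (extChartAt cotModel q₀ q).2) := by
  refine Prod.ext ?_ ?_
  · rw [cotChart_fst, cotChart_fst]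
    rfl
  · ext u
    obtain ⟨v, rfl⟩ := toChart_surjective q₀.proj (mem_extChartAt_source_iff.2 h) u
    rw [_root_.smul_apply, cotChart_snd h]
    exact cotChart_snd (q := scale r q) h v

theorem continuous_scale : Continuous fun a : ℝ × Cotangent S => scale a.1 a.2 := by
  rw [continuous_iff_continuousAt]
  rintro ⟨r, q⟩
  set C := extChartAt cotModel q with hC
  have hs : ∀ᶠ a : ℝ × Cotangent S in 𝓝 (r, q), a.2 ∈ C.source :=
    continuous_snd.continuousAt.eventually (extChartAt_source_mem_nhds (I := cotModel) q)
  have h1 : ContinuousAt (fun a : ℝ × Cotangent S => C a.2) (r, q) :=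
    ContinuousAt.comp (g := C) (continuousAt_extChartAt (I := cotModel) q)
      continuous_snd.continuousAt
  have h2 : ContinuousAt (fun a : ℝ × Cotangent S => ((C a.2).1, a.1 • (C a.2).2)) (r, q) :=
    h1.fst.prodMk (continuous_fst.continuousAt.smul h1.snd)
  have hq : C (scale r q) = ((C q).1, r • (C q).2) := cotChart_scale (mem_chart_source _ _) r
  have hmem : scale r q ∈ C.source := mem_cotChart_source.2 (mem_chart_source _ _)
  have h3 : ContinuousAt (fun a : ℝ × Cotangent S => C.symm ((C a.2).1, a.1 • (C a.2).2))
      (r, q) := by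
    refine ContinuousAt.comp (g := C.symm) ?_ h2
    refine continuousAt_extChartAt_symm'' ?_
    simp only
    rw [← hq]
    exact C.map_source hmem
  refine h3.congr ?_
  filter_upwards [hs] with a ha
  have h4 := mem_cotChart_source.1 ha
  rw [← cotChart_scale h4]
  exact C.left_inv ((mem_cotChart_source (q := scale a.1 a.2)).2 h4)

end Cotangent

namespace GeodesicManifold

variable {S : Type*} [TopologicalSpace S] [ChartedSpace Plane S] [IsManifold 𝓘(ℝ, Plane) ∞ S]
variable {g : Metric S} (𝓜 : GeodesicManifold g) {M : Set S}

theorem IsParam.proj_mem {a : (ℝ × ℝ) × ℝ} {q : Cotangent S} (h : 𝓜.IsParam M a q) :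
    q.proj ∈ interior M := by
  obtain ⟨ξ, h, rfl⟩ := h
  exact h.2.2.1

theorem IsParam.snd_ne_zero {a : (ℝ × ℝ) × ℝ} {q : Cotangent S} (h : 𝓜.IsParam M a q) :
    q.snd ≠ 0 := by
  obtain ⟨ξ, h, rfl⟩ := h
  exact h.2.2.2.1

theorem IsParam.mem_V {a : (ℝ × ℝ) × ℝ} {q : Cotangent S} (h : 𝓜.IsParam M a q) : q ∈ 𝓜.V M :=
  (𝓜.mem_V_iff M).2 ⟨a, h⟩

theorem snd_ne_zero_of_mem_V {q : Cotangent S} (h : q ∈ 𝓜.V M) : q.snd ≠ 0 :=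
  IsParam.snd_ne_zero 𝓜 (𝓜.isParam_param h)

theorem scale_mem_V {q : Cotangent S} (h : q ∈ 𝓜.V M) {r : ℝ} (hr : r ≠ 0) :
    scale r q ∈ 𝓜.V M :=
  IsParam.mem_V 𝓜 (IsParam.scale 𝓜 (𝓜.isParam_param h) hr)

theorem UniqueConormal.param_eq (hM : 𝓜.UniqueConormal M) {a : (ℝ × ℝ) × ℝ} {q : Cotangent S}
    (h : 𝓜.IsParam M a q) : 𝓜.param M q = a :=
  UniqueConormal.isParam_unique 𝓜 hM (𝓜.isParam_param (IsParam.mem_V 𝓜 h)) h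

theorem UniqueConormal.mapC_fst (hM : 𝓜.UniqueConormal M) {a : (ℝ × ℝ) × ℝ} {q : Cotangent S}
    (h : 𝓜.IsParam M a q) : (𝓜.mapC M q).1 = a.1 := by
  obtain ⟨ξ, h, rfl⟩ := h
  rw [UniqueConormal.mapC_eq 𝓜 hM h]

variable [T2Space S]

/-- The canonical map does not take values in the zero section. -/
theorem UniqueConormal.mapC_snd_ne_zero (hM : 𝓜.UniqueConormal M) {q : Cotangent S}
    (hq : q ∈ 𝓜.V M) : (𝓜.mapC M q).2 ≠ 0 := by
  obtain ⟨O, hO, h0, -, -, -, -, htaut⟩ := 𝓜.exists_contDiffOn_mapC hM hq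
  have h1 := ((𝓜.isParam_iff (q₀ := q) (mem_chart_source _ _)).1 (𝓜.isParam_param hq)).2.2.2.1
  intro h
  apply h1
  ext u
  have h2 := htaut _ h0 (u, 0)
  rw [(extChartAt cotModel q).left_inv (mem_extChartAt_source q), h] at h2
  simpa using h2.symm

/-- The canonical map as the restriction of a covector to the variations of the geodesic. -/
theorem UniqueConormal.dualPairing_mapC (hM : 𝓜.UniqueConormal M) {a : (ℝ × ℝ) × ℝ}
    {ξ : TangentSpace 𝓘(ℝ, Plane) (𝓜.γ a.1 a.2) →L[ℝ] ℝ} (h : 𝓜.IsConormal M a.1 a.2 ξ)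
    (w : (ℝ × ℝ) × ℝ) : dualPairing (𝓜.mapC M ⟨𝓜.γ a.1 a.2, ξ⟩).2 w.1 = ξ (𝓜.dPoint a w) := by
  have ha : a ∈ 𝓜.pointDom := ⟨h.1, h.2.1⟩
  have h5 := h.2.2.2.2
  rw [𝓜.velocity_eq ha] at h5
  have h6 : w = w.1.1 • ((1, 0), 0) + w.1.2 • ((0, 1), 0) + w.2 • ((0 : ℝ × ℝ), (1 : ℝ)) := by
    ext <;> simp
  have h7 : ξ (𝓜.dPoint a w) = w.1.1 * ξ (𝓜.dPoint a ((1, 0), 0)) +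
      w.1.2 * ξ (𝓜.dPoint a ((0, 1), 0)) + w.2 * ξ (𝓜.dPoint a (0, 1)) := by
    let L : (ℝ × ℝ) × ℝ →L[ℝ] ℝ := ContinuousLinearMap.comp
      (show TangentSpace 𝓘(ℝ, Plane) (𝓜.point a) →L[ℝ] ℝ from ξ) (𝓜.dPoint a)
    have hL : L w = w.1.1 * L ((1, 0), 0) + w.1.2 * L ((0, 1), 0) + w.2 * L (0, 1) := by
      conv_lhs => rw [h6]
      simp only [map_add, map_smul, smul_eq_mul]
    exact hL
  rw [UniqueConormal.mapC_eq 𝓜 hM h, 𝓜.dy_eq ha, 𝓜.dη_eq ha, h7, dualPairing_apply, h5]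
  ring

/-- The family of geodesics is a submersion at points of `M^int`: a covector annihilating its
derivative would be mapped to the zero section. -/
theorem UniqueConormal.eq_of_dPoint (hM : 𝓜.UniqueConormal M) {a : (ℝ × ℝ) × ℝ}
    (ha : a ∈ 𝓜.pointDom) (haM : 𝓜.point a ∈ interior M)
    {ξ ξ' : TangentSpace 𝓘(ℝ, Plane) (𝓜.γ a.1 a.2) →L[ℝ] ℝ}
    (h : ∀ w, ξ (𝓜.dPoint a w) = ξ' (𝓜.dPoint a w)) : ξ = ξ' := by
  by_contra hne
  have hd : ∀ w, (ξ - ξ') (𝓜.dPoint a w) = 0 := fun w => sub_eq_zero.2 (h w)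
  have hc : 𝓜.IsConormal M a.1 a.2 (ξ - ξ') := by
    refine ⟨ha.1, ha.2, haM, sub_ne_zero.2 hne, ?_⟩
    rw [𝓜.velocity_eq ha]
    exact hd _
  refine UniqueConormal.mapC_snd_ne_zero 𝓜 hM (IsParam.mem_V 𝓜 ⟨_, hc, rfl⟩) ?_
  have h1 : ∀ u, dualPairing (𝓜.mapC M ⟨𝓜.γ a.1 a.2, ξ - ξ'⟩).2 u = 0 := fun u =>
    (UniqueConormal.dualPairing_mapC 𝓜 hM hc (u, 0)).trans (hd _)
  have e1 := h1 (1, 0)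
  have e2 := h1 (0, 1)
  simp only [dualPairing_apply] at e1 e2
  exact Prod.ext (by simpa using e1) (by simpa using e2)

/-- A covector in `V` is determined by its image under the canonical map and by the time at which
it is conormal to the geodesic. -/
theorem UniqueConormal.eq_of_isParam (hM : 𝓜.UniqueConormal M) {a : (ℝ × ℝ) × ℝ}
    {q q' : Cotangent S} (h : 𝓜.IsParam M a q) (h' : 𝓜.IsParam M a q')
    (he : 𝓜.mapC M q = 𝓜.mapC M q') : q = q' := by
  obtain ⟨ξ, h, rfl⟩ := h
  obtain ⟨ξ', h', rfl⟩ := h'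
  congr 1
  refine UniqueConormal.eq_of_dPoint 𝓜 hM ⟨h.1, h.2.1⟩ h.2.2.1 fun w => ?_
  rw [← UniqueConormal.dualPairing_mapC 𝓜 hM h, ← UniqueConormal.dualPairing_mapC 𝓜 hM h', he]

/-- Conic neighborhoods on which the canonical map is injective. By homogeneity, injectivity near a
covector extends to the cone that it generates. -/
theorem UniqueConormal.exists_conic_nhd (hM : 𝓜.UniqueConormal M) {q₀ : Cotangent S}
    (hq₀ : q₀ ∈ 𝓜.V M) {ε : ℝ} (hε : 0 < ε) :
    ∃ U : Set (Cotangent S), IsOpen U ∧ IsConic U ∧ IsEven U ∧ q₀ ∈ U ∧ U ⊆ 𝓜.V M ∧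
      InjOn (𝓜.mapC M) U ∧ ∀ q ∈ U, |(𝓜.param M q).2 - (𝓜.param M q₀).2| < ε := by
  obtain ⟨N, -, hN, hqN, hNV, hinj, -⟩ := UniqueConormal.exists_local_inverse 𝓜 hM hq₀ univ_mem
  -- A function of `𝒞` that is homogeneous of degree one in the fibres and does not vanish at `q₀`.
  let ℓ : Cotangent S → ℝ := fun q => dualPairing (𝓜.mapC M q₀).2 (𝓜.mapC M q).2
  have hℓ₀ : ℓ q₀ ≠ 0 := by
    intro h
    apply UniqueConormal.mapC_snd_ne_zero 𝓜 hM hq₀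
    simp only [ℓ, dualPairing_apply] at h
    refine Prod.ext ?_ ?_
    · simp only [Prod.fst_zero]
      nlinarith [sq_nonneg (𝓜.mapC M q₀).2.1, sq_nonneg (𝓜.mapC M q₀).2.2]
    · simp only [Prod.snd_zero]
      nlinarith [sq_nonneg (𝓜.mapC M q₀).2.1, sq_nonneg (𝓜.mapC M q₀).2.2]
  have hℓ : ContinuousAt ℓ q₀ :=
    (dualPairing (𝓜.mapC M q₀).2).continuous.continuousAt.comp
      (UniqueConormal.contMDiffAt_mapC 𝓜 hM hq₀).continuousAt.snd
  have hℓs : ∀ q ∈ 𝓜.V M, ∀ r : ℝ, r ≠ 0 → ℓ (scale r q) = r * ℓ q := by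
    intro q hq r hr
    simp only [ℓ, UniqueConormal.mapC_scale 𝓜 hM hq hr, map_smul, smul_eq_mul]
  -- For `a` and `b` near `q₀`, the multiple of `b` with the same `ℓ` as `a` is near `q₀`.
  have hev : ∀ᶠ a : Cotangent S × Cotangent S in 𝓝 (q₀, q₀),
      scale (ℓ a.1 / ℓ a.2) a.2 ∈ N := by
    have h1 : ContinuousAt (fun a : Cotangent S × Cotangent S => ℓ a.1) (q₀, q₀) :=
      ContinuousAt.comp (g := ℓ) hℓ continuous_fst.continuousAt
    have h2 : ContinuousAt (fun a : Cotangent S × Cotangent S => ℓ a.2) (q₀, q₀) :=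
      ContinuousAt.comp (g := ℓ) hℓ continuous_snd.continuousAt
    have h3 : ContinuousAt (fun a : Cotangent S × Cotangent S => scale (ℓ a.1 / ℓ a.2) a.2)
        (q₀, q₀) :=
      ContinuousAt.comp (g := fun a : ℝ × Cotangent S => scale a.1 a.2)
        continuous_scale.continuousAt ((h1.div h2 hℓ₀).prodMk continuous_snd.continuousAt)
    refine h3.eventually (hN.mem_nhds ?_)
    simp only [div_self hℓ₀, scale_one]
    exact hqN
  rw [nhds_prod_eq] at hev
  obtain ⟨A, hA, hA'⟩ := Filter.eventually_prod_self_iff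
    (r := fun a b => scale (ℓ a / ℓ b) b ∈ N).1 hev
  have ht : ∀ᶠ q in 𝓝 q₀, |(𝓜.param M q).2 - (𝓜.param M q₀).2| < ε := by
    have h1 : ContinuousAt (fun q => |(𝓜.param M q).2 - (𝓜.param M q₀).2|) q₀ :=
      ((UniqueConormal.continuousAt_param 𝓜 hM hq₀).snd.sub continuousAt_const).abs
    refine h1.eventually_lt_const ?_
    simpa using hε
  obtain ⟨B, hB, hBo, hqB⟩ := _root_.mem_nhds_iff.1
    (inter_mem (inter_mem hA (hN.mem_nhds hqN)) (inter_mem (hℓ.eventually_ne hℓ₀) ht))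
  have hUV : ∀ q : Cotangent S, ∀ r : ℝ, r ≠ 0 → scale r q ∈ B → q ∈ 𝓜.V M := by
    intro q r hr hq
    have := 𝓜.scale_mem_V (hNV (hB hq).1.2) (inv_ne_zero hr)
    rwa [scale_scale, inv_mul_cancel₀ hr, scale_one] at this
  -- The symmetric cone generated by `B`. Two of its points with the same image have the same `ℓ`, so
  -- some common factor moves both into `N`, where the canonical map is injective.
  refine ⟨{q | ∃ r : ℝ, r ≠ 0 ∧ scale r q ∈ B}, ?_, ?_, ?_, ?_, ?_, ?_, ?_⟩
  · have h1 : {q : Cotangent S | ∃ r : ℝ, r ≠ 0 ∧ scale r q ∈ B} =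
        ⋃ r : ℝ, ⋃ _ : r ≠ 0, scale r ⁻¹' B := by
      ext q
      simp
    rw [h1]
    refine isOpen_iUnion fun r => isOpen_iUnion fun _ => hBo.preimage ?_
    exact continuous_scale.comp (continuous_const.prodMk continuous_id)
  · rintro q ⟨r, hr, hq⟩ s hs
    refine ⟨r * s⁻¹, mul_ne_zero hr (inv_ne_zero hs.ne'), ?_⟩
    rwa [scale_scale, mul_assoc, inv_mul_cancel₀ hs.ne', mul_one]
  · rintro q ⟨r, hr, hq⟩
    refine ⟨-r, neg_ne_zero.2 hr, ?_⟩
    rwa [scale_scale, neg_mul_neg, mul_one]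
  · exact ⟨1, one_ne_zero, by rwa [scale_one]⟩
  · rintro q ⟨r, hr, hq⟩
    exact hUV q r hr hq
  · rintro q ⟨r, hr, hq⟩ q' ⟨r', hr', hq'⟩ he
    have hqV := hUV q r hr hq
    have hqV' := hUV q' r' hr' hq'
    have hℓq : ℓ q = ℓ q' := by simp only [ℓ, he]
    have h1 : scale (ℓ (scale r q) / ℓ (scale r' q')) (scale r' q') ∈ N :=
      hA' _ (hB hq).1.1 _ (hB hq').1.1
    have h2 : ℓ q' ≠ 0 := by
      have := (hB hq').2.1
      rw [mem_ofPred_eq, hℓs _ hqV' _ hr'] at this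
      exact right_ne_zero_of_mul this
    rw [hℓs _ hqV _ hr, hℓs _ hqV' _ hr', hℓq, mul_div_mul_right _ _ h2, scale_scale,
      div_mul_cancel₀ _ hr'] at h1
    refine scale_injective hr (hinj (hB hq).1.2 h1 ?_)
    rw [UniqueConormal.mapC_scale 𝓜 hM hqV hr, UniqueConormal.mapC_scale 𝓜 hM hqV' hr, he]
  · rintro q ⟨r, hr, hq⟩
    have h1 := (hB hq).2.2
    rw [mem_ofPred_eq, UniqueConormal.param_eq 𝓜 hM
      (IsParam.scale 𝓜 (𝓜.isParam_param (hUV q r hr hq)) hr)] at h1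
    exact h1

end GeodesicManifold

/-! ### Conjugate points -/

namespace GeodesicManifold

variable {S : Type*} [TopologicalSpace S] [ChartedSpace Plane S] [IsManifold 𝓘(ℝ, Plane) ∞ S]
variable {g : Metric S} (𝓜 : GeodesicManifold g) {M : Set S}

theorem IsParam.segParam_zero {p : ℝ × ℝ} {t₁ : ℝ} {q : Cotangent S}
    (h : 𝓜.IsParam M (p, t₁) q) (t₂ : ℝ) : 𝓜.IsParam M (segParam p t₁ t₂ 0) q := by
  have e : segParam p t₁ t₂ 0 = (p, t₁) := by simp [segParam]
  rwa [e]

theorem IsParam.segParam_one {p : ℝ × ℝ} {t₂ : ℝ} {q : Cotangent S}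
    (h : 𝓜.IsParam M (p, t₂) q) (t₁ : ℝ) : 𝓜.IsParam M (segParam p t₁ t₂ 1) q := by
  have e : segParam p t₁ t₂ 1 = (p, t₂) := by simp [segParam]
  rwa [e]

variable [T2Space S]

/-- A vector in the kernel of a conormal covector and of the contact form vanishes. -/
theorem dPoint_eq_zero {a : (ℝ × ℝ) × ℝ}
    {ξ : TangentSpace 𝓘(ℝ, Plane) (𝓜.γ a.1 a.2) →L[ℝ] ℝ} (h : 𝓜.IsConormal M a.1 a.2 ξ)
    {w : (ℝ × ℝ) × ℝ} (hw : ξ (𝓜.dPoint a w) = 0) (hα : a.1.2 * w.1.1 + w.2 = 0) :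
    𝓜.dPoint a w = 0 := by
  let x₀ := 𝓜.γ a.1 a.2
  have hx : 𝓜.γ a.1 a.2 ∈ (chartAt Plane x₀).source := mem_chart_source _ _
  have ha : a ∈ 𝓜.chartDom x₀ := ⟨⟨h.1, h.2.1⟩, hx⟩
  let q : Cotangent S := ⟨x₀, ξ⟩
  obtain ⟨-, -, -, hz, hzv⟩ := (𝓜.isParam_iff (q₀ := q) (q := q) hx).1 ⟨ξ, h, rfl⟩
  obtain ⟨l, hl⟩ := exists_eq_smul_areaL (𝓜.coordVel_ne_zero _ ha) hzv
  have hl0 : l ≠ 0 := by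
    rintro rfl
    exact hz (by rw [hl, zero_smul])
  have h1 : (extChartAt cotModel q q).2 (toChart x₀ (𝓜.point a) (𝓜.dPoint a w)) = 0 :=
    (cotChart_snd (q₀ := q) (q := q) hx _).trans hw
  rw [hl, _root_.smul_apply, smul_eq_mul, mul_eq_zero, or_iff_right hl0] at h1
  have h2 : 𝓜.coordMom x₀ a (toChart x₀ (𝓜.point a) (𝓜.dPoint a w)) = 0 := by
    rw [𝓜.toChart_dPoint x₀ ha, 𝓜.coordMom_fderiv x₀ ha, hα]
  have h3 : 𝓜.coordMom x₀ a (𝓜.coordVel x₀ a) ≠ 0 := by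
    rw [coordVel, 𝓜.coordMom_fderiv x₀ ha]
    simp
  have h4 := eq_zero_of_areaL_of_apply (𝓜.coordVel_ne_zero _ ha) h3 h1 h2
  exact toChart_injective x₀ (x := 𝓜.point a) (mem_extChartAt_source_iff.2 hx)
    (h4.trans (map_zero _).symm)

/-- The covector that is dual to the derivative of a vanishing variation. -/
theorem UniqueConormal.inner_covDeriv_eq (hM : 𝓜.UniqueConormal M) {p : ℝ × ℝ} (hp : p ∈ 𝓜.W)
    {t₁ t₂ s : ℝ} (hs : s ∈ 𝓜.segmentDom p t₁ t₂)
    {J : ∀ s, TangentSpace 𝓘(ℝ, Plane) (𝓜.segment p t₁ t₂ s)} {m : (ℝ × ℝ) × ℝ}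
    (hJ : ∀ s ∈ 𝓜.segmentDom p t₁ t₂, J s = 𝓜.variationField p t₁ t₂ m 0 s) (h0 : J s = 0)
    {ξ : TangentSpace 𝓘(ℝ, Plane) (𝓜.segment p t₁ t₂ s) →L[ℝ] ℝ}
    (h : 𝓜.IsConormal M p (t₁ + s * (t₂ - t₁)) ξ) {l : ℝ}
    (hm : ∀ w : ℝ × ℝ, dualPairing (𝓜.mapC M ⟨𝓜.segment p t₁ t₂ s, ξ⟩).2 w =
      l * ((t₂ - t₁) * (m.1.2 * w.1 - w.2 * m.1.1))) :
    ξ = l • g.inner (𝓜.segment p t₁ t₂ s) (covDeriv g (𝓜.segment p t₁ t₂) J s) := by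
  refine UniqueConormal.eq_of_dPoint 𝓜 hM (a := segParam p t₁ t₂ s) ⟨hp, hs⟩ h.2.2.1 fun w => ?_
  refine (UniqueConormal.dualPairing_mapC 𝓜 hM (a := segParam p t₁ t₂ s) h w).symm.trans
    ((hm w.1).trans ?_)
  rw [← 𝓜.inner_covDeriv_variationField hp hs hJ h0 w]
  rfl

/-- Covectors at different points of a geodesic with the same image `(p, ŷ, η̂)` under the canonical
map are dual to the derivative of the variation `-η̂ ∂_y γ + ŷ ∂_η γ + η η̂ γ'`, which vanishes at
both points. -/
theorem UniqueConormal.conjugateRelated (hM : 𝓜.UniqueConormal M) {p : ℝ × ℝ} {t₁ t₂ : ℝ}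
    {q₁ q₂ : Cotangent S} (h₁ : 𝓜.IsParam M (p, t₁) q₁) (h₂ : 𝓜.IsParam M (p, t₂) q₂)
    (ht : t₁ ≠ t₂) (hq : 𝓜.mapC M q₁ = 𝓜.mapC M q₂) : 𝓜.ConjugateRelated q₁ q₂ := by
  have hp : p ∈ 𝓜.W := by
    obtain ⟨ξ, h, -⟩ := h₁
    exact h.1
  have ht₁ : t₁ ∈ 𝓜.dom p := by
    obtain ⟨ξ, h, -⟩ := h₁
    exact h.2.1
  have ht₂ : t₂ ∈ 𝓜.dom p := by
    obtain ⟨ξ, h, -⟩ := h₂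
    exact h.2.1
  have hne : (𝓜.mapC M q₁).2 ≠ 0 :=
    UniqueConormal.mapC_snd_ne_zero 𝓜 hM (IsParam.mem_V 𝓜 h₁)
  obtain ⟨ξ₁, hc₁, he₁⟩ := IsParam.segParam_zero 𝓜 h₁ t₂
  obtain ⟨ξ₂, hc₂, he₂⟩ := IsParam.segParam_one 𝓜 h₂ t₁
  have hs0 := 𝓜.zero_mem_segmentDom (t₂ := t₂) ht₁
  have hs1 := 𝓜.one_mem_segmentDom (t₁ := t₁) ht₂
  have hL : t₂ - t₁ ≠ 0 := sub_ne_zero.2 ht.symm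
  obtain ⟨z, hz⟩ : ∃ z, z = (𝓜.mapC M q₁).2 := ⟨_, rfl⟩
  let m : (ℝ × ℝ) × ℝ := ((-z.2, z.1), p.2 * z.2)
  have hz₁ : (𝓜.mapC M ⟨𝓜.segment p t₁ t₂ 0, ξ₁⟩).2 = z := by
    rw [hz, he₁]
    rfl
  have hz₂ : (𝓜.mapC M ⟨𝓜.segment p t₁ t₂ 1, ξ₂⟩).2 = z := by
    rw [hz, hq, he₂]
    rfl
  have hJ0 : 𝓜.variationField p t₁ t₂ m 0 0 = 0 := by
    rw [variationField_zero_eq]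
    refine 𝓜.dPoint_eq_zero hc₁ ?_ ?_
    · rw [← UniqueConormal.dualPairing_mapC 𝓜 hM hc₁, dualPairing_apply]
      have e : (𝓜.mapC M ⟨𝓜.γ (segParam p t₁ t₂ 0).1 (segParam p t₁ t₂ 0).2, ξ₁⟩).2 = z := hz₁
      rw [e]
      simp only [m]
      ring
    · simp only [m, segParam]
      ring
  have hJ1 : 𝓜.variationField p t₁ t₂ m 0 1 = 0 := by
    rw [variationField_zero_eq]
    refine 𝓜.dPoint_eq_zero hc₂ ?_ ?_
    · rw [← UniqueConormal.dualPairing_mapC 𝓜 hM hc₂, dualPairing_apply]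
      have e : (𝓜.mapC M ⟨𝓜.γ (segParam p t₁ t₂ 1).1 (segParam p t₁ t₂ 1).2, ξ₂⟩).2 = z := hz₂
      rw [e]
      simp only [m]
      ring
    · simp only [m, segParam]
      ring
  -- The factor `λ = (t₂ - t₁)⁻¹` compensates the speed of the segment.
  have hm : ∀ w : ℝ × ℝ, dualPairing z w =
      (t₂ - t₁)⁻¹ * ((t₂ - t₁) * (m.1.2 * w.1 - w.2 * m.1.1)) := by
    intro w
    rw [dualPairing_apply, inv_mul_cancel_left₀ hL]
    simp only [m]
    ring
  refine ⟨p, hp, t₁, ht₁, t₂, ht₂, ht, 𝓜.variationField p t₁ t₂ m 0,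
    ⟨𝓜.isJacobiOn_variationField hp t₁ t₂ m 0, ?_, hJ0, hJ1⟩, (t₂ - t₁)⁻¹, inv_ne_zero hL, ?_, ?_⟩
  · by_contra! hcon
    -- If the variation vanished identically, then so would the dual of its derivative.
    have h4 : ∀ s ∈ 𝓜.segmentDom p t₁ t₂, 𝓜.variationField p t₁ t₂ m 0 s =
        𝓜.variationField p t₁ t₂ 0 0 s := by
      intro s hs
      rw [hcon s hs, variationField_zero_eq]
      exact (map_zero _).symm
    have h5 : ∀ w : ℝ × ℝ, dualPairing z w = 0 := by
      intro w
      rw [hm w, ← 𝓜.inner_covDeriv_variationField hp hs0 (m := m) (fun _ _ => rfl) hJ0 (w, 0),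
        𝓜.inner_covDeriv_variationField hp hs0 h4 hJ0 (w, 0)]
      simp
    have e1 := h5 (1, 0)
    have e2 := h5 (0, 1)
    simp only [dualPairing_apply] at e1 e2
    exact hne (hz.symm.trans (Prod.ext (by simpa using e1) (by simpa using e2)))
  · rw [he₁]
    refine congrArg (Bundle.TotalSpace.mk (𝓜.segment p t₁ t₂ 0)) ?_
    refine UniqueConormal.inner_covDeriv_eq 𝓜 hM hp hs0 (fun _ _ => rfl) hJ0 hc₁ fun w => ?_
    rw [hz₁, hm]
  · rw [he₂]
    refine congrArg (Bundle.TotalSpace.mk (𝓜.segment p t₁ t₂ 1)) ?_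
    refine UniqueConormal.inner_covDeriv_eq 𝓜 hM hp hs1 (fun _ _ => rfl) hJ1 hc₂ fun w => ?_
    rw [hz₂, hm]

/-- The canonical map at a covector dual to the derivative of a vanishing variation. -/
theorem UniqueConormal.mapC_covDeriv (hM : 𝓜.UniqueConormal M) {p : ℝ × ℝ} (hp : p ∈ 𝓜.W)
    {t₁ t₂ s : ℝ} (hs : s ∈ 𝓜.segmentDom p t₁ t₂)
    {J : ∀ s, TangentSpace 𝓘(ℝ, Plane) (𝓜.segment p t₁ t₂ s)} {m : (ℝ × ℝ) × ℝ}
    (hJ : ∀ s ∈ 𝓜.segmentDom p t₁ t₂, J s = 𝓜.variationField p t₁ t₂ m 0 s) (h0 : J s = 0)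
    {l : ℝ} {q : Cotangent S} (hq : q ∈ 𝓜.V M) (he : q = ⟨𝓜.segment p t₁ t₂ s,
      l • g.inner (𝓜.segment p t₁ t₂ s) (covDeriv g (𝓜.segment p t₁ t₂) J s)⟩) :
    𝓜.mapC M q = (p, (l * ((t₂ - t₁) * m.1.2), -(l * ((t₂ - t₁) * m.1.1)))) := by
  have h1 := IsParam.proj_mem 𝓜 (𝓜.isParam_param hq)
  have h2 := 𝓜.snd_ne_zero_of_mem_V hq
  subst he
  have ha : segParam p t₁ t₂ s ∈ 𝓜.pointDom := ⟨hp, hs⟩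
  have key := fun w => 𝓜.inner_covDeriv_variationField hp hs hJ h0 w
  have hc : 𝓜.IsConormal M p (t₁ + s * (t₂ - t₁))
      (l • g.inner (𝓜.segment p t₁ t₂ s) (covDeriv g (𝓜.segment p t₁ t₂) J s)) := by
    refine ⟨hp, hs, h1, h2, ?_⟩
    rw [𝓜.velocity_eq ha]
    refine (congrArg (fun x => l * x) (key (0, 1))).trans ?_
    simp
  refine (UniqueConormal.mapC_eq 𝓜 hM hc).trans ?_
  rw [𝓜.dy_eq ha, 𝓜.dη_eq ha]
  refine congrArg (Prod.mk p) (Prod.ext ?_ ?_)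
  · refine (congrArg (fun x => l * x) (key ((1, 0), 0))).trans ?_
    simp
  · refine (congrArg (fun x => l * x) (key ((0, 1), 0))).trans ?_
    simp

theorem UniqueConormal.mapC_eq_of_conjugateRelated (hM : 𝓜.UniqueConormal M)
    {q₁ q₂ : Cotangent S} (hq₁ : q₁ ∈ 𝓜.V M) (hq₂ : q₂ ∈ 𝓜.V M)
    (h : 𝓜.ConjugateRelated q₁ q₂) : 𝓜.mapC M q₁ = 𝓜.mapC M q₂ := by
  obtain ⟨p, hp, t₁, ht₁, t₂, ht₂, ht, J, ⟨hJ, -, hJ0, hJ1⟩, l, -, e₁, e₂⟩ := h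
  obtain ⟨a, b, h⟩ := 𝓜.exists_eq_variationField_of_eq_zero hp ht₁ ht₂ ht hJ hJ0 hJ1
  rw [UniqueConormal.mapC_covDeriv 𝓜 hM hp (𝓜.zero_mem_segmentDom ht₁) h hJ0 hq₁ e₁,
    UniqueConormal.mapC_covDeriv 𝓜 hM hp (𝓜.one_mem_segmentDom ht₂) h hJ1 hq₂ e₂]

end GeodesicManifold

/-! ### The map `𝒞₂₁` and its graph -/

section Chart

variable {S : Type*} [TopologicalSpace S] [ChartedSpace Plane S] [IsManifold 𝓘(ℝ, Plane) ∞ S]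

theorem isEmbedding_cotChart_symm (q : Cotangent S) {O : Set (Plane × (Plane →L[ℝ] ℝ))}
    (hO : O ⊆ (extChartAt cotModel q).target) :
    Topology.IsEmbedding (O.domRestrict (extChartAt cotModel q).symm) := by
  let e : OpenPartialHomeomorph (Plane × (Plane →L[ℝ] ℝ)) (Cotangent S) :=
    { toPartialEquiv := (extChartAt cotModel q).symm
      open_source := isOpen_extChartAt_target q
      open_target := isOpen_extChartAt_source q
      continuousOn_toFun := continuousOn_extChartAt_symm q
      continuousOn_invFun := continuousOn_extChartAt q }
  exact Topology.IsEmbedding.subtypeVal.comp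
    (e.toHomeomorphSourceTarget.isEmbedding.comp (Topology.IsEmbedding.inclusion hO))

theorem eq_zero_of_mfderiv_cotChart_symm {q : Cotangent S} {z : Plane × (Plane →L[ℝ] ℝ)}
    (hz : z ∈ (extChartAt cotModel q).target)
    {v : TangentSpace 𝓘(ℝ, Plane × (Plane →L[ℝ] ℝ)) z}
    (hv : mfderiv 𝓘(ℝ, Plane × (Plane →L[ℝ] ℝ)) cotModel (extChartAt cotModel q).symm z v = 0) :
    v = 0 := by
  have h := mfderiv_extChartAt_comp_mfderivWithin_extChartAt_symm (I := cotModel) hz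
  rw [ModelWithCorners.range_eq_univ, mfderivWithin_univ] at h
  have h1 := congrArg (fun L : (Plane × (Plane →L[ℝ] ℝ)) →L[ℝ] (Plane × (Plane →L[ℝ] ℝ)) => L v) h
  refine Eq.trans h1.symm ?_
  refine (congrArg (mfderiv cotModel 𝓘(ℝ, Plane × (Plane →L[ℝ] ℝ)) (extChartAt cotModel q)
    ((extChartAt cotModel q).symm z)) hv).trans (map_zero _)

end Chart

namespace GeodesicManifold

variable {S : Type*} [TopologicalSpace S] [ChartedSpace Plane S] [IsManifold 𝓘(ℝ, Plane) ∞ S]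
variable {g : Metric S} (𝓜 : GeodesicManifold g) {M : Set S} {V₁ V₂ : Set (Cotangent S)}

theorem mapC21_mem (h : 𝓜.mapC M '' V₁ ⊆ 𝓜.mapC M '' V₂) {q : Cotangent S} (hq : q ∈ V₁) :
    𝓜.mapC21 M V₂ q ∈ V₂ ∧ 𝓜.mapC M (𝓜.mapC21 M V₂ q) = 𝓜.mapC M q := by
  have h1 : ∃ a ∈ V₂, 𝓜.mapC M a = 𝓜.mapC M q := h (mem_image_of_mem _ hq)
  have : Nonempty (Cotangent S) := ⟨q⟩
  exact ⟨Function.invFunOn_mem h1, Function.invFunOn_eq h1⟩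

theorem mapC21_eq_iff (h : 𝓜.mapC M '' V₁ ⊆ 𝓜.mapC M '' V₂) (hinj : InjOn (𝓜.mapC M) V₂)
    {q q' : Cotangent S} (hq : q ∈ V₁) (hq' : q' ∈ V₂) :
    𝓜.mapC21 M V₂ q = q' ↔ 𝓜.mapC M q = 𝓜.mapC M q' := by
  have h1 := 𝓜.mapC21_mem h hq
  constructor
  · rintro rfl
    exact h1.2.symm
  · intro he
    exact hinj h1.1 hq' (h1.2.trans he)

variable [T2Space S]

theorem UniqueConormal.contMDiffOn_mapC21 (hM : 𝓜.UniqueConormal M)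
    (h : 𝓜.mapC M '' V₁ ⊆ 𝓜.mapC M '' V₂) (hV₁ : V₁ ⊆ 𝓜.V M) (hV₂ : V₂ ⊆ 𝓜.V M)
    (ho : IsOpen V₁) (ho₂ : IsOpen V₂) (hinj : InjOn (𝓜.mapC M) V₂) :
    ContMDiffOn cotModel cotModel ∞ (𝓜.mapC21 M V₂) V₁ := by
  intro q hq
  obtain ⟨hm, he⟩ := 𝓜.mapC21_mem h hq
  obtain ⟨N, hNV, -, hqN, -, -, hNo, Ψ, hΨ, hΨe⟩ :=
    UniqueConormal.exists_local_inverse 𝓜 hM (hV₂ hm) (ho₂.mem_nhds hm)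
  have hn : 𝓜.mapC M '' N ∈ 𝓝 (𝓜.mapC M q) := by
    rw [← he]
    exact hNo.mem_nhds (mem_image_of_mem _ hqN)
  have hc := UniqueConormal.contMDiffAt_mapC 𝓜 hM (hV₁ hq)
  refine ContMDiffAt.contMDiffWithinAt (((hΨ.contMDiffAt hn).comp q hc).congr_of_eventuallyEq ?_)
  filter_upwards [hc.continuousAt.preimage_mem_nhds hn, ho.mem_nhds hq] with r hr hr'
  obtain ⟨b, hb, hbr⟩ := hr
  simp only [Function.comp]
  rw [← hbr, hΨe b hb]
  exact (𝓜.mapC21_eq_iff h hinj hr' (hNV hb)).2 hbr.symm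

theorem UniqueConormal.isDiffeoOn_mapC21 (hM : 𝓜.UniqueConormal M)
    (h : 𝓜.mapC M '' V₁ = 𝓜.mapC M '' V₂) (hV₁ : V₁ ⊆ 𝓜.V M) (hV₂ : V₂ ⊆ 𝓜.V M)
    (ho₁ : IsOpen V₁) (ho₂ : IsOpen V₂) (hinj₁ : InjOn (𝓜.mapC M) V₁)
    (hinj₂ : InjOn (𝓜.mapC M) V₂) : IsDiffeoOn (𝓜.mapC21 M V₂) V₁ V₂ := by
  have hinv : InvOn (𝓜.mapC21 M V₁) (𝓜.mapC21 M V₂) V₁ V₂ := by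
    constructor
    · intro q hq
      have h1 := 𝓜.mapC21_mem h.subset hq
      exact (𝓜.mapC21_eq_iff h.superset hinj₁ h1.1 hq).2 h1.2
    · intro q hq
      have h1 := 𝓜.mapC21_mem h.superset hq
      exact (𝓜.mapC21_eq_iff h.subset hinj₂ h1.1 hq).2 h1.2
  exact ⟨hinv.bijOn (fun q hq => (𝓜.mapC21_mem h.subset hq).1)
    (fun q hq => (𝓜.mapC21_mem h.superset hq).1),
    UniqueConormal.contMDiffOn_mapC21 𝓜 hM h.subset hV₁ hV₂ ho₁ ho₂ hinj₂, 𝓜.mapC21 M V₁, hinv,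
    UniqueConormal.contMDiffOn_mapC21 𝓜 hM h.superset hV₂ hV₁ ho₂ ho₁ hinj₁⟩

/-- The graph of `𝒞₂₁` is a canonical relation: it is given by the equation `𝒞(x, ξ) = 𝒞(y, ζ)`,
and `𝒞` preserves the symplectic forms. -/
theorem UniqueConormal.isCanonicalRelation_mapC21 (hM : 𝓜.UniqueConormal M)
    (h : 𝓜.mapC M '' V₁ = 𝓜.mapC M '' V₂) (hV₁ : V₁ ⊆ 𝓜.V M) (hV₂ : V₂ ⊆ 𝓜.V M)
    (ho₁ : IsOpen V₁) (ho₂ : IsOpen V₂) (hcon₁ : IsConic V₁) (hcon₂ : IsConic V₂)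
    (hinj₂ : InjOn (𝓜.mapC M) V₂) :
    IsCanonicalRelation {a | a.2 ∈ V₁ ∧ a.1 = 𝓜.mapC21 M V₂ a.2} (V₂ ×ˢ V₁) := by
  have hsm := UniqueConormal.contMDiffOn_mapC21 𝓜 hM h.subset hV₁ hV₂ ho₁ ho₂ hinj₂
  set Λ : Set (Cotangent S × Cotangent S) := {a | a.2 ∈ V₁ ∧ a.1 = 𝓜.mapC21 M V₂ a.2} with hΛ
  have hmem : ∀ a ∈ Λ, a.1 ∈ V₂ ∧ a.2 ∈ V₁ ∧ 𝓜.mapC M a.1 = 𝓜.mapC M a.2 := by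
    rintro a ⟨hb, ha⟩
    have h1 := 𝓜.mapC21_mem h.subset hb
    rw [← ha] at h1
    exact ⟨h1.1, hb, h1.2⟩
  have hmem' : ∀ a : Cotangent S × Cotangent S, a.1 ∈ V₂ → a.2 ∈ V₁ →
      𝓜.mapC M a.1 = 𝓜.mapC M a.2 → a ∈ Λ := fun a h1 h2 h3 =>
    ⟨h2, ((𝓜.mapC21_eq_iff h.subset hinj₂ h2 h1).2 h3.symm).symm⟩
  refine ⟨fun q hq => ?_, ⟨closure Λ, isClosed_closure, ?_⟩, fun q hq r hr => ?_, fun q hq => ?_⟩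
  · obtain ⟨h1, h2, -⟩ := hmem q hq
    exact ⟨𝓜.snd_ne_zero_of_mem_V (hV₂ h1), 𝓜.snd_ne_zero_of_mem_V (hV₁ h2)⟩
  -- The graph is relatively closed because `𝒞` is continuous.
  · refine Subset.antisymm (fun a ha => ⟨subset_closure ha, (hmem a ha).1, (hmem a ha).2.1⟩) ?_
    rintro a ⟨ha, h1, h2⟩
    refine hmem' a h1 h2 ?_
    have : (𝓝[Λ] a).NeBot := mem_closure_iff_nhdsWithin_neBot.1 ha
    have c1 : ContinuousAt (fun a : Cotangent S × Cotangent S => 𝓜.mapC M a.1) a :=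
      ContinuousAt.comp (g := 𝓜.mapC M)
        (UniqueConormal.contMDiffAt_mapC 𝓜 hM (hV₂ h1)).continuousAt continuous_fst.continuousAt
    have c2 : ContinuousAt (fun a : Cotangent S × Cotangent S => 𝓜.mapC M a.2) a :=
      ContinuousAt.comp (g := 𝓜.mapC M)
        (UniqueConormal.contMDiffAt_mapC 𝓜 hM (hV₁ h2)).continuousAt continuous_snd.continuousAt
    refine tendsto_nhds_unique (c1.tendsto.mono_left (nhdsWithin_le_nhds (s := Λ)))
      ((c2.tendsto.mono_left nhdsWithin_le_nhds).congr' ?_)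
    filter_upwards [self_mem_nhdsWithin] with b hb
    exact (hmem b hb).2.2.symm
  · obtain ⟨h1, h2, h3⟩ := hmem q hq
    refine hmem' _ (hcon₂ _ h1 r hr) (hcon₁ _ h2 r hr) ?_
    simp only
    rw [UniqueConormal.mapC_scale 𝓜 hM (hV₂ h1) hr.ne',
      UniqueConormal.mapC_scale 𝓜 hM (hV₁ h2) hr.ne', h3]
  · obtain ⟨h1, h2, h3⟩ := hmem q hq
    set C := extChartAt cotModel q.2 with hC
    have hO : IsOpen (C.target ∩ C.symm ⁻¹' V₁) :=
      (continuousOn_extChartAt_symm (I := cotModel) q.2).isOpen_inter_preimage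
        (isOpen_extChartAt_target q.2) ho₁
    have hψ : ContMDiffOn 𝓘(ℝ, Plane × (Plane →L[ℝ] ℝ)) cotModel ∞ C.symm
        (C.target ∩ C.symm ⁻¹' V₁) :=
      (contMDiffOn_extChartAt_symm (I := cotModel) q.2).mono inter_subset_left
    have hφ : ContMDiffOn 𝓘(ℝ, Plane × (Plane →L[ℝ] ℝ)) cotModel ∞
        (fun z => 𝓜.mapC21 M V₂ (C.symm z)) (C.target ∩ C.symm ⁻¹' V₁) :=
      hsm.comp hψ fun z hz => hz.2
    -- The graph is parametrized by canonical coordinates of the second factor.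
    refine ⟨C.target ∩ C.symm ⁻¹' V₁, univ ×ˢ (C.source ∩ V₁), fun z => 𝓜.mapC21 M V₂ (C.symm z),
      C.symm, hO, isOpen_univ.prod ((isOpen_extChartAt_source q.2).inter ho₁),
      ⟨mem_univ _, mem_extChartAt_source q.2, h2⟩, ?_, ?_, hφ, hψ, fun z hz => ⟨?_, ?_⟩⟩
    · ext a
      constructor
      · rintro ⟨z, hz, rfl⟩
        exact ⟨⟨hz.2, rfl⟩, mem_univ _, C.map_target hz.1, hz.2⟩
      · rintro ⟨ha, -, ha1, ha2⟩
        have h4 := C.left_inv ha1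
        refine ⟨C a.2, ⟨C.map_source ha1, ?_⟩, ?_⟩
        · rw [mem_preimage, h4]
          exact ha2
        · simp only
          rw [h4]
          exact Prod.ext ha.2.symm rfl
    · refine Topology.IsEmbedding.of_comp ?_ continuous_snd
        (isEmbedding_cotChart_symm q.2 inter_subset_left)
      exact continuousOn_iff_continuous_domRestrict.1 (hφ.continuousOn.prodMk hψ.continuousOn)
    · intro v _ hv
      exact eq_zero_of_mfderiv_cotChart_symm hz.1 hv
    · intro v w
      have hn := hO.mem_nhds hz
      have hz1 := 𝓜.mapC21_mem h.subset hz.2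
      have d1 := ((UniqueConormal.contMDiffAt_mapC 𝓜 hM (hV₂ hz1.1)).mdifferentiableAt
        (by simp)).hasMFDerivAt.comp z ((hφ.contMDiffAt hn).mdifferentiableAt
          (by simp)).hasMFDerivAt
      have d2 := ((UniqueConormal.contMDiffAt_mapC 𝓜 hM (hV₁ hz.2)).mdifferentiableAt
        (by simp)).hasMFDerivAt.comp z ((hψ.contMDiffAt hn).mdifferentiableAt
          (by simp)).hasMFDerivAt
      -- Both components of the parametrization have the same composition with `𝒞`.
      have he : (𝓜.mapC M ∘ fun z => 𝓜.mapC21 M V₂ (C.symm z)) =ᶠ[𝓝 z] 𝓜.mapC M ∘ C.symm := by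
        filter_upwards [hn] with y hy
        exact (𝓜.mapC21_mem h.subset hy.2).2
      have hd := hasMFDerivAt_unique d1 (d2.congr_of_eventuallyEq he)
      rw [UniqueConormal.symplecticForm_eq 𝓜 hM (hV₂ hz1.1),
        UniqueConormal.symplecticForm_eq 𝓜 hM (hV₁ hz.2), sub_eq_zero]
      have hdv : ∀ v : Plane × (Plane →L[ℝ] ℝ), _ := fun v => congrArg
        (fun L : (Plane × (Plane →L[ℝ] ℝ)) →L[ℝ] ((ℝ × ℝ) × (ℝ × ℝ)) => L v) hd
      exact congrArg₂ symplecticGeod (hdv v) (hdv w)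

/-- Small conic neighborhoods with equal images under the canonical map. -/
theorem UniqueConormal.exists_image_eq (hM : 𝓜.UniqueConormal M) {A₁ A₂ : Set (Cotangent S)}
    (hA₁ : A₁ ⊆ 𝓜.V M) (hA₂ : A₂ ⊆ 𝓜.V M) (ho₁ : IsOpen A₁) (ho₂ : IsOpen A₂)
    (hc₁ : IsConic A₁) (hc₂ : IsConic A₂) (he₁ : IsEven A₁) (he₂ : IsEven A₂)
    {q₁ q₂ : Cotangent S} (hq₁ : q₁ ∈ A₁) (hq₂ : q₂ ∈ A₂) (hq : 𝓜.mapC M q₁ = 𝓜.mapC M q₂) :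
    ∃ V₁ ⊆ A₁, ∃ V₂ ⊆ A₂,
      IsOpen V₁ ∧ IsConic V₁ ∧ IsEven V₁ ∧ q₁ ∈ V₁ ∧ IsOpen V₂ ∧ IsConic V₂ ∧ IsEven V₂ ∧ q₂ ∈ V₂ ∧
        𝓜.mapC M '' V₁ = 𝓜.mapC M '' V₂ := by
  set N := 𝓜.mapC M '' A₁ ∩ 𝓜.mapC M '' A₂ with hN
  have hNo : IsOpen N := (UniqueConormal.isOpen_image_mapC 𝓜 hM ho₁ hA₁).inter
    (UniqueConormal.isOpen_image_mapC 𝓜 hM ho₂ hA₂)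
  have hNs : ∀ z ∈ N, ∀ r : ℝ, (∀ q ∈ A₁, scale r q ∈ A₁) → (∀ q ∈ A₂, scale r q ∈ A₂) → r ≠ 0 →
      (z.1, r • z.2) ∈ N := by
    rintro z ⟨⟨a, ha, rfl⟩, b, hb, hab⟩ r h1 h2 hr
    refine ⟨⟨scale r a, h1 a ha, UniqueConormal.mapC_scale 𝓜 hM (hA₁ ha) hr⟩, scale r b, h2 b hb, ?_⟩
    rw [← hab]
    exact UniqueConormal.mapC_scale 𝓜 hM (hA₂ hb) hr
  have key : ∀ {A : Set (Cotangent S)}, A ⊆ 𝓜.V M → IsOpen A →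
      IsOpen (A ∩ 𝓜.mapC M ⁻¹' N) ∧ ∀ q ∈ A ∩ 𝓜.mapC M ⁻¹' N, ∀ r : ℝ,
        (∀ q ∈ A, scale r q ∈ A) → (∀ q ∈ A₁, scale r q ∈ A₁) → (∀ q ∈ A₂, scale r q ∈ A₂) →
        r ≠ 0 → scale r q ∈ A ∩ 𝓜.mapC M ⁻¹' N := by
    intro A hA hAo
    refine ⟨ContinuousOn.isOpen_inter_preimage (fun q hq =>
      (UniqueConormal.contMDiffAt_mapC 𝓜 hM (hA hq)).continuousAt.continuousWithinAt) hAo hNo, ?_⟩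
    intro q hq r h1 h2 h3 hr
    refine ⟨h1 q hq.1, ?_⟩
    rw [mem_preimage, UniqueConormal.mapC_scale 𝓜 hM (hA hq.1) hr]
    exact hNs _ hq.2 r h2 h3 hr
  have him : ∀ {A : Set (Cotangent S)}, N ⊆ 𝓜.mapC M '' A →
      𝓜.mapC M '' (A ∩ 𝓜.mapC M ⁻¹' N) = N := by
    intro A hA
    rw [image_inter_preimage, inter_eq_right]
    exact hA
  have hm1 : 𝓜.mapC M q₁ ∈ N := ⟨mem_image_of_mem _ hq₁, hq ▸ mem_image_of_mem _ hq₂⟩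
  have hm2 : 𝓜.mapC M q₂ ∈ N := hq ▸ hm1
  refine ⟨A₁ ∩ 𝓜.mapC M ⁻¹' N, inter_subset_left, A₂ ∩ 𝓜.mapC M ⁻¹' N, inter_subset_left,
    (key hA₁ ho₁).1, ?_, ?_, ⟨hq₁, hm1⟩, (key hA₂ ho₂).1, ?_, ?_, ⟨hq₂, hm2⟩,
    (him inter_subset_left).trans (him inter_subset_right).symm⟩
  · exact fun q hq r hr => (key hA₁ ho₁).2 q hq r (fun q hq => hc₁ q hq r hr)
      (fun q hq => hc₁ q hq r hr) (fun q hq => hc₂ q hq r hr) hr.ne'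
  · exact fun q hq => (key hA₁ ho₁).2 q hq (-1) he₁ he₁ he₂ (by norm_num)
  · exact fun q hq r hr => (key hA₂ ho₂).2 q hq r (fun q hq => hc₂ q hq r hr)
      (fun q hq => hc₁ q hq r hr) (fun q hq => hc₂ q hq r hr) hr.ne'
  · exact fun q hq => (key hA₂ ho₂).2 q hq (-1) he₂ he₁ he₂ (by norm_num)

end GeodesicManifold

end XRay

end

theorem mainTheorem7 {S : Type*} [TopologicalSpace S] [T2Space S]
    [ChartedSpace XRay.Plane S] [IsManifold 𝓘(ℝ, XRay.Plane) ∞ S]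
    (g : XRay.Metric S) (M : Set S) (𝓜 : XRay.GeodesicManifold g)
    (hM : 𝓜.UniqueConormal M)
    (q₁ q₂ : XRay.Cotangent S) (hq₁ : q₁ ∈ 𝓜.V M) (hq₂ : q₂ ∈ 𝓜.V M) (hne : q₁ ≠ q₂)
    (hq : 𝓜.mapC M q₁ = 𝓜.mapC M q₂) :
    𝓜.ConjugacyFieldUnique ∧
    ∃ U₁ U₂ : Set (XRay.Cotangent S),
      IsOpen U₁ ∧ XRay.IsConic U₁ ∧ XRay.IsEven U₁ ∧ q₁ ∈ U₁ ∧ U₁ ⊆ 𝓜.V M ∧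
      IsOpen U₂ ∧ XRay.IsConic U₂ ∧ XRay.IsEven U₂ ∧ q₂ ∈ U₂ ∧ U₂ ⊆ 𝓜.V M ∧
      -- arbitrarily small conic neighborhoods with equal images exist
      (∀ U₁' U₂' : Set (XRay.Cotangent S),
        IsOpen U₁' → XRay.IsConic U₁' → XRay.IsEven U₁' → q₁ ∈ U₁' →
        IsOpen U₂' → XRay.IsConic U₂' → XRay.IsEven U₂' → q₂ ∈ U₂' →
        ∃ V₁ V₂ : Set (XRay.Cotangent S), V₁ ⊆ U₁ ∩ U₁' ∧ V₂ ⊆ U₂ ∩ U₂' ∧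
          IsOpen V₁ ∧ XRay.IsConic V₁ ∧ XRay.IsEven V₁ ∧ q₁ ∈ V₁ ∧
          IsOpen V₂ ∧ XRay.IsConic V₂ ∧ XRay.IsEven V₂ ∧ q₂ ∈ V₂ ∧
          𝓜.mapC M '' V₁ = 𝓜.mapC M '' V₂) ∧
      -- and for all of them the map is a diffeomorphism and a canonical relation
      ∀ V₁ V₂ : Set (XRay.Cotangent S), V₁ ⊆ U₁ → V₂ ⊆ U₂ →
        IsOpen V₁ → XRay.IsConic V₁ → q₁ ∈ V₁ →
        IsOpen V₂ → XRay.IsConic V₂ → q₂ ∈ V₂ →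
        𝓜.mapC M '' V₁ = 𝓜.mapC M '' V₂ →
        Set.InjOn (𝓜.mapC M) V₁ ∧ Set.InjOn (𝓜.mapC M) V₂ ∧
        XRay.IsDiffeoOn (𝓜.mapC21 M V₂) V₁ V₂ ∧
        XRay.IsCanonicalRelation {a | a.2 ∈ V₁ ∧ a.1 = 𝓜.mapC21 M V₂ a.2} (V₂ ×ˢ V₁) ∧
        𝓜.mapC21 M V₂ q₁ = q₂ ∧
        ∀ r₁ ∈ V₁, ∀ r₂ ∈ V₂, 𝓜.mapC21 M V₂ r₁ = r₂ ↔ 𝓜.ConjugateRelated r₁ r₂ := by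
  refine ⟨𝓜.conjugacyFieldUnique, ?_⟩
  have ha₁ := 𝓜.isParam_param hq₁
  have ha₂ := 𝓜.isParam_param hq₂
  have hp : (𝓜.param M q₁).1 = (𝓜.param M q₂).1 := by
    rw [← XRay.GeodesicManifold.UniqueConormal.mapC_fst 𝓜 hM ha₁,
      ← XRay.GeodesicManifold.UniqueConormal.mapC_fst 𝓜 hM ha₂, hq]
  have ht : (𝓜.param M q₁).2 ≠ (𝓜.param M q₂).2 := by
    intro h
    have h1 : 𝓜.param M q₁ = 𝓜.param M q₂ := Prod.ext hp h
    exact hne (XRay.GeodesicManifold.UniqueConormal.eq_of_isParam 𝓜 hM ha₁ (h1 ▸ ha₂) hq)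
  -- With this choice of `ε`, covectors in `U₁` and `U₂` are conormal at different times.
  obtain ⟨ε, hε, hεt⟩ : ∃ ε > 0, 2 * ε = |(𝓜.param M q₁).2 - (𝓜.param M q₂).2| :=
    ⟨|(𝓜.param M q₁).2 - (𝓜.param M q₂).2| / 2, half_pos (abs_pos.2 (sub_ne_zero.2 ht)), by ring⟩
  obtain ⟨U₁, ho₁, hc₁, he₁, hm₁, hV₁, hi₁, ht₁⟩ :=
    XRay.GeodesicManifold.UniqueConormal.exists_conic_nhd 𝓜 hM hq₁ hε
  obtain ⟨U₂, ho₂, hc₂, he₂, hm₂, hV₂, hi₂, ht₂⟩ :=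
    XRay.GeodesicManifold.UniqueConormal.exists_conic_nhd 𝓜 hM hq₂ hε
  refine ⟨U₁, U₂, ho₁, hc₁, he₁, hm₁, hV₁, ho₂, hc₂, he₂, hm₂, hV₂, ?_, ?_⟩
  · intro U₁' U₂' ho₁' hc₁' he₁' hm₁' ho₂' hc₂' he₂' hm₂'
    obtain ⟨V₁, hVU₁, V₂, hVU₂, h⟩ := XRay.GeodesicManifold.UniqueConormal.exists_image_eq 𝓜 hM
      (A₁ := U₁ ∩ U₁') (A₂ := U₂ ∩ U₂') (Set.inter_subset_left.trans hV₁)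
      (Set.inter_subset_left.trans hV₂) (ho₁.inter ho₁') (ho₂.inter ho₂')
      (fun q hq r hr => ⟨hc₁ q hq.1 r hr, hc₁' q hq.2 r hr⟩)
      (fun q hq r hr => ⟨hc₂ q hq.1 r hr, hc₂' q hq.2 r hr⟩)
      (fun q hq => ⟨he₁ q hq.1, he₁' q hq.2⟩) (fun q hq => ⟨he₂ q hq.1, he₂' q hq.2⟩)
      ⟨hm₁, hm₁'⟩ ⟨hm₂, hm₂'⟩ hq
    exact ⟨V₁, V₂, hVU₁, hVU₂, h⟩
  · intro V₁ V₂ hVU₁ hVU₂ hVo₁ hVc₁ hVm₁ hVo₂ hVc₂ hVm₂ him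
    have hj₁ := hi₁.mono hVU₁
    have hj₂ := hi₂.mono hVU₂
    have hW₁ := hVU₁.trans hV₁
    have hW₂ := hVU₂.trans hV₂
    refine ⟨hj₁, hj₂,
      XRay.GeodesicManifold.UniqueConormal.isDiffeoOn_mapC21 𝓜 hM him hW₁ hW₂ hVo₁ hVo₂ hj₁ hj₂,
      XRay.GeodesicManifold.UniqueConormal.isCanonicalRelation_mapC21 𝓜 hM him hW₁ hW₂ hVo₁ hVo₂
        hVc₁ hVc₂ hj₂,
      (𝓜.mapC21_eq_iff him.subset hj₂ hVm₁ hVm₂).2 hq, fun r₁ hr₁ r₂ hr₂ => ?_⟩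
    rw [𝓜.mapC21_eq_iff him.subset hj₂ hr₁ hr₂]
    constructor
    · intro h
      have hb₁ := 𝓜.isParam_param (hW₁ hr₁)
      have hb₂ := 𝓜.isParam_param (hW₂ hr₂)
      have hp' : (𝓜.param M r₁).1 = (𝓜.param M r₂).1 := by
        rw [← XRay.GeodesicManifold.UniqueConormal.mapC_fst 𝓜 hM hb₁,
          ← XRay.GeodesicManifold.UniqueConormal.mapC_fst 𝓜 hM hb₂, h]
      have hne' : (𝓜.param M r₁).2 ≠ (𝓜.param M r₂).2 := by
        intro he
        have d₁ := ht₁ r₁ (hVU₁ hr₁)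
        have d₂ := ht₂ r₂ (hVU₂ hr₂)
        rw [← he, abs_sub_comm] at d₂
        rw [abs_sub_comm] at d₁
        have d₃ := abs_sub_le (𝓜.param M q₁).2 (𝓜.param M r₁).2 (𝓜.param M q₂).2
        rw [abs_sub_comm] at d₂
        linarith
      have hb₂' : 𝓜.IsParam M ((𝓜.param M r₁).1, (𝓜.param M r₂).2) r₂ := by
        rw [hp']
        exact hb₂
      exact XRay.GeodesicManifold.UniqueConormal.conjugateRelated 𝓜 hM hb₁ hb₂' hne' h
    · exact XRay.GeodesicManifold.UniqueConormal.mapC_eq_of_conjugateRelated 𝓜 hM (hW₁ hr₁)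
        (hW₂ hr₂)
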